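/- Let $t_-<t_+$ and let $r:(t_-,t_+)\to(0,\infty)$ be smooth and concave. Let $$S=\{(r(s)\cos\theta,\,r(s)\sin\theta,\,s):\theta\in\mathbb R,\ t_-<s<t_+\}\subset\mathbb R^3$$ be the corresponding weakly convex rotationally symmetric surface, with its Euclidean induced metric $\bar\sigma$, outward unit normal $\bar X$, mean curvature $\bar H_{\partial M}$ (with respect to $\bar X$), and let $\bar\gamma\in[0,\pi]$ be defined by $\cos\bar\gamma=\langle\bar X,\partial/\partial x^3\rangle$. Let $(M,g)$ be a smooth Riemannian 3-manifold with boundary, with scalar curvature $R_g\ge 0$, whose boundary is identified with $S$ by a diffeomorphism (the poles, respectively the flat faces, in the two extreme planes $\{x^3=t_\pm\}$ are not counted as part of $M$). Let $X$ be the outward unit normal of $\partial M$, $\sigma$ the metric induced by $g$ on $\partial M$, and $H_{\partial M}$ its mean curvature with respect to $X$ (trace of $A(Y,Z)=\langle\nabla_YX,Z\rangle$). Assume $\sigma\ge\bar\sigma$ and $H_{\partial M}\ge\bar H_{\partial M}$ on $\partial M\cong S$. Let $D$ be the closed unit disk, $I=(a,b)$ with $a<0<b$, and let $\psi:D\times I\to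 M$ be smooth up to the boundary, such that for every $t\in I$ the map $\psi(\cdot,t)$ is an immersion with $\psi(\partial D\times\{t\})\subset\partial M$. Write $\Sigma_t=\psi(D\times\{t\})$ and let $N_t$ be a unit normal of $\Sigma_t$ with $v_t:=\langle\partial\psi/\partial t,N_t\rangle>0$. Assume that for each $t\in I$ the curve $\partial\Sigma_t$ separates the two ends $x^3\to t_-$ and $x^3\to t_+$ of $\partial M\cong S$, that $\Sigma_t$ has constant mean curvature $H(t)$ (trace of $A_t(Y,Z)=\langle\nabla_YN_t,Z\rangle$), and that $\langle X,N_t\rangle=\cos\bar\gamma$ along $\partial\Sigma_t$. (In particular this covers every foliation by constant mean curvature disks with prescribed contact angle $\bar\gamma$, parametrized by $\psi$.) Set $$\Psi(t)=\Big(\int_{\Sigma_t}\frac1{v_t}\Big)^{-1}\int_{\partial\Sigma_t}\cot\bar\gamma ,\qquad t\in I,$$ where the integrals are taken with respect to the area and length elements induced by $g$. Then $\Psi$ is continuous on $I$, the function $t\mapsto\exp\!\big(-\int_0^t\Psi(\tau)\,d\tau\big)H(t)$ is differentiable on $I$, and $$\frac{d}{dt}\Big(\exp\Big(-\int_0^t\Psi(\tau)\,d\tau\Big)H(t)\Big)\le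 0\qquad\text{for all }t\in I .$$ -/

import Mathlib

open Set MeasureTheory Bundle
open scoped Manifold ContDiff

noncomputable section

namespace Capillary

/-! Riemannian geometry in coordinates. A metric in coordinates is `G : 𝔼 n → 𝔼 n → 𝔼 n → ℝ`,
with `G y u v` the product of `u` and `v` at the point `y`. Partial derivatives are taken within a
set `S` (a half-space or the whole space), so that boundary points are covered. -/

/-- Euclidean `n`-space. -/
abbrev 𝔼 (n : ℕ) : Type := EuclideanSpace ℝ (Fin n)

/-- The `i`-th coordinate vector. -/
def vec {n : ℕ} (i : Fin n) : 𝔼 n := EuclideanSpace.single i 1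

/-- The partial derivative `∂ᵢ f`, taken within `S`. -/
def pd {n : ℕ} {F : Type*} [NormedAddCommGroup F] [NormedSpace ℝ F]
    (S : Set (𝔼 n)) (i : Fin n) (f : 𝔼 n → F) (y : 𝔼 n) : F :=
  fderivWithin ℝ f S y (vec i)

/-- The matrix `(G_{ij})` of a metric. -/
def gram {n : ℕ} (G : 𝔼 n → 𝔼 n → 𝔼 n → ℝ) (y : 𝔼 n) : Matrix (Fin n) (Fin n) ℝ :=
  Matrix.of fun i j => G y (vec i) (vec j)

/-- The Christoffel symbol `Γᵏᵢⱼ = ½ G^{kl} (∂ᵢ G_{jl} + ∂ⱼ G_{il} - ∂ₗ G_{ij})`. -/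
def christoffel {n : ℕ} (S : Set (𝔼 n)) (G : 𝔼 n → 𝔼 n → 𝔼 n → ℝ)
    (k i j : Fin n) (y : 𝔼 n) : ℝ :=
  (1 / 2) * ∑ l, (gram G y)⁻¹ k l *
    (pd S i (fun z => gram G z j l) y + pd S j (fun z => gram G z i l) y
      - pd S l (fun z => gram G z i j) y)

/-- The Ricci tensor
`Ric_{jk} = ∂ᵢ Γⁱⱼₖ - ∂ⱼ Γⁱᵢₖ + Γⁱᵢₚ Γᵖⱼₖ - Γⁱⱼₚ Γᵖᵢₖ` (positive on round spheres). -/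
def ricci {n : ℕ} (S : Set (𝔼 n)) (G : 𝔼 n → 𝔼 n → 𝔼 n → ℝ) (j k : Fin n) (y : 𝔼 n) : ℝ :=
  ∑ i, (pd S i (christoffel S G i j k) y - pd S j (christoffel S G i i k) y)
    + ∑ i, ∑ p, (christoffel S G i i p y * christoffel S G p j k y
        - christoffel S G i j p y * christoffel S G p i k y)

/-- The scalar curvature `G^{jk} Ric_{jk}`. -/
def scalarCoord {n : ℕ} (S : Set (𝔼 n)) (G : 𝔼 n → 𝔼 n → 𝔼 n → ℝ) (y : 𝔼 n) : ℝ :=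
  ∑ j, ∑ k, (gram G y)⁻¹ j k * ricci S G j k y

/-- The first fundamental form `h_{ab} = G(∂ₐF, ∂_bF)` of a parametrized surface `F : U → 𝔼 n`. -/
def firstFormCoord {n : ℕ} (G : 𝔼 n → 𝔼 n → 𝔼 n → ℝ) (U : Set (𝔼 2)) (F : 𝔼 2 → 𝔼 n)
    (x : 𝔼 2) : Matrix (Fin 2) (Fin 2) ℝ :=
  Matrix.of fun a b => G (F x) (pd U a F x) (pd U b F x)

/-- The covariant derivative `∇_{∂ₐF} ∂_bF`
`= (∂ₐ∂_b Fᵏ + Γᵏᵢⱼ(F) ∂ₐFⁱ ∂_bFʲ) eₖ` along a parametrized surface. -/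
def covDerivCoord {n : ℕ} (S : Set (𝔼 n)) (G : 𝔼 n → 𝔼 n → 𝔼 n → ℝ) (U : Set (𝔼 2))
    (F : 𝔼 2 → 𝔼 n) (a b : Fin 2) (x : 𝔼 2) : 𝔼 n :=
  pd U a (pd U b F) x
    + ∑ k, (∑ i, ∑ j, christoffel S G k i j (F x) * pd U a F x i * pd U b F x j) • vec k

/-- The mean curvature of a parametrized surface with respect to the unit normal `N` at `F x`:
the trace `h^{ab} A(∂ₐF, ∂_bF)` of `A(Y, Z) = ⟨∇_Y N, Z⟩ = -⟨∇_Y Z, N⟩`. -/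
def meanCurvCoord {n : ℕ} (S : Set (𝔼 n)) (G : 𝔼 n → 𝔼 n → 𝔼 n → ℝ) (U : Set (𝔼 2))
    (F : 𝔼 2 → 𝔼 n) (x : 𝔼 2) (N : 𝔼 n) : ℝ :=
  -∑ a, ∑ b, (firstFormCoord G U F x)⁻¹ a b * G (F x) (covDerivCoord S G U F a b x) N

/-! Riemannian 3-manifolds with boundary. -/

section Manifold

variable {M : Type*} [TopologicalSpace M] [ChartedSpace (EuclideanHalfSpace 3) M]
  [IsManifold (𝓡∂ 3) ∞ M]

/-- Smooth Riemannian metrics on `M`, up to the boundary. -/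
abbrev Metric3 (M : Type*) [TopologicalSpace M] [ChartedSpace (EuclideanHalfSpace 3) M]
    [IsManifold (𝓡∂ 3) ∞ M] : Type _ :=
  ContMDiffRiemannianMetric (𝓡∂ 3) ∞ (𝔼 3) (fun p : M => TangentSpace (𝓡∂ 3) p)

/-- The metric `g` in the coordinates given by the preferred chart at `p`. -/
def chartMetric (g : Metric3 M) (p : M) : 𝔼 3 → 𝔼 3 → 𝔼 3 → ℝ := fun y u v =>
  g.inner ((extChartAt (𝓡∂ 3) p).symm y)
    (mfderivWithin 𝓘(ℝ, 𝔼 3) (𝓡∂ 3) (extChartAt (𝓡∂ 3) p).symm (range (𝓡∂ 3)) y u)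
    (mfderivWithin 𝓘(ℝ, 𝔼 3) (𝓡∂ 3) (extChartAt (𝓡∂ 3) p).symm (range (𝓡∂ 3)) y v)

/-- The scalar curvature `R_g` at `p`, computed in a chart around `p`. -/
def scalarCurvature (g : Metric3 M) (p : M) : ℝ :=
  scalarCoord (range (𝓡∂ 3)) (chartMetric g p) (extChartAt (𝓡∂ 3) p p)

/-- The differential at `x` of a parametrized surface `F : U → M`. -/
def surfDeriv (U : Set (𝔼 2)) (F : 𝔼 2 → M) (x : 𝔼 2) (ξ : 𝔼 2) : TangentSpace (𝓡∂ 3) (F x) :=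
  mfderivWithin 𝓘(ℝ, 𝔼 2) (𝓡∂ 3) F U x ξ

/-- The induced metric of a parametrized surface, as a matrix. -/
def firstForm (g : Metric3 M) (U : Set (𝔼 2)) (F : 𝔼 2 → M) (x : 𝔼 2) :
    Matrix (Fin 2) (Fin 2) ℝ :=
  Matrix.of fun a b => g.inner (F x) (surfDeriv U F x (vec a)) (surfDeriv U F x (vec b))

/-- The coordinates of a tangent vector at `p` in the preferred chart at `p`. -/
def coords (p : M) (w : TangentSpace (𝓡∂ 3) p) : 𝔼 3 :=
  mfderiv (𝓡∂ 3) 𝓘(ℝ, 𝔼 3) (extChartAt (𝓡∂ 3) p) p w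

/-- The mean curvature in `(M, g)` of a parametrized surface `F : U → M` with respect to the unit
normal `N` at `F x`, computed in a chart around `F x`. -/
def meanCurvature (g : Metric3 M) (U : Set (𝔼 2)) (F : 𝔼 2 → M) (x : 𝔼 2)
    (N : TangentSpace (𝓡∂ 3) (F x)) : ℝ :=
  meanCurvCoord (range (𝓡∂ 3)) (chartMetric g (F x)) U
    (fun z => extChartAt (𝓡∂ 3) (F x) (F z)) x
    (coords (F x) N)

/-- `X` is the outward unit normal of `∂M` at the boundary point `p`. In a chart at `p` the manifold
is `{y₀ ≥ 0}`: a vector is tangent to `∂M` if its `0`-th coordinate vanishes, and points out of `M`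
if that coordinate is negative. -/
def IsOutwardUnitNormal (g : Metric3 M) (p : M) (X : TangentSpace (𝓡∂ 3) p) : Prop :=
  g.inner p X X = 1 ∧
  (∀ w : TangentSpace (𝓡∂ 3) p, coords p w 0 = 0 → g.inner p X w = 0) ∧
  coords p X 0 < 0

end Manifold

/-! The weakly convex rotationally symmetric model surface
`{(r(s) cos θ, r(s) sin θ, s) : tm < s < tp}` in Euclidean 3-space. -/

/-- The profile `r` of a smooth weakly convex surface of revolution between the planes at heights
`tm` and `tp`. -/
structure IsProfile (tm tp : ℝ) (r : ℝ → ℝ) : Prop where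
  lt : tm < tp
  smooth : ContDiffOn ℝ ∞ r (Ioo tm tp)
  pos : ∀ s ∈ Ioo tm tp, 0 < r s
  concave : ConcaveOn ℝ (Ioo tm tp) r

/-- The parameter domain of the model surface: `x 0` is the angle, `x 1` the height. -/
def strip (tm tp : ℝ) : Set (𝔼 2) := {x | x 1 ∈ Ioo tm tp}

/-- The parametrization `(θ, s) ↦ (r(s) cos θ, r(s) sin θ, s)` of the model surface. -/
def modelSurface (r : ℝ → ℝ) (x : 𝔼 2) : 𝔼 3 :=
  !₂[r (x 1) * Real.cos (x 0), r (x 1) * Real.sin (x 0), x 1]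

/-- The Euclidean outward unit normal `X̄ = (cos θ, sin θ, -r') / √(1 + r'²)` of the model surface
at its point `q = (r cos θ, r sin θ, s)`. -/
def modelNormal (r : ℝ → ℝ) (q : 𝔼 3) : 𝔼 3 :=
  (Real.sqrt (1 + deriv r (q 2) ^ 2))⁻¹ • !₂[q 0 / r (q 2), q 1 / r (q 2), -deriv r (q 2)]

/-- The angle `γ̄ ∈ [0, π]` with `cos γ̄ = ⟨X̄, ∂/∂x³⟩`, at a point `q` of the model surface. -/
def modelAngle (r : ℝ → ℝ) (q : 𝔼 3) : ℝ :=
  Real.arccos (inner ℝ (modelNormal r q) (vec 2))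

/-- The Euclidean mean curvature of the model surface, with respect to `X̄`. -/
def modelMeanCurvature (tm tp : ℝ) (r : ℝ → ℝ) (x : 𝔼 2) : ℝ :=
  meanCurvCoord univ (fun _ u v => inner ℝ u v) (strip tm tp) (modelSurface r) x
    (modelNormal r (modelSurface r x))

section Foliation

variable {M : Type*} [TopologicalSpace M] [ChartedSpace (EuclideanHalfSpace 3) M]
  [IsManifold (𝓡∂ 3) ∞ M]

/-- `j` identifies `∂M` diffeomorphically with the model surface; `B` is the inverse of `j`
written in the parameters `(θ, s)`. Only the values of `j` on `∂M` matter. -/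
structure IsBoundaryIdentification (tm tp : ℝ) (r : ℝ → ℝ) (j : M → 𝔼 3) (B : 𝔼 2 → M) :
    Prop where
  smooth : ContMDiffOn 𝓘(ℝ, 𝔼 2) (𝓡∂ 3) ∞ B (strip tm tp)
  immersion : ∀ x ∈ strip tm tp, Function.Injective (surfDeriv (strip tm tp) B x)
  image : B '' strip tm tp = (𝓡∂ 3).boundary M
  injOn : InjOn j ((𝓡∂ 3).boundary M)
  comp : ∀ x ∈ strip tm tp, j (B x) = modelSurface r x

/-- The comparison `σ ≥ σ̄` of the metrics induced on `∂M` by `g` and by the Euclidean metric. -/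
def MetricComparison (g : Metric3 M) (tm tp : ℝ) (r : ℝ → ℝ) (B : 𝔼 2 → M) : Prop :=
  ∀ x ∈ strip tm tp, ∀ ξ : 𝔼 2,
    ‖fderivWithin ℝ (modelSurface r) (strip tm tp) x ξ‖ ^ 2
      ≤ g.inner (B x) (surfDeriv (strip tm tp) B x ξ) (surfDeriv (strip tm tp) B x ξ)

/-- The comparison `H_{∂M} ≥ H̄_{∂M}`, where `X` is the outward unit normal field of `∂M`. -/
def MeanCurvatureComparison (g : Metric3 M) (X : ∀ p : M, TangentSpace (𝓡∂ 3) p)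
    (tm tp : ℝ) (r : ℝ → ℝ) (B : 𝔼 2 → M) : Prop :=
  ∀ x ∈ strip tm tp,
    modelMeanCurvature tm tp r x ≤ meanCurvature g (strip tm tp) B x (X (B x))

/-- `K ⊆ ∂M` separates the two ends of `∂M`: no connected subset of `∂M \ K` contains both points
whose height is close to `tm` and points whose height is close to `tp`. -/
def SeparatesEnds (tm tp : ℝ) (j : M → 𝔼 3) (K : Set M) : Prop :=
  ∃ s₀ ∈ Ioo tm tp, ∃ s₁ ∈ Ioo tm tp, s₀ < s₁ ∧
    ∀ C ⊆ (𝓡∂ 3).boundary M \ K, IsPreconnected C →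
      ¬ ((∃ p ∈ C, j p 2 ≤ s₀) ∧ ∃ p ∈ C, s₁ ≤ j p 2)

/-- The closed unit disk. -/
def disk : Set (𝔼 2) := Metric.closedBall 0 1

/-- The leaf `Σ_t`, parametrized by the disk. -/
def leaf (ψ : 𝔼 2 × ℝ → M) (t : ℝ) : 𝔼 2 → M := fun x => ψ (x, t)

/-- The speed `v_t = ⟨∂ψ/∂t, N_t⟩` at the point `z = (x, t)`. -/
def speed (g : Metric3 M) (a b : ℝ) (ψ : 𝔼 2 × ℝ → M) (N : ∀ z, TangentSpace (𝓡∂ 3) (ψ z))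
    (z : 𝔼 2 × ℝ) : ℝ :=
  g.inner (ψ z) (mfderivWithin 𝓘(ℝ, 𝔼 2 × ℝ) (𝓡∂ 3) ψ (disk ×ˢ Ioo a b) z (0, 1)) (N z)

/-- The disks `Σ_t = ψ(disk × {t})`, `a < t < b`, with unit normals `N_t`, form a smooth family
with `v_t > 0`, in which `Σ_t` has constant mean curvature `H t` and meets `∂M`, along a curve
separating the ends of `∂M`, with the prescribed contact angle: `⟨X, N_t⟩ = cos γ̄`.
Since `v_t > 0`, the map `ψ` is a local diffeomorphism; that it is injective is not required. -/
structure IsCMCCapillaryFoliation (g : Metric3 M) (X : ∀ p : M, TangentSpace (𝓡∂ 3) p)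
    (tm tp : ℝ) (r : ℝ → ℝ) (j : M → 𝔼 3) (a b : ℝ) (ψ : 𝔼 2 × ℝ → M)
    (N : ∀ z, TangentSpace (𝓡∂ 3) (ψ z)) (H : ℝ → ℝ) : Prop where
  smooth : ContMDiffOn 𝓘(ℝ, 𝔼 2 × ℝ) (𝓡∂ 3) ∞ ψ (disk ×ˢ Ioo a b)
  immersion : ∀ t ∈ Ioo a b, ∀ x ∈ disk, Function.Injective (surfDeriv disk (leaf ψ t) x)
  boundary : ∀ t ∈ Ioo a b, ∀ x ∈ Metric.sphere (0 : 𝔼 2) 1, ψ (x, t) ∈ (𝓡∂ 3).boundary M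
  unit : ∀ t ∈ Ioo a b, ∀ x ∈ disk, g.inner (ψ (x, t)) (N (x, t)) (N (x, t)) = 1
  normal : ∀ t ∈ Ioo a b, ∀ x ∈ disk, ∀ ξ : 𝔼 2,
    g.inner (ψ (x, t)) (surfDeriv disk (leaf ψ t) x ξ) (N (x, t)) = 0
  speed_pos : ∀ t ∈ Ioo a b, ∀ x ∈ disk, 0 < speed g a b ψ N (x, t)
  cmc : ∀ t ∈ Ioo a b, ∀ x ∈ disk, meanCurvature g disk (leaf ψ t) x (N (x, t)) = H t
  angle : ∀ t ∈ Ioo a b, ∀ x ∈ Metric.sphere (0 : 𝔼 2) 1,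
    g.inner (ψ (x, t)) (X (ψ (x, t))) (N (x, t)) = Real.cos (modelAngle r (j (ψ (x, t))))
  separates : ∀ t ∈ Ioo a b, SeparatesEnds tm tp j (leaf ψ t '' Metric.sphere (0 : 𝔼 2) 1)

/-- The integral over `Σ_t` of a function of the parameter, for the area element of `g`. -/
def leafIntegral (g : Metric3 M) (ψ : 𝔼 2 × ℝ → M) (t : ℝ) (f : 𝔼 2 → ℝ) : ℝ :=
  ∫ x in disk, f x * Real.sqrt (firstForm g disk (leaf ψ t) x).det

/-- The integral over `∂Σ_t` of a function of the parameter, for the line element of `g`. -/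
def leafBoundaryIntegral (g : Metric3 M) (ψ : 𝔼 2 × ℝ → M) (t : ℝ) (f : 𝔼 2 → ℝ) : ℝ :=
  ∫ α in (0 : ℝ)..(2 * Real.pi),
    f !₂[Real.cos α, Real.sin α] *
      Real.sqrt (g.inner (leaf ψ t !₂[Real.cos α, Real.sin α])
        (surfDeriv disk (leaf ψ t) !₂[Real.cos α, Real.sin α] !₂[-Real.sin α, Real.cos α])
        (surfDeriv disk (leaf ψ t) !₂[Real.cos α, Real.sin α] !₂[-Real.sin α, Real.cos α]))

/-- The function `Ψ(t) = (∫_{Σ_t} 1 / v_t)⁻¹ ∫_{∂Σ_t} cot γ̄`. -/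
def Psi (g : Metric3 M) (r : ℝ → ℝ) (j : M → 𝔼 3) (a b : ℝ) (ψ : 𝔼 2 × ℝ → M)
    (N : ∀ z, TangentSpace (𝓡∂ 3) (ψ z)) (t : ℝ) : ℝ :=
  (leafIntegral g ψ t (fun x => 1 / speed g a b ψ N (x, t)))⁻¹ *
    leafBoundaryIntegral g ψ t (fun x => Real.cot (modelAngle r (j (ψ (x, t)))))

end Foliation

end Capillary

end

open Capillary

/-!
The quotient rule reduces the monotonicity to the differential inequality
`deriv H t ≤ Ψ t * H t` (`deriv_mean_le_Psi_mul`, `deriv_exp_integral_mul`), and this inequality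
comes from one application of the divergence theorem on the leaf `Σ_t`.

*Interior.* The leaf evolves with normal speed `v`, so that
`H' = -Δv - (|A|² + Ric(N, N)) v`. Dividing by `v` and eliminating the Ricci curvature with the
Gauss equation (as Schoen and Yau do for stable minimal surfaces) gives
`-Δ log v + K = H' / v + |∇ log v|² + (R_g + H² + |A|²) / 2`,
where `K` is the Gauss curvature of the leaf. The left-hand side is a divergence on the whole leaf:
a disk carries a global orthonormal frame, and `K` is the curl of its connection form. Hence the
Gauss-Bonnet theorem is not needed. The scalar curvature being nonnegative, the divergence of the
field `(flux0, flux1)` is at least `H' / v`. For the computation the metric is pulled back to the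
parameter domain, disk times interval, where the Gram-Schmidt frame of the coordinate fields
consists of two fields tangent to the leaves and of `N`; the coframe is the Cholesky factor of the
metric, with last entry `v` (`normal_eq`). The identity then follows from the structure equations
of Cartan (`IsPullback.structure_eq`, `IsPullback.scalarCoord_eq`), and it is
`IsMovingFrame.divergence_ge`. The map `ψ` need not be injective for this.

*Boundary.* Let `e` be the unit tangent and `ν` the outward conormal of `∂Σ_t` in `Σ_t`. The contact
angle prescribes `X = sin γ̄ ν + cos γ̄ N`, and `e` and `η = sin γ̄ N - cos γ̄ ν` form an orthonormal
basis of the tangent plane of `∂M`. Differentiating this relation along `∂M` turns the flux, per unit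
of length, into the rotation speed of `e` in the Gram-Schmidt frame plus
`cot γ̄ H - (H_∂M + dγ̄(η)) / sin γ̄`. On the model surface of profile `r` the mean curvature is
`sin γ̄ / r - (dγ̄ / dx³) sin γ̄`. Since `r` is concave, `dγ̄ / dx³ ≤ 0`, and since `σ ≥ σ̄`, the height
increases by at most `sin γ̄` along a unit vector of `∂M`. With `H_∂M ≥ H̄_∂M`, what remains is at most
`cot γ̄ H - 1 / r`. Again because `σ ≥ σ̄`, the length element is at least `r |dθ|`, with `θ` the
angle about the axis, so that the term `-1 / r` contributes at most `-|dθ|`. This is `flux_le`.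

*Topology.* The vector `e` rotates by exactly `2π` in the frame, because the frame comes from
the coordinate frame by a triangular matrix with positive diagonal (`integral_turn`). The boundary
curve separates the ends of `∂M`, so it meets every meridian of the model surface and
`∫ |dθ| ≥ 2π` (`two_pi_le_integral_angRate`). The two contributions cancel, and the divergence
theorem (`integral_divergence_disk`) gives `H' ∫ 1 / v ≤ H ∫ cot γ̄`.
-/

open Set MeasureTheory Bundle
open scoped Manifold ContDiff
noncomputable section
namespace Capillary
open scoped Topology

set_option synthInstance.maxHeartbeats 400000

/-! ### The Levi-Civita connection in coordinates -/

section Coordinates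

variable {n : ℕ}

/-- A field of bilinear forms is a smooth Riemannian metric on the relatively open subset `T` of
the coordinate domain `R` (in practice the half-space, with `T` the range of a chart). -/
structure IsRiemannOn (R T : Set (𝔼 n)) (G : 𝔼 n → 𝔼 n →L[ℝ] 𝔼 n →L[ℝ] ℝ) : Prop where
  uniqueDiff : UniqueDiffOn ℝ R
  subset : T ⊆ R
  nhds : ∀ y ∈ T, T ∈ 𝓝[R] y
  smooth : ContDiffOn ℝ ∞ G T
  symm : ∀ y ∈ T, ∀ u v, G y u v = G y v u
  pos : ∀ y ∈ T, ∀ u, u ≠ 0 → 0 < G y u u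

/-- The metric as an uncurried family of functions, the form used by `christoffel`. -/
abbrev unc (G : 𝔼 n → 𝔼 n →L[ℝ] 𝔼 n →L[ℝ] ℝ) : 𝔼 n → 𝔼 n → 𝔼 n → ℝ := fun y u v => G y u v

/-- The Christoffel symbols of `G`, bundled as a field of bilinear maps. -/
def Gam (R : Set (𝔼 n)) (G : 𝔼 n → 𝔼 n →L[ℝ] 𝔼 n →L[ℝ] ℝ) (y : 𝔼 n) :
    𝔼 n →L[ℝ] 𝔼 n →L[ℝ] 𝔼 n :=
  ∑ k, ∑ i, ∑ j, christoffel R (unc G) k i j y •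
    (EuclideanSpace.proj i : 𝔼 n →L[ℝ] ℝ).smulRight
      ((EuclideanSpace.proj j : 𝔼 n →L[ℝ] ℝ).smulRight (vec k : 𝔼 n))

/-- The curvature tensor `Riem(u, v) w` of the connection `Gam`. -/
def Riem (R : Set (𝔼 n)) (G : 𝔼 n → 𝔼 n →L[ℝ] 𝔼 n →L[ℝ] ℝ) (y u v w : 𝔼 n) : 𝔼 n :=
  fderivWithin ℝ (Gam R G) R y u v w - fderivWithin ℝ (Gam R G) R y v u w
    + Gam R G y u (Gam R G y v w) - Gam R G y v (Gam R G y u w)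

lemma vec_apply (i j : Fin n) : (vec i : 𝔼 n) j = if j = i then 1 else 0 := by
  simp [vec]

lemma sum_smul_vec (u : 𝔼 n) : ∑ i, u i • (vec i : 𝔼 n) = u := by
  ext j
  simp [vec_apply]

lemma Gam_apply (R : Set (𝔼 n)) (G : 𝔼 n → 𝔼 n →L[ℝ] 𝔼 n →L[ℝ] ℝ) (y u v : 𝔼 n) :
    Gam R G y u v
      = ∑ k, (∑ i, ∑ j, christoffel R (unc G) k i j y * u i * v j) • (vec k : 𝔼 n) := by
  simp only [Gam, _root_.sum_apply, _root_.smul_apply,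
    ContinuousLinearMap.smulRight_apply, Finset.sum_smul, smul_smul]
  rfl

lemma Gam_vec (R : Set (𝔼 n)) (G : 𝔼 n → 𝔼 n →L[ℝ] 𝔼 n →L[ℝ] ℝ) (y : 𝔼 n) (i j k : Fin n) :
    Gam R G y (vec i) (vec j) k = christoffel R (unc G) k i j y := by
  simp [Gam_apply, vec_apply]

/-- Two continuous linear maps on Euclidean space agree if they agree on the coordinate vectors. -/
lemma clm_ext_vec {F : Type*} [NormedAddCommGroup F] [NormedSpace ℝ F] {f g : 𝔼 n →L[ℝ] F}
    (h : ∀ i, f (vec i) = g (vec i)) : f = g := by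
  ext u
  rw [← sum_smul_vec u]
  simp [h]

lemma lin_ext {f g : 𝔼 n → ℝ} (hf : IsLinearMap ℝ f) (hg : IsLinearMap ℝ g)
    (h : ∀ i, f (vec i) = g (vec i)) (u : 𝔼 n) : f u = g u := by
  have := clm_ext_vec (f := LinearMap.toContinuousLinearMap hf.mk')
    (g := LinearMap.toContinuousLinearMap hg.mk') h
  exact congrArg (fun L : 𝔼 n →L[ℝ] ℝ => L u) this

variable {R T : Set (𝔼 n)} {G : 𝔼 n → 𝔼 n →L[ℝ] 𝔼 n →L[ℝ] ℝ}

lemma contDiffOn_det {E : Type*} [NormedAddCommGroup E] [NormedSpace ℝ E] {s : Set E}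
    {m : ℕ} {A : E → Matrix (Fin m) (Fin m) ℝ}
    (hA : ∀ i j, ContDiffOn ℝ ∞ (fun z => A z i j) s) : ContDiffOn ℝ ∞ (fun z => (A z).det) s := by
  simp only [Matrix.det_apply]
  refine ContDiffOn.sum fun σ _ => ?_
  refine ContDiffOn.const_smul _ ?_
  exact contDiffOn_prod fun i _ => hA _ _

lemma contDiffOn_inv_entry {E : Type*} [NormedAddCommGroup E] [NormedSpace ℝ E] {s : Set E}
    {m : ℕ} {A : E → Matrix (Fin m) (Fin m) ℝ}
    (hA : ∀ i j, ContDiffOn ℝ ∞ (fun z => A z i j) s) (hdet : ∀ z ∈ s, (A z).det ≠ 0)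
    (i j : Fin m) : ContDiffOn ℝ ∞ (fun z => (A z)⁻¹ i j) s := by
  simp only [Matrix.inv_def, Matrix.smul_apply, Matrix.adjugate_apply, Ring.inverse_eq_inv',
    smul_eq_mul]
  refine ((contDiffOn_det hA).inv hdet).mul (contDiffOn_det fun k l => ?_)
  by_cases hk : k = j
  · subst hk; simp only [Matrix.updateRow_self]; exact contDiffOn_const
  · simp only [Matrix.updateRow_ne hk]; exact hA k l

/-- If the vectors `E m` are orthonormal for the matrix `A`, then `A⁻¹ = ∑ m, E m ⊗ E m`. -/
lemma inv_eq_sum_of_orthonormal {m : ℕ} (A : Matrix (Fin m) (Fin m) ℝ)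
    (E : Fin m → Fin m → ℝ)
    (hE : ∀ i j, ∑ a, ∑ b, E i a * A a b * E j b = if i = j then 1 else 0) (a b : Fin m) :
    A⁻¹ a b = ∑ k, E k a * E k b := by
  set P : Matrix (Fin m) (Fin m) ℝ := Matrix.of fun k a => E k a with hP
  have h1 : P * (A * P.transpose) = 1 := by
    ext i j
    rw [Matrix.one_apply, ← hE i j, Matrix.mul_apply]
    refine Finset.sum_congr rfl fun a _ => ?_
    rw [Matrix.mul_apply, Finset.mul_sum]
    exact Finset.sum_congr rfl fun b _ => by simp [hP]; ring
  have h2 : A * (P.transpose * P) = 1 := by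
    rw [← Matrix.mul_assoc]; exact mul_eq_one_comm.1 h1
  rw [Matrix.inv_eq_right_inv h2, Matrix.mul_apply]
  rfl

namespace IsRiemannOn

variable (hG : IsRiemannOn R T G)
include hG

lemma uniqueDiffOn_T : UniqueDiffOn ℝ T := fun y hy =>
  (hG.uniqueDiff y (hG.subset hy)).mono_nhds (by
    rw [nhdsWithin_le_iff]; exact hG.nhds y hy)

lemma nhdsWithin_eq {y : 𝔼 n} (hy : y ∈ T) : 𝓝[R] y = 𝓝[T] y :=
  le_antisymm (by rw [nhdsWithin_le_iff]; exact hG.nhds y hy) (nhdsWithin_mono y hG.subset)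

lemma fderivWithin_eq {F : Type*} [NormedAddCommGroup F] [NormedSpace ℝ F] (f : 𝔼 n → F) {y : 𝔼 n}
    (hy : y ∈ T) : fderivWithin ℝ f R y = fderivWithin ℝ f T y :=
  fderivWithin_congr_set (nhdsWithin_eq_iff_eventuallyEq.1 (hG.nhdsWithin_eq hy))

lemma contDiffWithinAt {F : Type*} [NormedAddCommGroup F] [NormedSpace ℝ F] {f : 𝔼 n → F}
    (hf : ContDiffOn ℝ ∞ f T) {y : 𝔼 n} (hy : y ∈ T) : ContDiffWithinAt ℝ ∞ f R y :=
  (hf y hy).mono_of_mem_nhdsWithin (hG.nhds y hy)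

lemma differentiableWithinAt {F : Type*} [NormedAddCommGroup F] [NormedSpace ℝ F] {f : 𝔼 n → F}
    (hf : ContDiffOn ℝ ∞ f T) {y : 𝔼 n} (hy : y ∈ T) : DifferentiableWithinAt ℝ f R y :=
  (hG.contDiffWithinAt hf hy).differentiableWithinAt (by simp)

lemma contDiffOn_fderivWithin {F : Type*} [NormedAddCommGroup F] [NormedSpace ℝ F] {f : 𝔼 n → F}
    (hf : ContDiffOn ℝ ∞ f T) : ContDiffOn ℝ ∞ (fun y => fderivWithin ℝ f R y) T :=
  (hf.fderivWithin hG.uniqueDiffOn_T (m := ∞) (by simp)).congr fun y hy => hG.fderivWithin_eq f hy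

lemma pd_gram {y : 𝔼 n} (hy : y ∈ T) (i j l : Fin n) :
    pd R i (fun z => gram (unc G) z j l) y = fderivWithin ℝ G R y (vec i) (vec j) (vec l) := by
  have h := (hG.differentiableWithinAt hG.smooth hy).hasFDerivWithinAt
  have h2 := (h.clm_apply (hasFDerivWithinAt_const (vec j) y R)).clm_apply
    (hasFDerivWithinAt_const (vec l) y R)
  simp only [pd, gram, Matrix.of_apply]
  rw [h2.fderivWithin (hG.uniqueDiff y (hG.subset hy))]
  simp

lemma gram_det_ne {y : 𝔼 n} (hy : y ∈ T) : (gram (unc G) y).det ≠ 0 := by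
  intro h0
  obtain ⟨v, hv, hv0⟩ := Matrix.exists_mulVec_eq_zero_iff.2 h0
  set u : 𝔼 n := WithLp.toLp 2 v with hu
  have hu0 : u ≠ 0 := by
    intro h; apply hv; ext i; have := congrArg (fun w : 𝔼 n => w i) h; simpa [hu] using this
  have hpos := hG.pos y hy u hu0
  have : G y u u = ∑ i, v i * ((gram (unc G) y).mulVec v) i := by
    conv_lhs => rw [← sum_smul_vec u]
    simp only [map_sum, map_smul, _root_.sum_apply, _root_.smul_apply,
      smul_eq_mul, Matrix.mulVec, dotProduct, gram, Matrix.of_apply, Finset.mul_sum]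
    rw [Finset.sum_comm]
    refine Finset.sum_congr rfl fun i _ => Finset.sum_congr rfl fun j _ => ?_
    simp only [hu]; ring
  rw [this, hv0] at hpos
  simp at hpos

lemma contDiffOn_gram (i j : Fin n) : ContDiffOn ℝ ∞ (fun y => gram (unc G) y i j) T :=
  (hG.smooth.clm_apply contDiffOn_const).clm_apply contDiffOn_const

lemma contDiffOn_christoffel (k i j : Fin n) :
    ContDiffOn ℝ ∞ (christoffel R (unc G) k i j) T := by
  have h : ∀ a b c : Fin n, ContDiffOn ℝ ∞ (pd R a (fun z => gram (unc G) z b c)) T := fun a b c =>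
    (hG.contDiffOn_fderivWithin (hG.contDiffOn_gram b c)).clm_apply contDiffOn_const
  unfold christoffel
  refine contDiffOn_const.mul (ContDiffOn.sum fun l _ => ?_)
  exact (contDiffOn_inv_entry hG.contDiffOn_gram (fun z hz => hG.gram_det_ne hz) k l).mul
    (((h _ _ _).add (h _ _ _)).sub (h _ _ _))

lemma contDiffOn_Gam : ContDiffOn ℝ ∞ (Gam R G) T := by
  unfold Gam
  refine ContDiffOn.sum fun k _ => ContDiffOn.sum fun i _ => ContDiffOn.sum fun j _ => ?_
  exact (ContinuousLinearMap.toSpanSingleton ℝ _).contDiff.comp_contDiffOn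
    (hG.contDiffOn_christoffel k i j)

lemma fderivWithin_symm {y : 𝔼 n} (hy : y ∈ T) (u v w : 𝔼 n) :
    fderivWithin ℝ G R y u v w = fderivWithin ℝ G R y u w v := by
  have hd := (hG.differentiableWithinAt hG.smooth hy).hasFDerivWithinAt
  have hu := hG.uniqueDiff y (hG.subset hy)
  have h1 := (hd.clm_apply (hasFDerivWithinAt_const v y R)).clm_apply
    (hasFDerivWithinAt_const w y R)
  have h2 := (hd.clm_apply (hasFDerivWithinAt_const w y R)).clm_apply
    (hasFDerivWithinAt_const v y R)
  have h3 : (fun z => (G z v) w) =ᶠ[𝓝[R] y] (fun z => (G z w) v) := by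
    filter_upwards [hG.nhds y hy] with z hz using hG.symm z hz v w
  have h4 := Filter.EventuallyEq.fderivWithin_eq (𝕜 := ℝ) h3 (hG.symm y hy v w)
  rw [h1.fderivWithin hu, h2.fderivWithin hu] at h4
  simpa using congrArg (fun L : 𝔼 n →L[ℝ] ℝ => L u) h4

/-- Koszul's formula: the defining property of the Levi-Civita connection. -/
lemma koszul {y : 𝔼 n} (hy : y ∈ T) (u v w : 𝔼 n) :
    G y (Gam R G y u v) w = (1 / 2) * (fderivWithin ℝ G R y u v w + fderivWithin ℝ G R y v u w
      - fderivWithin ℝ G R y w u v) := by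
  have key : ∀ i j m : Fin n, G y (Gam R G y (vec i) (vec j)) (vec m)
      = (1 / 2) * (fderivWithin ℝ G R y (vec i) (vec j) (vec m)
        + fderivWithin ℝ G R y (vec j) (vec i) (vec m)
        - fderivWithin ℝ G R y (vec m) (vec i) (vec j)) := by
    intro i j m
    have hinv : ∀ l, ∑ k, (gram (unc G) y)⁻¹ k l * gram (unc G) y k m = if l = m then 1 else 0 := by
      intro l
      have h1 := Matrix.mul_nonsing_inv (gram (unc G) y) (hG.gram_det_ne hy).isUnit
      have h2 := congrFun (congrFun h1 m) l
      rw [Matrix.mul_apply, Matrix.one_apply] at h2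
      rw [show (if l = m then (1 : ℝ) else 0) = if m = l then 1 else 0 by simp [eq_comm], ← h2]
      refine Finset.sum_congr rfl fun k _ => ?_
      rw [mul_comm, show gram (unc G) y k m = gram (unc G) y m k from hG.symm y hy _ _]
    have hL : G y (Gam R G y (vec i) (vec j)) (vec m)
        = ∑ k, christoffel R (unc G) k i j y * gram (unc G) y k m := by
      rw [← sum_smul_vec (Gam R G y (vec i) (vec j))]
      simp only [Gam_vec, map_sum, map_smul, _root_.sum_apply,
        _root_.smul_apply, smul_eq_mul, gram, Matrix.of_apply]
    rw [hL]
    simp only [christoffel, hG.pd_gram hy, mul_assoc, Finset.sum_mul]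
    rw [← Finset.mul_sum, Finset.sum_comm]
    congr 1
    set D : Fin n → ℝ := fun l => fderivWithin ℝ G R y (vec i) (vec j) (vec l)
      + fderivWithin ℝ G R y (vec j) (vec i) (vec l)
      - fderivWithin ℝ G R y (vec l) (vec i) (vec j) with hD
    change _ = D m
    have hm : D m = ∑ l, (if l = m then (1 : ℝ) else 0) * D l := by simp
    rw [hm]
    refine Finset.sum_congr rfl fun l _ => ?_
    rw [← hinv l, Finset.sum_mul]
    exact Finset.sum_congr rfl fun k _ => by ring
  have key2 : ∀ i j w, G y (Gam R G y (vec i) (vec j)) w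
      = (1 / 2) * (fderivWithin ℝ G R y (vec i) (vec j) w
        + fderivWithin ℝ G R y (vec j) (vec i) w - fderivWithin ℝ G R y w (vec i) (vec j)) :=
    fun i j => lin_ext ⟨fun a b => by simp only [map_add], fun c a => by simp only [map_smul]⟩
      ⟨fun a b => by simp only [map_add, _root_.add_apply]; ring,
      fun c a => by simp only [map_smul, _root_.smul_apply, smul_eq_mul]; ring⟩ (key i j)
  have key3 : ∀ i w v, G y (Gam R G y (vec i) v) w
      = (1 / 2) * (fderivWithin ℝ G R y (vec i) v w
        + fderivWithin ℝ G R y v (vec i) w - fderivWithin ℝ G R y w (vec i) v) :=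
    fun i w => lin_ext ⟨fun a b => by simp only [map_add, _root_.add_apply],
      fun c a => by simp only [map_smul, _root_.smul_apply]⟩
      ⟨fun a b => by simp only [map_add, _root_.add_apply]; ring,
      fun c a => by simp only [map_smul, _root_.smul_apply, smul_eq_mul]; ring⟩ (fun j => key2 i j w)
  exact lin_ext (f := fun u => G y (Gam R G y u v) w)
    (g := fun u => (1 / 2) * (fderivWithin ℝ G R y u v w + fderivWithin ℝ G R y v u w
      - fderivWithin ℝ G R y w u v)) ⟨fun a b => by simp only [map_add, _root_.add_apply],
      fun c a => by simp only [map_smul, _root_.smul_apply]⟩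
      ⟨fun a b => by simp only [map_add, _root_.add_apply]; ring,
      fun c a => by simp only [map_smul, _root_.smul_apply, smul_eq_mul]; ring⟩ (fun i => key3 i w v) u

/-- The connection is compatible with the metric. -/
lemma compat {y : 𝔼 n} (hy : y ∈ T) (u v w : 𝔼 n) :
    fderivWithin ℝ G R y u v w = G y (Gam R G y u v) w + G y v (Gam R G y u w) := by
  rw [hG.symm y hy v, hG.koszul hy, hG.koszul hy, hG.fderivWithin_symm hy u w v,
    hG.fderivWithin_symm hy v u w, hG.fderivWithin_symm hy w u v]
  ring

/-- The connection is torsion-free. -/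
lemma torsion {y : 𝔼 n} (hy : y ∈ T) (u v : 𝔼 n) : Gam R G y u v = Gam R G y v u := by
  by_contra hne
  have h : ∀ w, G y (Gam R G y u v - Gam R G y v u) w = 0 := by
    intro w
    rw [map_sub, _root_.sub_apply, hG.koszul hy, hG.koszul hy,
      hG.fderivWithin_symm hy w u v]
    ring
  have := hG.pos y hy _ (sub_ne_zero.2 hne)
  rw [h] at this
  exact lt_irrefl _ this

lemma fderivWithin_Gam_vec {y : 𝔼 n} (hy : y ∈ T) (u : 𝔼 n) (i j k : Fin n) :
    fderivWithin ℝ (christoffel R (unc G) k i j) R y u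
      = fderivWithin ℝ (Gam R G) R y u (vec i) (vec j) k := by
  have hd := (hG.differentiableWithinAt hG.contDiffOn_Gam hy).hasFDerivWithinAt
  have h1 := (hd.clm_apply (hasFDerivWithinAt_const (vec i) y R)).clm_apply
    (hasFDerivWithinAt_const (vec j) y R)
  have h2 := (EuclideanSpace.proj k : 𝔼 n →L[ℝ] ℝ).hasFDerivAt.comp_hasFDerivWithinAt y h1
  have h3 : christoffel R (unc G) k i j
      = (EuclideanSpace.proj k : 𝔼 n →L[ℝ] ℝ) ∘ fun z => Gam R G z (vec i) (vec j) := by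
    funext z
    exact (Gam_vec R G z i j k).symm
  rw [h3, h2.fderivWithin (hG.uniqueDiff y (hG.subset hy))]
  simp

lemma ricci_eq {y : 𝔼 n} (hy : y ∈ T) (j k : Fin n) :
    ricci R (unc G) j k y = ∑ i, Riem R G y (vec i) (vec j) (vec k) i := by
  have hc : ∀ u v : 𝔼 n, ∀ i, Gam R G y u v i
      = ∑ a, ∑ b, christoffel R (unc G) i a b y * u a * v b := by
    intro u v i
    simp [Gam_apply, vec_apply]
  simp only [ricci, pd, hG.fderivWithin_Gam_vec hy, Riem, ← Finset.sum_add_distrib]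
  refine Finset.sum_congr rfl fun i _ => ?_
  have h1 : Gam R G y (vec i) (Gam R G y (vec j) (vec k)) i
      = ∑ p, christoffel R (unc G) i i p y * christoffel R (unc G) p j k y := by
    rw [hc]; simp [Gam_vec, vec_apply]
  have h2 : Gam R G y (vec j) (Gam R G y (vec i) (vec k)) i
      = ∑ p, christoffel R (unc G) i j p y * christoffel R (unc G) p i k y := by
    rw [hc]; simp [Gam_vec, vec_apply]
  simp only [PiLp.sub_apply, PiLp.add_apply, h1, h2, Finset.sum_sub_distrib]
  ring

end IsRiemannOn

lemma lin_expand {f : 𝔼 n → ℝ} (hf : IsLinearMap ℝ f) (u : 𝔼 n) :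
    f u = ∑ i, u i * f (vec i) := by
  conv_lhs => rw [← sum_smul_vec u]
  have h := map_sum hf.mk' (fun i => u i • (vec i : 𝔼 n)) Finset.univ
  simp only [IsLinearMap.mk'_apply] at h
  rw [h]
  exact Finset.sum_congr rfl fun i _ => by rw [hf.map_smul, smul_eq_mul]

lemma bil_expand (A : 𝔼 n →L[ℝ] 𝔼 n →L[ℝ] ℝ) (u v : 𝔼 n) :
    A u v = ∑ i, ∑ j, u i * A (vec i) (vec j) * v j := by
  rw [lin_expand (f := fun u => A u v) ⟨fun a b => by simp, fun c a => by simp⟩ u]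
  refine Finset.sum_congr rfl fun i _ => ?_
  rw [lin_expand (f := A (vec i)) ⟨map_add _, map_smul _⟩ v, Finset.mul_sum]
  exact Finset.sum_congr rfl fun j _ => by ring

section RiemLinear

variable (A : 𝔼 n →L[ℝ] 𝔼 n →L[ℝ] 𝔼 n →L[ℝ] 𝔼 n) (B : 𝔼 n →L[ℝ] 𝔼 n →L[ℝ] 𝔼 n)

lemma isLinearMap_riem₁ (v w : 𝔼 n) : IsLinearMap ℝ
    (fun u => A u v w - A v u w + B u (B v w) - B v (B u w)) := by
  constructor
  · intro a b
    rw [A.map_add, (A v).map_add, B.map_add]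
    simp only [_root_.add_apply]
    rw [(B v).map_add]
    abel
  · intro c a
    rw [A.map_smul, (A v).map_smul, B.map_smul]
    simp only [_root_.smul_apply]
    rw [(B v).map_smul]
    simp only [smul_sub, smul_add]

lemma isLinearMap_riem₂ (u w : 𝔼 n) : IsLinearMap ℝ
    (fun v => A u v w - A v u w + B u (B v w) - B v (B u w)) := by
  constructor
  · intro a b
    rw [A.map_add, (A u).map_add, B.map_add]
    simp only [_root_.add_apply]
    rw [(B u).map_add]
    abel
  · intro c a
    rw [A.map_smul, (A u).map_smul, B.map_smul]
    simp only [_root_.smul_apply]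
    rw [(B u).map_smul]
    simp only [smul_sub, smul_add]

lemma isLinearMap_riem₃ (u v : 𝔼 n) : IsLinearMap ℝ
    (fun w => A u v w - A v u w + B u (B v w) - B v (B u w)) := by
  constructor
  · intro a b
    rw [(A u v).map_add, (A v u).map_add, (B v).map_add, (B u).map_add, (B u).map_add,
      (B v).map_add]
    abel
  · intro c a
    rw [(A u v).map_smul, (A v u).map_smul, (B v).map_smul, (B u).map_smul, (B u).map_smul,
      (B v).map_smul]
    simp only [smul_sub, smul_add]

end RiemLinear

lemma isLinearMap_comp_apply {f : 𝔼 n → 𝔼 n} (hf : IsLinearMap ℝ f) (i : Fin n) :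
    IsLinearMap ℝ (fun u => f u i) :=
  ⟨fun a b => by rw [hf.map_add]; rfl, fun c a => by rw [hf.map_smul]; rfl⟩

lemma isLinearMap_comp_inner {f : 𝔼 n → 𝔼 n} (hf : IsLinearMap ℝ f) (L : 𝔼 n →L[ℝ] 𝔼 n →L[ℝ] ℝ)
    (e : 𝔼 n) : IsLinearMap ℝ (fun u => L (f u) e) :=
  ⟨fun a b => by rw [hf.map_add, L.map_add]; rfl, fun c a => by rw [hf.map_smul, L.map_smul]; rfl⟩

/-- The trace of an endomorphism, computed in an orthonormal basis and in coordinates. -/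
lemma sum_inner_eq_trace (A : 𝔼 n →L[ℝ] 𝔼 n →L[ℝ] ℝ) (E : Fin n → 𝔼 n)
    (hE : ∀ i j, A (E i) (E j) = if i = j then 1 else 0) {f : 𝔼 n → 𝔼 n} (hf : IsLinearMap ℝ f) :
    ∑ i, A (f (E i)) (E i) = ∑ i, f (vec i) i := by
  set P : Matrix (Fin n) (Fin n) ℝ := Matrix.of fun k a => E k a with hP
  set Q : Matrix (Fin n) (Fin n) ℝ := Matrix.of fun a b => A (vec a) (vec b) with hQ
  set L : Matrix (Fin n) (Fin n) ℝ := Matrix.of fun a b => f (vec a) b with hL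
  have h1 : P * (Q * P.transpose) = 1 := by
    ext i j
    rw [Matrix.one_apply, ← hE i j, bil_expand A, Matrix.mul_apply]
    refine Finset.sum_congr rfl fun a _ => ?_
    rw [Matrix.mul_apply, Finset.mul_sum]
    exact Finset.sum_congr rfl fun b _ => by simp [hP, hQ]; ring
  have h2 : (Q * P.transpose) * P = 1 := mul_eq_one_comm.1 h1
  have h3 : ∀ i, A (f (E i)) (E i) = (P * L * (Q * P.transpose)) i i := by
    intro i
    rw [bil_expand A, Matrix.mul_apply]
    refine Finset.sum_congr rfl fun a _ => ?_
    rw [Matrix.mul_apply, Matrix.mul_apply, Finset.mul_sum]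
    refine Finset.sum_congr rfl fun b _ => ?_
    rw [lin_expand (isLinearMap_comp_apply hf a) (E i)]
    simp only [hP, hQ, hL, Matrix.of_apply, Matrix.transpose_apply]
    ring
  calc _ = Matrix.trace (P * L * (Q * P.transpose)) := by
        simp only [Matrix.trace, Matrix.diag, h3]
    _ = Matrix.trace L := by
        rw [Matrix.mul_assoc, Matrix.trace_mul_comm, Matrix.mul_assoc, h2, Matrix.mul_one]
    _ = _ := rfl

namespace IsRiemannOn

variable (hG : IsRiemannOn R T G)
include hG

/-- The scalar curvature as a sum of sectional curvatures of an orthonormal basis. -/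
lemma scalarCoord_eq {y : 𝔼 n} (hy : y ∈ T) (E : Fin n → 𝔼 n)
    (hE : ∀ i j, G y (E i) (E j) = if i = j then 1 else 0) :
    scalarCoord R (unc G) y = ∑ i, ∑ j, G y (Riem R G y (E i) (E j) (E j)) (E i) := by
  have hP : ∀ a b, (gram (unc G) y)⁻¹ a b = ∑ m, E m a * E m b := by
    refine inv_eq_sum_of_orthonormal (gram (unc G) y) (fun m a => E m a) fun i j => ?_
    rw [← hE i j, bil_expand (G y)]
    rfl
  have l1 := fun v w => isLinearMap_riem₁ (fderivWithin ℝ (Gam R G) R y) (Gam R G y) v w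
  have l2 := fun u w => isLinearMap_riem₂ (fderivWithin ℝ (Gam R G) R y) (Gam R G y) u w
  have l3 := fun u v => isLinearMap_riem₃ (fderivWithin ℝ (Gam R G) R y) (Gam R G y) u v
  have htr : ∀ v w, ∑ i, G y (Riem R G y (E i) v w) (E i) = ∑ i, Riem R G y (vec i) v w i :=
    fun v w => sum_inner_eq_trace (G y) E hE (l1 v w)
  have e3 : ∀ m i, Riem R G y (vec i) (E m) (E m) i
      = ∑ j, ∑ k, E m j * E m k * Riem R G y (vec i) (vec j) (vec k) i := by
    intro m i
    have f1 := fun v w => lin_expand (isLinearMap_comp_apply (l3 (vec i) v) i) w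
    have f2 := fun w v => lin_expand (isLinearMap_comp_apply (l2 (vec i) w) i) v
    refine (f2 (E m) (E m)).trans ?_
    refine Finset.sum_congr rfl fun j _ => ?_
    rw [f1, Finset.mul_sum]
    exact Finset.sum_congr rfl fun k _ => (mul_assoc _ _ _).symm
  rw [Finset.sum_comm]
  simp only [htr, scalarCoord, hG.ricci_eq hy, hP, e3, Finset.sum_mul, Finset.mul_sum]
  calc _ = ∑ j, ∑ k, ∑ m, ∑ i, E m j * E m k * Riem R G y (vec i) (vec j) (vec k) i :=
        Finset.sum_congr rfl fun j _ => Finset.sum_congr rfl fun k _ => Finset.sum_comm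
    _ = ∑ j, ∑ m, ∑ k, ∑ i, E m j * E m k * Riem R G y (vec i) (vec j) (vec k) i :=
        Finset.sum_congr rfl fun j _ => Finset.sum_comm
    _ = ∑ m, ∑ j, ∑ k, ∑ i, E m j * E m k * Riem R G y (vec i) (vec j) (vec k) i :=
        Finset.sum_comm
    _ = ∑ m, ∑ j, ∑ i, ∑ k, E m j * E m k * Riem R G y (vec i) (vec j) (vec k) i :=
        Finset.sum_congr rfl fun m _ => Finset.sum_congr rfl fun j _ => Finset.sum_comm
    _ = _ := Finset.sum_congr rfl fun m _ => Finset.sum_comm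

end IsRiemannOn


end Coordinates

/-! ### The covariant derivative along a map -/

section Along

variable {n : ℕ} {V : Type*} [NormedAddCommGroup V] [NormedSpace ℝ V]

/-- The covariant derivative `D_ξ W` of a vector field `W` along the map `φ : S → 𝔼 n`. -/
def covD (R : Set (𝔼 n)) (G : 𝔼 n → 𝔼 n →L[ℝ] 𝔼 n →L[ℝ] ℝ) (S : Set V) (φ : V → 𝔼 n)
    (W : V → 𝔼 n) (z ξ : V) : 𝔼 n :=
  fderivWithin ℝ W S z ξ + Gam R G (φ z) (fderivWithin ℝ φ S z ξ) (W z)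

variable {R T : Set (𝔼 n)} {G : 𝔼 n → 𝔼 n →L[ℝ] 𝔼 n →L[ℝ] ℝ} {S : Set V} {φ : V → 𝔼 n}

lemma covD_add_dir (W : V → 𝔼 n) (z ξ ζ : V) :
    covD R G S φ W z (ξ + ζ) = covD R G S φ W z ξ + covD R G S φ W z ζ := by
  simp only [covD, map_add, _root_.add_apply]; abel

lemma covD_smul_dir (W : V → 𝔼 n) (z ξ : V) (c : ℝ) :
    covD R G S φ W z (c • ξ) = c • covD R G S φ W z ξ := by
  simp only [covD, map_smul, _root_.smul_apply, smul_add]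

lemma covD_congr {W W' : V → 𝔼 n} {z : V} (h : W =ᶠ[𝓝[S] z] W') (hz : z ∈ S) (ξ : V) :
    covD R G S φ W z ξ = covD R G S φ W' z ξ := by
  simp only [covD, h.fderivWithin_eq_of_mem (𝕜 := ℝ) hz, h.eq_of_nhdsWithin hz]

lemma covD_sum (hS : UniqueDiffOn ℝ S) {ι : Type*} [Fintype ι] {f : ι → V → ℝ} {W : ι → V → 𝔼 n}
    {z : V} (hz : z ∈ S) (hf : ∀ i, DifferentiableWithinAt ℝ (f i) S z)
    (hW : ∀ i, DifferentiableWithinAt ℝ (W i) S z) (ξ : V) :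
    covD R G S φ (fun z => ∑ i, f i z • W i z) z ξ
      = ∑ i, (fderivWithin ℝ (f i) S z ξ • W i z + f i z • covD R G S φ (W i) z ξ) := by
  have h1 : HasFDerivWithinAt (fun z => ∑ i, f i z • W i z) _ S z :=
    HasFDerivWithinAt.fun_sum fun i _ => (hf i).hasFDerivWithinAt.smul (hW i).hasFDerivWithinAt
  rw [covD, h1.fderivWithin (hS z hz)]
  simp only [_root_.sum_apply, map_sum, _root_.add_apply, _root_.smul_apply,
    ContinuousLinearMap.smulRight_apply, ← Finset.sum_add_distrib, map_smul, covD, smul_add]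
  exact Finset.sum_congr rfl fun i _ => by abel

variable (hG : IsRiemannOn R T G) (hS : UniqueDiffOn ℝ S) (hφ : ContDiffOn ℝ ∞ φ S)
  (hm : MapsTo φ S T)

include hG hS hφ hm

lemma contDiffOn_covD {W : V → 𝔼 n} (hW : ContDiffOn ℝ ∞ W S) (ξ : V) :
    ContDiffOn ℝ ∞ (fun z => covD R G S φ W z ξ) S := by
  have h1 := (hW.fderivWithin hS (m := ∞) (by simp)).clm_apply (contDiffOn_const (c := ξ))
  have h2 := (hφ.fderivWithin hS (m := ∞) (by simp)).clm_apply (contDiffOn_const (c := ξ))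
  exact h1.add (((hG.contDiffOn_Gam.comp hφ hm).clm_apply h2).clm_apply hW)

omit hS in
lemma hasFDerivWithinAt_Gam_comp {z : V} (hz : z ∈ S) :
    HasFDerivWithinAt (fun z => Gam R G (φ z))
      ((fderivWithin ℝ (Gam R G) R (φ z)).comp (fderivWithin ℝ φ S z)) S z :=
  ((hG.differentiableWithinAt hG.contDiffOn_Gam (hm hz)).hasFDerivWithinAt).comp z
    ((hφ z hz).differentiableWithinAt (by simp)).hasFDerivWithinAt
    (fun _ hx => hG.subset (hm hx))

/-- The derivative of the inner product of two fields along `φ`. -/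
lemma fderivWithin_inner_along {W W' : V → 𝔼 n} {z : V} (hz : z ∈ S)
    (hW : DifferentiableWithinAt ℝ W S z) (hW' : DifferentiableWithinAt ℝ W' S z) (ξ : V) :
    fderivWithin ℝ (fun z => G (φ z) (W z) (W' z)) S z ξ
      = G (φ z) (covD R G S φ W z ξ) (W' z) + G (φ z) (W z) (covD R G S φ W' z ξ) := by
  have h1 : HasFDerivWithinAt (fun z => G (φ z))
      ((fderivWithin ℝ G R (φ z)).comp (fderivWithin ℝ φ S z)) S z :=
    ((hG.differentiableWithinAt hG.smooth (hm hz)).hasFDerivWithinAt).comp z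
      ((hφ z hz).differentiableWithinAt (by simp)).hasFDerivWithinAt
      (fun _ hx => hG.subset (hm hx))
  have h2 := (h1.clm_apply hW.hasFDerivWithinAt).clm_apply hW'.hasFDerivWithinAt
  rw [h2.fderivWithin (hS z hz)]
  simp only [_root_.add_apply, ContinuousLinearMap.comp_apply, ContinuousLinearMap.flip_apply,
    hG.compat (hm hz), covD, map_add]
  ring

/-- The connection along `φ` is torsion-free. -/
lemma covD_symm {z : V} (hz : z ∈ S) (hz' : z ∈ closure (interior S)) (ξ ζ : V) :
    covD R G S φ (fun z => fderivWithin ℝ φ S z ζ) z ξ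
      = covD R G S φ (fun z => fderivWithin ℝ φ S z ξ) z ζ := by
  have hd : DifferentiableWithinAt ℝ (fderivWithin ℝ φ S) S z :=
    (hφ.fderivWithin hS (m := ∞) (by simp) z hz).differentiableWithinAt (by simp)
  have h1 : ∀ η, fderivWithin ℝ (fun z => fderivWithin ℝ φ S z η) S z
      = (fderivWithin ℝ (fderivWithin ℝ φ S) S z).flip η := by
    intro η
    have := hd.hasFDerivWithinAt.clm_apply (hasFDerivWithinAt_const η z S)
    rw [this.fderivWithin (hS z hz)]
    ext; simp
  have h2 : IsSymmSndFDerivWithinAt ℝ φ S z :=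
    (hφ z hz).isSymmSndFDerivWithinAt (by simpa using ENat.LEInfty.out) hS hz' hz
  rw [covD, covD, h1, h1, hG.torsion (hm hz)]
  congr 1
  exact h2.eq ξ ζ

/-- The commutator of covariant derivatives along `φ` is the curvature of the target. -/
lemma covD_comm {W : V → 𝔼 n} (hW : ContDiffOn ℝ ∞ W S) {z : V} (hz : z ∈ S)
    (hz' : z ∈ closure (interior S)) (ξ ζ : V) :
    covD R G S φ (fun z => covD R G S φ W z ζ) z ξ - covD R G S φ (fun z => covD R G S φ W z ξ) z ζ
      = Riem R G (φ z) (fderivWithin ℝ φ S z ξ) (fderivWithin ℝ φ S z ζ) (W z) := by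
  have hdφ : DifferentiableWithinAt ℝ (fderivWithin ℝ φ S) S z :=
    (hφ.fderivWithin hS (m := ∞) (by simp) z hz).differentiableWithinAt (by simp)
  have hdW : DifferentiableWithinAt ℝ (fderivWithin ℝ W S) S z :=
    (hW.fderivWithin hS (m := ∞) (by simp) z hz).differentiableWithinAt (by simp)
  have hsφ : IsSymmSndFDerivWithinAt ℝ φ S z :=
    (hφ z hz).isSymmSndFDerivWithinAt (by simpa using ENat.LEInfty.out) hS hz' hz
  have hsW : IsSymmSndFDerivWithinAt ℝ W S z :=
    (hW z hz).isSymmSndFDerivWithinAt (by simpa using ENat.LEInfty.out) hS hz' hz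
  have hG' := hasFDerivWithinAt_Gam_comp hG hφ hm hz
  have hWd := ((hW z hz).differentiableWithinAt (by simp)).hasFDerivWithinAt
  have key : ∀ a c, fderivWithin ℝ (fun z => covD R G S φ W z a) S z c
      = fderivWithin ℝ (fderivWithin ℝ W S) S z c a
        + (fderivWithin ℝ (Gam R G) R (φ z) (fderivWithin ℝ φ S z c) (fderivWithin ℝ φ S z a) (W z)
          + Gam R G (φ z) (fderivWithin ℝ (fderivWithin ℝ φ S) S z c a) (W z)
          + Gam R G (φ z) (fderivWithin ℝ φ S z a) (fderivWithin ℝ W S z c)) := by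
    intro a c
    have h1 := hdW.hasFDerivWithinAt.clm_apply (hasFDerivWithinAt_const a z S)
    have h2 := hdφ.hasFDerivWithinAt.clm_apply (hasFDerivWithinAt_const a z S)
    have h3 := h1.add ((hG'.clm_apply h2).clm_apply hWd)
    have h4 : (fun z => covD R G S φ W z a) = (fun z => fderivWithin ℝ W S z a)
      + (fun z => Gam R G (φ z) (fderivWithin ℝ φ S z a) (W z)) := rfl
    rw [h4, h3.fderivWithin (hS z hz)]
    simp only [_root_.add_apply, ContinuousLinearMap.comp_apply, ContinuousLinearMap.flip_apply,
      _root_.zero_apply, map_zero, zero_add]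
    abel
  have e1 : fderivWithin ℝ (fderivWithin ℝ φ S) S z ξ ζ
      = fderivWithin ℝ (fderivWithin ℝ φ S) S z ζ ξ := hsφ.eq ξ ζ
  have e2 : fderivWithin ℝ (fderivWithin ℝ W S) S z ξ ζ
      = fderivWithin ℝ (fderivWithin ℝ W S) S z ζ ξ := hsW.eq ξ ζ
  have u1 : ∀ a c, covD R G S φ (fun z => covD R G S φ W z a) z c
      = fderivWithin ℝ (fun z => covD R G S φ W z a) S z c
        + Gam R G (φ z) (fderivWithin ℝ φ S z c) (covD R G S φ W z a) := fun _ _ => rfl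
  rw [u1, u1, key, key, e1, e2]
  simp only [covD, Riem, map_add]
  abel

end Along

/-! ### Charts of the manifold -/

section Charts

variable {M : Type*} [TopologicalSpace M] [ChartedSpace (EuclideanHalfSpace 3) M]
  [IsManifold (𝓡∂ 3) ∞ M] {V : Type*} [NormedAddCommGroup V] [NormedSpace ℝ V]

/-- The metric at `q`, with the tangent space read as `𝔼 3`. -/
def met (g : Metric3 M) (q : M) : 𝔼 3 →L[ℝ] 𝔼 3 →L[ℝ] ℝ := g.inner q

/-- The differential of a map into `M`, with the tangent spaces read as vector spaces. -/
def dm (S : Set V) (f : V → M) (z : V) : V →L[ℝ] 𝔼 3 := mfderivWithin 𝓘(ℝ, V) (𝓡∂ 3) f S z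

/-- The components of the pulled-back metric `f^* g` are smooth. -/
lemma contDiffOn_pullback (g : Metric3 M) {S : Set V} (hS : UniqueDiffOn ℝ S) {f : V → M}
    (hf : ContMDiffOn 𝓘(ℝ, V) (𝓡∂ 3) ∞ f S) (u v : V) :
    ContDiffOn ℝ ∞ (fun z => met g (f z) (dm S f z u) (dm S f z v)) S := by
  have hsec : ∀ u : V, ContMDiffOn 𝓘(ℝ, V) (𝓡∂ 3).tangent ∞
      (fun z => (TotalSpace.mk' (𝔼 3) (f z) (mfderivWithin 𝓘(ℝ, V) (𝓡∂ 3) f S z u) :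
        TangentBundle (𝓡∂ 3) M)) S := by
    intro u
    have hT := hf.contMDiffOn_tangentMapWithin (m := ∞) (by simp) hS.uniqueMDiffOn
    have hc : ContMDiffOn 𝓘(ℝ, V) 𝓘(ℝ, V).tangent ∞
        (fun z => (⟨z, u⟩ : TangentBundle 𝓘(ℝ, V) V)) S :=
      contMDiffOn_vectorSpace_iff_contDiffOn.2 contDiffOn_const
    exact hT.comp hc (fun z hz => hz)
  intro z hz
  have hg := g.contMDiff.contMDiffAt.comp_contMDiffWithinAt z (hf z hz)
  have h := ContMDiffWithinAt.clm_bundle_apply₂ (F₁ := 𝔼 3) (F₂ := 𝔼 3) (F₃ := ℝ)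
    (E₃ := Bundle.Trivial M ℝ) (n := ∞) hg (hsec u z hz) (hsec v z hz)
  simp only [contMDiffWithinAt_totalSpace] at h
  exact h.2.contDiffWithinAt

/-- The metric `g` in the preferred chart at `p`, bundled. -/
def chartG (g : Metric3 M) (p : M) (y : 𝔼 3) : 𝔼 3 →L[ℝ] 𝔼 3 →L[ℝ] ℝ :=
  (met g ((extChartAt (𝓡∂ 3) p).symm y)).bilinearComp
    (dm (range (𝓡∂ 3)) (extChartAt (𝓡∂ 3) p).symm y)
    (dm (range (𝓡∂ 3)) (extChartAt (𝓡∂ 3) p).symm y)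

lemma unc_chartG (g : Metric3 M) (p : M) : unc (chartG g p) = chartMetric g p := rfl

lemma met_symm (g : Metric3 M) (q : M) (u v : 𝔼 3) : met g q u v = met g q v u := g.symm q u v

lemma met_pos (g : Metric3 M) (q : M) {u : 𝔼 3} (hu : u ≠ 0) : 0 < met g q u u := g.pos q u hu

omit [IsManifold (𝓡∂ 3) ∞ M] in
lemma chart_target_nhds (p : M) {y : 𝔼 3} (hy : y ∈ (extChartAt (𝓡∂ 3) p).target) :
    (extChartAt (𝓡∂ 3) p).target ∈ 𝓝[range (𝓡∂ 3)] y := extChartAt_target_mem_nhdsWithin_of_mem hy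

omit [IsManifold (𝓡∂ 3) ∞ M] in
lemma uniqueDiffOn_target (p : M) : UniqueDiffOn ℝ (extChartAt (𝓡∂ 3) p).target :=
  uniqueDiffOn_extChartAt_target p

lemma isRiemannOn_chartG (g : Metric3 M) (p : M) :
    IsRiemannOn (range (𝓡∂ 3)) (extChartAt (𝓡∂ 3) p).target (chartG g p) where
  uniqueDiff := (𝓡∂ 3).uniqueDiffOn
  subset := extChartAt_target_subset_range p
  nhds _ hy := chart_target_nhds p hy
  smooth := by
    have h := contDiffOn_pullback g (uniqueDiffOn_target p) (contMDiffOn_extChartAt_symm (n := ∞) p)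
    refine contDiffOn_clm_apply.2 fun u => contDiffOn_clm_apply.2 fun v => (h u v).congr ?_
    intro y hy
    have e : dm (range (𝓡∂ 3)) (extChartAt (𝓡∂ 3) p).symm y
        = dm (extChartAt (𝓡∂ 3) p).target (extChartAt (𝓡∂ 3) p).symm y := by
      refine mfderivWithin_congr_set (nhdsWithin_eq_iff_eventuallyEq.1 ?_)
      exact le_antisymm (by rw [nhdsWithin_le_iff]; exact chart_target_nhds p hy)
        (nhdsWithin_mono y (extChartAt_target_subset_range p))
    simp only [chartG, ContinuousLinearMap.bilinearComp_apply, e]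
  symm y _ u v := met_symm g _ _ _
  pos y hy u hu := by
    refine met_pos g _ fun h => hu ?_
    have hi := (isInvertible_mfderivWithin_extChartAt_symm (I := 𝓡∂ 3) hy).injective
    exact hi (h.trans (map_zero (dm (range (𝓡∂ 3)) (extChartAt (𝓡∂ 3) p).symm y)).symm)

lemma mdiff_chart (p : M) {q : M} (hq : q ∈ (extChartAt (𝓡∂ 3) p).source) :
    MDifferentiableAt (𝓡∂ 3) 𝓘(ℝ, 𝔼 3) (extChartAt (𝓡∂ 3) p) q := by
  exact mdifferentiableAt_extChartAt (by rwa [← extChartAt_source (I := 𝓡∂ 3)])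

lemma contMDiffOn_chart_comp {S : Set V} {f : V → M} (p : M)
    (hf : ContMDiffOn 𝓘(ℝ, V) (𝓡∂ 3) ∞ f S)
    (hs : MapsTo f S (extChartAt (𝓡∂ 3) p).source) :
    ContDiffOn ℝ ∞ (fun z => extChartAt (𝓡∂ 3) p (f z)) S := by
  have := (contMDiffOn_extChartAt (I := 𝓡∂ 3) (n := ∞) (x := p)).comp hf
    (fun z hz => by simpa using hs hz)
  exact this.contDiffOn

/-- The differential of `f` in the chart at `p` is related to that of `f` by the chart. -/
lemma dm_eq_symm_comp {S : Set V} {f : V → M} (p : M) {z : V} (hu : UniqueDiffWithinAt ℝ S z)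
    (hf : MDifferentiableWithinAt 𝓘(ℝ, V) (𝓡∂ 3) f S z)
    (hs : f z ∈ (extChartAt (𝓡∂ 3) p).source) (ξ : V) :
    dm (range (𝓡∂ 3)) (extChartAt (𝓡∂ 3) p).symm (extChartAt (𝓡∂ 3) p (f z))
      (fderivWithin ℝ (fun z => extChartAt (𝓡∂ 3) p (f z)) S z ξ) = dm S f z ξ := by
  have h1 := mfderivWithin_comp (I := 𝓘(ℝ, V)) (I' := 𝓡∂ 3) (I'' := 𝓘(ℝ, 𝔼 3)) (u := univ) z
    (mdiff_chart p hs).mdifferentiableWithinAt hf (subset_univ _) hu.uniqueMDiffWithinAt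
  have h2 := mfderivWithin_extChartAt_symm_comp_mfderiv_extChartAt' (I := 𝓡∂ 3) hs
  rw [mfderivWithin_univ, mfderivWithin_eq_fderivWithin] at h1
  have h3 : fderivWithin ℝ (fun z => extChartAt (𝓡∂ 3) p (f z)) S z ξ
    = mfderiv (𝓡∂ 3) 𝓘(ℝ, 𝔼 3) (extChartAt (𝓡∂ 3) p) (f z) (dm S f z ξ) :=
    congrArg (fun L : V →L[ℝ] 𝔼 3 => L ξ) h1
  rw [h3]
  exact congrArg (fun L : 𝔼 3 →L[ℝ] 𝔼 3 => L (dm S f z ξ)) h2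

lemma chartG_along (g : Metric3 M) {S : Set V} {f : V → M} (p : M) {z : V}
    (hu : UniqueDiffWithinAt ℝ S z)
    (hf : MDifferentiableWithinAt 𝓘(ℝ, V) (𝓡∂ 3) f S z)
    (hs : f z ∈ (extChartAt (𝓡∂ 3) p).source) (ξ ζ : V) :
    chartG g p (extChartAt (𝓡∂ 3) p (f z))
      (fderivWithin ℝ (fun z => extChartAt (𝓡∂ 3) p (f z)) S z ξ)
      (fderivWithin ℝ (fun z => extChartAt (𝓡∂ 3) p (f z)) S z ζ)
      = met g (f z) (dm S f z ξ) (dm S f z ζ) := by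
  simp only [chartG, ContinuousLinearMap.bilinearComp_apply, dm_eq_symm_comp p hu hf hs]
  rw [(extChartAt (𝓡∂ 3) p).left_inv hs]

lemma coords_eq (p : M) (w : 𝔼 3) : coords p w = w := by
  exact congrArg (fun L : 𝔼 3 →L[ℝ] 𝔼 3 => L w) (mfderiv_extChartAt_self (I := 𝓡∂ 3) (x := p))

lemma chartG_self (g : Metric3 M) (p : M) (u v : 𝔼 3) :
    chartG g p (extChartAt (𝓡∂ 3) p p) u v = met g p u v := by
  have h := mfderivWithin_range_extChartAt_symm (I := 𝓡∂ 3) (x := p)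
  have h' : ∀ w, dm (range (𝓡∂ 3)) (extChartAt (𝓡∂ 3) p).symm (extChartAt (𝓡∂ 3) p p) w = w :=
    fun w => congrArg (fun L : 𝔼 3 →L[ℝ] 𝔼 3 => L w) h
  simp only [chartG, ContinuousLinearMap.bilinearComp_apply, h']
  rw [(extChartAt (𝓡∂ 3) p).left_inv (mem_extChartAt_source p)]

/-- In the chart at the base point, the chart representation has the same differential. -/
lemma fderivWithin_chart_self {S : Set V} {f : V → M} {z : V} (hu : UniqueDiffWithinAt ℝ S z)
    (hf : MDifferentiableWithinAt 𝓘(ℝ, V) (𝓡∂ 3) f S z) (ξ : V) :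
    fderivWithin ℝ (fun x => extChartAt (𝓡∂ 3) (f z) (f x)) S z ξ = dm S f z ξ := by
  have h := mfderivWithin_range_extChartAt_symm (I := 𝓡∂ 3) (x := f z)
  rw [← dm_eq_symm_comp (f z) hu hf (mem_extChartAt_source _) ξ]
  exact (congrArg (fun L : 𝔼 3 →L[ℝ] 𝔼 3 => L _) h).symm

/-- Boundary points lie on the face `{y₀ = 0}` in every chart. -/
lemma chart_zero_of_mem_boundary (p : M) {q : M} (hq : q ∈ (extChartAt (𝓡∂ 3) p).source)
    (hb : q ∈ (𝓡∂ 3).boundary M) : extChartAt (𝓡∂ 3) p q 0 = 0 := by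
  have ht := (extChartAt (𝓡∂ 3) p).map_source hq
  have hr := extChartAt_target_subset_range p ht
  rw [range_modelWithCornersEuclideanHalfSpace] at hr
  by_contra hne
  have hpos : 0 < extChartAt (𝓡∂ 3) p q 0 := lt_of_le_of_ne hr (Ne.symm hne)
  have hnot : ¬ (𝓡∂ 3).IsInteriorPoint q := by
    rw [(𝓡∂ 3).isInteriorPoint_iff_not_isBoundaryPoint]; exact not_not.2 hb
  rw [(𝓡∂ 3).isInteriorPoint_iff_of_mem_atlas (n := ∞) (by simp)
    (chart_mem_atlas (EuclideanHalfSpace 3) p)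
    (by rwa [← extChartAt_source (I := 𝓡∂ 3)])] at hnot
  apply hnot
  rw [mem_interior_iff_mem_nhds]
  have h1 := chart_target_nhds p ht
  rw [nhdsWithin_eq_nhds.2] at h1
  · exact h1
  · rw [range_modelWithCornersEuclideanHalfSpace]
    have hc : Continuous fun y : 𝔼 3 => y 0 := by fun_prop
    exact Filter.mem_of_superset ((isOpen_lt continuous_const hc).mem_nhds hpos)
      (fun y hy => le_of_lt (show (0 : ℝ) < y 0 from hy))

end Charts

/-! ### Orthonormal frames and their connection forms -/

section Frames

variable {n : ℕ}

/-- Expansion of a vector in an orthonormal basis. -/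
lemma orthonormal_expand (A : 𝔼 n →L[ℝ] 𝔼 n →L[ℝ] ℝ) (E : Fin n → 𝔼 n)
    (hE : ∀ i j, A (E i) (E j) = if i = j then 1 else 0) (W : 𝔼 n) :
    ∑ i, A W (E i) • E i = W := by
  have hli : LinearIndependent ℝ E := by
    rw [Fintype.linearIndependent_iff]
    intro f hf i
    have := congrArg (fun w => A w (E i)) hf
    simpa [hE] using this
  have hsp : W ∈ Submodule.span ℝ (range E) := by
    rw [hli.span_eq_top_of_card_eq_finrank' (by simp)]; trivial
  obtain ⟨f, rfl⟩ := (Submodule.mem_span_range_iff_exists_fun ℝ).1 hsp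
  refine Finset.sum_congr rfl fun i _ => ?_
  simp [hE]

/-- Parseval's identity for the bilinear form `A` and a basis orthonormal for it. -/
lemma orthonormal_inner (A : 𝔼 n →L[ℝ] 𝔼 n →L[ℝ] ℝ) (E : Fin n → 𝔼 n)
    (hE : ∀ i j, A (E i) (E j) = if i = j then 1 else 0) (W W' : 𝔼 n) :
    A W W' = ∑ i, A W (E i) * A W' (E i) := by
  conv_lhs => rw [← orthonormal_expand A E hE W, ← orthonormal_expand A E hE W']
  simp [hE, mul_comm]

variable {V : Type*} [NormedAddCommGroup V] [NormedSpace ℝ V]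

/-- The derivative of a function of the parameters in the `k`-th direction, within `S`. -/
abbrev pdv (S : Set V) (e : Fin n → V) (k : Fin n) (f : V → ℝ) (z : V) : ℝ :=
  fderivWithin ℝ f S z (e k)

/-- The components `h` of a metric on the parameter domain `S`, in the directions `e`, together with
the components `c` of an orthonormal frame `E i = ∑ k, c i k ∂ₖ`. -/
structure IsFrame (S : Set V) (h c : Fin n → Fin n → V → ℝ) : Prop where
  smooth_h : ∀ k l, ContDiffOn ℝ ∞ (h k l) S
  smooth_c : ∀ i k, ContDiffOn ℝ ∞ (c i k) S
  orthonormal : ∀ z ∈ S, ∀ i j, ∑ k, ∑ l, c i k z * c j l z * h k l z = if i = j then 1 else 0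

/-- The Christoffel symbols of the first kind, `⟨∇ₖ∂ₘ, ∂ₗ⟩`. -/
def firstKind (S : Set V) (e : Fin n → V) (h : Fin n → Fin n → V → ℝ) (k m l : Fin n) (z : V) : ℝ :=
  (1 / 2) * (pdv S e k (h m l) z + pdv S e m (h k l) z - pdv S e l (h k m) z)

/-- The coframe coefficients `⟨∂ₖ, E i⟩`. -/
def coframe (h c : Fin n → Fin n → V → ℝ) (k i : Fin n) (z : V) : ℝ := ∑ l, c i l z * h k l z

/-- The connection forms `⟨∇ₖ E i, E j⟩` of the frame. -/
def conn (S : Set V) (e : Fin n → V) (h c : Fin n → Fin n → V → ℝ) (k i j : Fin n) (z : V) : ℝ :=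
  ∑ m, ∑ l, (pdv S e k (c i m) z * c j l z * h m l z + c i m z * c j l z * firstKind S e h k m l z)

/-- The curvature `⟨Riem(∂ₖ, ∂ₗ) E i, E j⟩`, in terms of the connection forms. -/
def curvForm (S : Set V) (e : Fin n → V) (h c : Fin n → Fin n → V → ℝ) (k l i j : Fin n) (z : V) :
    ℝ :=
  pdv S e k (conn S e h c l i j) z - pdv S e l (conn S e h c k i j) z
    - ∑ m, (conn S e h c l i m z * conn S e h c k j m z
      - conn S e h c k i m z * conn S e h c l j m z)

variable {S : Set V} {e : Fin n → V} {h c : Fin n → Fin n → V → ℝ}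

namespace IsFrame

variable (hF : IsFrame S h c) (hS : UniqueDiffOn ℝ S)
include hF

include hS

lemma contDiffOn_conn (k i j : Fin n) : ContDiffOn ℝ ∞ (conn S e h c k i j) S := by
  have hp : ∀ k {f : V → ℝ}, ContDiffOn ℝ ∞ f S → ContDiffOn ℝ ∞ (pdv S e k f) S := fun k f hf =>
    (hf.fderivWithin hS (m := ∞) (by simp)).clm_apply contDiffOn_const
  refine ContDiffOn.sum fun m _ => ContDiffOn.sum fun l _ => ?_
  refine (((hp k (hF.smooth_c i m)).mul (hF.smooth_c j l)).mul (hF.smooth_h m l)).add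
    (((hF.smooth_c i m).mul (hF.smooth_c j l)).mul (contDiffOn_const.mul ?_))
  exact ((hp k (hF.smooth_h m l)).add (hp m (hF.smooth_h k l))).sub (hp l (hF.smooth_h k m))

end IsFrame

variable {R T : Set (𝔼 n)} {G : 𝔼 n → 𝔼 n →L[ℝ] 𝔼 n →L[ℝ] ℝ} {φ : V → 𝔼 n}

/-- The frame field `E i` along the map `φ`. -/
def frameAlong (S : Set V) (e : Fin n → V) (φ : V → 𝔼 n) (c : Fin n → Fin n → V → ℝ) (i : Fin n)
    (z : V) : 𝔼 n := ∑ k, c i k z • fderivWithin ℝ φ S z (e k)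

/-- The map `φ` into the coordinate domain pulls the metric `G` back to `h`. -/
structure IsPullback (R T : Set (𝔼 n)) (G : 𝔼 n → 𝔼 n →L[ℝ] 𝔼 n →L[ℝ] ℝ) (S : Set V) (e : Fin n → V)
    (φ : V → 𝔼 n) (h c : Fin n → Fin n → V → ℝ) : Prop extends IsFrame S h c where
  metric : IsRiemannOn R T G
  uniqueDiff : UniqueDiffOn ℝ S
  dense_interior : S ⊆ closure (interior S)
  smooth : ContDiffOn ℝ ∞ φ S
  mapsTo : MapsTo φ S T
  pullback : ∀ z ∈ S, ∀ k l,
    G (φ z) (fderivWithin ℝ φ S z (e k)) (fderivWithin ℝ φ S z (e l)) = h k l z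

namespace IsPullback

variable (hP : IsPullback R T G S e φ h c)
include hP

lemma contDiffOn_dφ (ξ : V) : ContDiffOn ℝ ∞ (fun z => fderivWithin ℝ φ S z ξ) S :=
  (hP.smooth.fderivWithin hP.uniqueDiff (m := ∞) (by simp)).clm_apply contDiffOn_const

lemma contDiffOn_frame (i : Fin n) : ContDiffOn ℝ ∞ (frameAlong S e φ c i) S :=
  ContDiffOn.sum fun k _ => (hP.smooth_c i k).smul (hP.contDiffOn_dφ _)

lemma inner_frame {z : V} (hz : z ∈ S) (i j : Fin n) :
    G (φ z) (frameAlong S e φ c i z) (frameAlong S e φ c j z) = if i = j then 1 else 0 := by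
  rw [← hP.orthonormal z hz i j]
  simp only [frameAlong, map_sum, map_smul, _root_.sum_apply, _root_.smul_apply, smul_eq_mul,
    Finset.mul_sum, hP.pullback z hz]
  rw [Finset.sum_comm]
  exact Finset.sum_congr rfl fun a _ => Finset.sum_congr rfl fun b _ => by ring

lemma inner_coframe {z : V} (hz : z ∈ S) (k i : Fin n) :
    G (φ z) (fderivWithin ℝ φ S z (e k)) (frameAlong S e φ c i z) = coframe h c k i z := by
  simp only [frameAlong, map_sum, map_smul, smul_eq_mul, hP.pullback z hz, coframe]

lemma inner_firstKind {z : V} (hz : z ∈ S) (k m l : Fin n) :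
    G (φ z) (covD R G S φ (fun z => fderivWithin ℝ φ S z (e m)) z (e k))
      (fderivWithin ℝ φ S z (e l)) = firstKind S e h k m l z := by
  have hd : ∀ ξ, DifferentiableWithinAt ℝ (fun z => fderivWithin ℝ φ S z ξ) S z := fun ξ =>
    (hP.contDiffOn_dφ ξ z hz).differentiableWithinAt (by simp)
  have key : ∀ k m l, pdv S e k (h m l) z
      = G (φ z) (covD R G S φ (fun z => fderivWithin ℝ φ S z (e m)) z (e k))
          (fderivWithin ℝ φ S z (e l))
        + G (φ z) (covD R G S φ (fun z => fderivWithin ℝ φ S z (e l)) z (e k))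
          (fderivWithin ℝ φ S z (e m)) := by
    intro k m l
    have h1 := fderivWithin_inner_along hP.metric hP.uniqueDiff hP.smooth hP.mapsTo hz
      (hd (e m)) (hd (e l)) (e k)
    rw [hP.metric.symm _ (hP.mapsTo hz) (fderivWithin ℝ φ S z (e m))] at h1
    rw [← h1]
    have h2 : EqOn (h m l) (fun z => G (φ z) (fderivWithin ℝ φ S z (e m))
      (fderivWithin ℝ φ S z (e l))) S := fun y hy => (hP.pullback y hy m l).symm
    exact congrArg (fun L : V →L[ℝ] ℝ => L (e k)) (fderivWithin_congr h2 (h2 hz))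
  have hs : ∀ a b, covD R G S φ (fun z => fderivWithin ℝ φ S z (e b)) z (e a)
      = covD R G S φ (fun z => fderivWithin ℝ φ S z (e a)) z (e b) := fun a b =>
    covD_symm hP.metric hP.uniqueDiff hP.smooth hP.mapsTo hz (hP.dense_interior hz) _ _
  rw [firstKind, key, key, key, hs m k, hs l k, hs l m]
  ring

lemma inner_conn {z : V} (hz : z ∈ S) (k i j : Fin n) :
    G (φ z) (covD R G S φ (frameAlong S e φ c i) z (e k)) (frameAlong S e φ c j z)
      = conn S e h c k i j z := by
  have h1 : covD R G S φ (frameAlong S e φ c i) z (e k) = _ :=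
    covD_sum hP.uniqueDiff hz (fun m => (hP.smooth_c i m z hz).differentiableWithinAt (by simp))
      (fun m => (hP.contDiffOn_dφ (e m) z hz).differentiableWithinAt (by simp)) (e k)
  rw [h1]
  simp only [frameAlong, map_sum, map_smul, map_add, _root_.sum_apply, _root_.smul_apply,
    _root_.add_apply, smul_eq_mul, Finset.mul_sum, hP.pullback z hz, hP.inner_firstKind hz, conn]
  rw [Finset.sum_comm]
  exact Finset.sum_congr rfl fun a _ => Finset.sum_congr rfl fun b _ => by ring

lemma conn_antisymm {z : V} (hz : z ∈ S) (k i j : Fin n) :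
    conn S e h c k i j z = -conn S e h c k j i z := by
  have hd : ∀ i, DifferentiableWithinAt ℝ (frameAlong S e φ c i) S z := fun i =>
    (hP.contDiffOn_frame i z hz).differentiableWithinAt (by simp)
  have h1 := fderivWithin_inner_along hP.metric hP.uniqueDiff hP.smooth hP.mapsTo hz
    (hd i) (hd j) (e k)
  have h2 : EqOn (fun z => G (φ z) (frameAlong S e φ c i z) (frameAlong S e φ c j z))
    (fun _ => if i = j then 1 else 0) S := fun y hy => hP.inner_frame hy i j
  rw [fderivWithin_congr h2 (h2 hz), fderivWithin_const_apply,
    hP.metric.symm _ (hP.mapsTo hz) (frameAlong S e φ c i z), hP.inner_conn hz,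
    hP.inner_conn hz] at h1
  simp only [_root_.zero_apply] at h1
  linarith

/-- The first structure equation (vanishing torsion). -/
lemma structure_eq {z : V} (hz : z ∈ S) (k l i : Fin n) :
    pdv S e k (coframe h c l i) z + ∑ j, coframe h c l j z * conn S e h c k j i z
      = pdv S e l (coframe h c k i) z + ∑ j, coframe h c k j z * conn S e h c l j i z := by
  have key : ∀ k l, pdv S e k (coframe h c l i) z + ∑ j, coframe h c l j z * conn S e h c k j i z
      = G (φ z) (covD R G S φ (fun z => fderivWithin ℝ φ S z (e l)) z (e k))
          (frameAlong S e φ c i z) := by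
    intro k l
    have h1 := fderivWithin_inner_along hP.metric hP.uniqueDiff hP.smooth hP.mapsTo hz
      ((hP.contDiffOn_dφ (e l) z hz).differentiableWithinAt (by simp))
      ((hP.contDiffOn_frame i z hz).differentiableWithinAt (by simp)) (e k)
    have h2 : EqOn (coframe h c l i) (fun z => G (φ z) (fderivWithin ℝ φ S z (e l))
      (frameAlong S e φ c i z)) S := fun y hy => (hP.inner_coframe hy l i).symm
    have h3 : pdv S e k (coframe h c l i) z = fderivWithin ℝ (fun z => G (φ z)
      (fderivWithin ℝ φ S z (e l)) (frameAlong S e φ c i z)) S z (e k) :=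
      congrArg (fun L : V →L[ℝ] ℝ => L (e k)) (fderivWithin_congr h2 (h2 hz))
    rw [h3, h1, orthonormal_inner (G (φ z)) (fun j => frameAlong S e φ c j z)
      (hP.inner_frame hz) (fderivWithin ℝ φ S z (e l))]
    simp only [hP.inner_coframe hz, hP.inner_conn hz]
    rw [add_assoc, ← Finset.sum_add_distrib]
    simp only [hP.conn_antisymm hz k i]
    simp
  rw [key, key, covD_symm hP.metric hP.uniqueDiff hP.smooth hP.mapsTo hz (hP.dense_interior hz)]

/-- The second structure equation. -/
lemma inner_Riem {z : V} (hz : z ∈ S) (k l i j : Fin n) :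
    G (φ z) (Riem R G (φ z) (fderivWithin ℝ φ S z (e k)) (fderivWithin ℝ φ S z (e l))
      (frameAlong S e φ c i z)) (frameAlong S e φ c j z) = curvForm S e h c k l i j z := by
  have key : ∀ k l, G (φ z) (covD R G S φ (fun z => covD R G S φ (frameAlong S e φ c i) z (e l))
      z (e k)) (frameAlong S e φ c j z) = pdv S e k (conn S e h c l i j) z
        - ∑ m, conn S e h c l i m z * conn S e h c k j m z := by
    intro k l
    have h1 := fderivWithin_inner_along hP.metric hP.uniqueDiff hP.smooth hP.mapsTo hz
      ((contDiffOn_covD hP.metric hP.uniqueDiff hP.smooth hP.mapsTo (hP.contDiffOn_frame i) (e l)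
        z hz).differentiableWithinAt (by simp))
      ((hP.contDiffOn_frame j z hz).differentiableWithinAt (by simp)) (e k)
    have h2 : EqOn (conn S e h c l i j) (fun z => G (φ z)
      (covD R G S φ (frameAlong S e φ c i) z (e l)) (frameAlong S e φ c j z)) S :=
      fun y hy => (hP.inner_conn hy l i j).symm
    have h3 : pdv S e k (conn S e h c l i j) z = fderivWithin ℝ (fun z => G (φ z)
      (covD R G S φ (frameAlong S e φ c i) z (e l)) (frameAlong S e φ c j z)) S z (e k) :=
      congrArg (fun L : V →L[ℝ] ℝ => L (e k)) (fderivWithin_congr h2 (h2 hz))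
    rw [h3, h1, orthonormal_inner (G (φ z)) (fun j => frameAlong S e φ c j z)
      (hP.inner_frame hz) (covD R G S φ (frameAlong S e φ c i) z (e l))]
    simp only [hP.inner_conn hz]
    ring
  rw [← covD_comm hP.metric hP.uniqueDiff hP.smooth hP.mapsTo (hP.contDiffOn_frame i) hz
    (hP.dense_interior hz), map_sub, _root_.sub_apply, key, key, curvForm, Finset.sum_sub_distrib]
  ring

/-- The scalar curvature in terms of the connection forms of an orthonormal frame. -/
lemma scalarCoord_eq {z : V} (hz : z ∈ S) :
    scalarCoord R (unc G) (φ z)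
      = ∑ i, ∑ j, ∑ k, ∑ l, c i k z * c j l z * curvForm S e h c k l j i z := by
  rw [hP.metric.scalarCoord_eq (hP.mapsTo hz) (fun i => frameAlong S e φ c i z)
    (hP.inner_frame hz)]
  refine Finset.sum_congr rfl fun i _ => Finset.sum_congr rfl fun j _ => ?_
  set A := fderivWithin ℝ (Gam R G) R (φ z) with hA
  set B := Gam R G (φ z) with hB
  have e1 : ∀ v w q, G (φ z) (Riem R G (φ z) (frameAlong S e φ c i z) v w) q
      = ∑ k, c i k z * G (φ z) (Riem R G (φ z) (fderivWithin ℝ φ S z (e k)) v w) q := by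
    intro v w q
    have hl := isLinearMap_comp_inner (isLinearMap_riem₁ A B v w) (G (φ z)) q
    have h2 := map_sum hl.mk' (fun k => c i k z • fderivWithin ℝ φ S z (e k)) Finset.univ
    simp only [map_smul, smul_eq_mul] at h2
    exact h2
  have e2 : ∀ u w q, G (φ z) (Riem R G (φ z) u (frameAlong S e φ c j z) w) q
      = ∑ l, c j l z * G (φ z) (Riem R G (φ z) u (fderivWithin ℝ φ S z (e l)) w) q := by
    intro u w q
    have hl := isLinearMap_comp_inner (isLinearMap_riem₂ A B u w) (G (φ z)) q
    have h2 := map_sum hl.mk' (fun k => c j k z • fderivWithin ℝ φ S z (e k)) Finset.univ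
    simp only [map_smul, smul_eq_mul] at h2
    exact h2
  rw [e1]
  refine Finset.sum_congr rfl fun k _ => ?_
  rw [e2, Finset.mul_sum]
  refine Finset.sum_congr rfl fun l _ => ?_
  rw [hP.inner_Riem hz, mul_assoc]

end IsPullback

end Frames

/-! ### The Gram-Schmidt frame -/

section Cholesky

variable {V : Type*} [NormedAddCommGroup V] [NormedSpace ℝ V]

/-- A matrix-valued function is symmetric and positive definite on `S`. -/
structure IsPosDefOn (S : Set V) (h : Fin 3 → Fin 3 → V → ℝ) : Prop where
  symm : ∀ z ∈ S, ∀ k l, h k l z = h l k z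
  pos : ∀ z ∈ S, ∀ x : Fin 3 → ℝ, x ≠ 0 → 0 < ∑ k, ∑ l, x k * x l * h k l z

variable (h : Fin 3 → Fin 3 → V → ℝ) (z : V)

/-- The entry `(0, 0)` of the Cholesky factor of `h`. -/
def chP : ℝ := Real.sqrt (h 0 0 z)
/-- The entry `(1, 0)` of the Cholesky factor of `h`. -/
def chQ : ℝ := h 0 1 z / chP h z
/-- The entry `(1, 1)` of the Cholesky factor of `h`. -/
def chR : ℝ := Real.sqrt (h 1 1 z - chQ h z ^ 2)
/-- The entry `(2, 0)` of the Cholesky factor of `h`. -/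
def chS : ℝ := h 0 2 z / chP h z
/-- The entry `(2, 1)` of the Cholesky factor of `h`. -/
def chU : ℝ := (h 1 2 z - chS h z * chQ h z) / chR h z
/-- The entry `(2, 2)` of the Cholesky factor of `h`: the normal speed of the family of surfaces
`{t = const}`. -/
def chV : ℝ := Real.sqrt (h 2 2 z - chS h z ^ 2 - chU h z ^ 2)

/-- The inverse of the Cholesky factor of `h`: the components of the orthonormal frame obtained from
the coordinate frame by the Gram-Schmidt process. -/
def cholC (i k : Fin 3) (z : V) : ℝ :=
  ![![1 / chP h z, 0, 0],
    ![-chQ h z / (chP h z * chR h z), 1 / chR h z, 0],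
    ![(-chS h z + chU h z * chQ h z / chR h z) / (chP h z * chV h z),
      -chU h z / (chV h z * chR h z), 1 / chV h z]] i k

variable {h z} {S : Set V}

omit [NormedAddCommGroup V] [NormedSpace ℝ V] in
lemma chol_pos (hp : IsPosDefOn S h) (hz : z ∈ S) :
    0 < h 0 0 z ∧ 0 < h 1 1 z - chQ h z ^ 2 ∧ 0 < h 2 2 z - chS h z ^ 2 - chU h z ^ 2 := by
  have s10 := hp.symm z hz 1 0
  have s20 := hp.symm z hz 2 0
  have s21 := hp.symm z hz 2 1
  have h0 : 0 < h 0 0 z := by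
    have := hp.pos z hz ![1, 0, 0] (fun h => by simpa using congrFun h 0)
    simpa [Fin.sum_univ_three] using this
  have hP : 0 < chP h z := Real.sqrt_pos.2 h0
  have hP2 : chP h z ^ 2 = h 0 0 z := Real.sq_sqrt h0.le
  have hQ : h 0 1 z = chQ h z * chP h z := by rw [chQ]; field_simp
  have hS : h 0 2 z = chS h z * chP h z := by rw [chS]; field_simp
  have h1 : 0 < h 1 1 z - chQ h z ^ 2 := by
    have := hp.pos z hz ![-chQ h z / chP h z, 1, 0] (fun h => by simpa using congrFun h 1)
    simp only [Fin.sum_univ_three, Matrix.cons_val_zero, Matrix.cons_val_one, Matrix.cons_val,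
      s10, s20, s21, hQ, hS, ← hP2] at this
    convert this using 1
    field_simp
    ring
  have hR : 0 < chR h z := Real.sqrt_pos.2 h1
  have hR2 : chR h z ^ 2 = h 1 1 z - chQ h z ^ 2 := Real.sq_sqrt h1.le
  have hU : h 1 2 z = chU h z * chR h z + chS h z * chQ h z := by rw [chU]; field_simp; ring
  refine ⟨h0, h1, ?_⟩
  have := hp.pos z hz ![(-chS h z + chU h z * chQ h z / chR h z) / chP h z, -chU h z / chR h z, 1]
    (fun h => by simpa using congrFun h 2)
  simp only [Fin.sum_univ_three, Matrix.cons_val_zero, Matrix.cons_val_one, Matrix.cons_val,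
    s10, s20, s21, hQ, hS, hU, ← hP2, show h 1 1 z = chR h z ^ 2 + chQ h z ^ 2 by linarith] at this
  convert this using 1
  field_simp
  ring

omit [NormedAddCommGroup V] [NormedSpace ℝ V] in
lemma chP_pos (hp : IsPosDefOn S h) (hz : z ∈ S) : 0 < chP h z :=
  Real.sqrt_pos.2 (chol_pos hp hz).1

omit [NormedAddCommGroup V] [NormedSpace ℝ V] in
lemma chR_pos (hp : IsPosDefOn S h) (hz : z ∈ S) : 0 < chR h z :=
  Real.sqrt_pos.2 (chol_pos hp hz).2.1

omit [NormedAddCommGroup V] [NormedSpace ℝ V] in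
lemma chV_pos (hp : IsPosDefOn S h) (hz : z ∈ S) : 0 < chV h z :=
  Real.sqrt_pos.2 (chol_pos hp hz).2.2

omit [NormedAddCommGroup V] [NormedSpace ℝ V] in
/-- The Cholesky decomposition of `h`. -/
lemma chol_eqs (hp : IsPosDefOn S h) (hz : z ∈ S) :
    h 0 0 z = chP h z ^ 2 ∧ h 0 1 z = chP h z * chQ h z ∧ h 0 2 z = chP h z * chS h z
      ∧ h 1 1 z = chQ h z ^ 2 + chR h z ^ 2 ∧ h 1 2 z = chS h z * chQ h z + chU h z * chR h z
      ∧ h 2 2 z = chS h z ^ 2 + chU h z ^ 2 + chV h z ^ 2 := by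
  obtain ⟨h0, h1, h2⟩ := chol_pos hp hz
  have hP := chP_pos hp hz
  have hR := chR_pos hp hz
  have hP2 : chP h z ^ 2 = h 0 0 z := Real.sq_sqrt h0.le
  have hR2 : chR h z ^ 2 = h 1 1 z - chQ h z ^ 2 := Real.sq_sqrt h1.le
  have hV2 : chV h z ^ 2 = h 2 2 z - chS h z ^ 2 - chU h z ^ 2 := Real.sq_sqrt h2.le
  refine ⟨hP2.symm, ?_, ?_, by linarith, ?_, by linarith⟩
  · rw [chQ]; field_simp
  · rw [chS]; field_simp
  · rw [chU]; field_simp; ring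

omit [NormedAddCommGroup V] [NormedSpace ℝ V] in
/-- The coframe of the Gram-Schmidt frame is the Cholesky factor. -/
lemma coframe_chol (hp : IsPosDefOn S h) (hz : z ∈ S) (k i : Fin 3) :
    coframe h (cholC h) k i z
      = ![![chP h z, 0, 0], ![chQ h z, chR h z, 0], ![chS h z, chU h z, chV h z]] k i := by
  obtain ⟨e1, e2, e3, e4, e5, e6⟩ := chol_eqs hp hz
  have s10 := hp.symm z hz 1 0
  have s20 := hp.symm z hz 2 0
  have s21 := hp.symm z hz 2 1
  have hP := (chP_pos hp hz).ne'
  have hR := (chR_pos hp hz).ne'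
  have hV := (chV_pos hp hz).ne'
  fin_cases k <;> fin_cases i <;>
    simp [coframe, cholC, Fin.sum_univ_three, s10, s20, s21, e1, e2, e3, e4, e5, e6] <;>
    field_simp <;> ring

lemma contDiffOn_chol (hh : ∀ k l, ContDiffOn ℝ ∞ (h k l) S) (hp : IsPosDefOn S h) :
    ContDiffOn ℝ ∞ (chP h) S ∧ ContDiffOn ℝ ∞ (chQ h) S ∧ ContDiffOn ℝ ∞ (chR h) S
      ∧ ContDiffOn ℝ ∞ (chS h) S ∧ ContDiffOn ℝ ∞ (chU h) S ∧ ContDiffOn ℝ ∞ (chV h) S := by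
  have a1 : ContDiffOn ℝ ∞ (chP h) S := (hh 0 0).sqrt fun z hz => (chol_pos hp hz).1.ne'
  have a2 : ContDiffOn ℝ ∞ (chQ h) S := (hh 0 1).div a1 fun z hz => (chP_pos hp hz).ne'
  have a3 : ContDiffOn ℝ ∞ (chR h) S :=
    ((hh 1 1).sub (a2.pow 2)).sqrt fun z hz => (chol_pos hp hz).2.1.ne'
  have a4 : ContDiffOn ℝ ∞ (chS h) S := (hh 0 2).div a1 fun z hz => (chP_pos hp hz).ne'
  have a5 : ContDiffOn ℝ ∞ (chU h) S :=
    ((hh 1 2).sub (a4.mul a2)).div a3 fun z hz => (chR_pos hp hz).ne'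
  exact ⟨a1, a2, a3, a4, a5,
    (((hh 2 2).sub (a4.pow 2)).sub (a5.pow 2)).sqrt fun z hz => (chol_pos hp hz).2.2.ne'⟩

lemma isFrame_chol (hh : ∀ k l, ContDiffOn ℝ ∞ (h k l) S) (hp : IsPosDefOn S h) :
    IsFrame S h (cholC h) where
  smooth_h := hh
  smooth_c i k := by
    obtain ⟨a1, a2, a3, a4, a5, a6⟩ := contDiffOn_chol hh hp
    have n1 : ∀ z ∈ S, chP h z ≠ 0 := fun z hz => (chP_pos hp hz).ne'
    have n2 : ∀ z ∈ S, chR h z ≠ 0 := fun z hz => (chR_pos hp hz).ne'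
    have n3 : ∀ z ∈ S, chV h z ≠ 0 := fun z hz => (chV_pos hp hz).ne'
    fin_cases i <;> fin_cases k
    · exact contDiffOn_const.div a1 n1
    · exact contDiffOn_const
    · exact contDiffOn_const
    · exact a2.neg.div (a1.mul a3) fun z hz => mul_ne_zero (n1 z hz) (n2 z hz)
    · exact contDiffOn_const.div a3 n2
    · exact contDiffOn_const
    · exact (a4.neg.add ((a5.mul a2).div a3 n2)).div (a1.mul a6)
        fun z hz => mul_ne_zero (n1 z hz) (n3 z hz)
    · exact a5.neg.div (a6.mul a3) fun z hz => mul_ne_zero (n3 z hz) (n2 z hz)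
    · exact contDiffOn_const.div a6 n3
  orthonormal z hz i j := by
    have h1 : ∑ k, ∑ l, cholC h i k z * cholC h j l z * h k l z
        = ∑ k, cholC h i k z * coframe h (cholC h) k j z := by
      refine Finset.sum_congr rfl fun k _ => ?_
      rw [coframe, Finset.mul_sum]
      exact Finset.sum_congr rfl fun l _ => by ring
    rw [h1]
    simp only [coframe_chol hp hz]
    have hP := (chP_pos hp hz).ne'
    have hR := (chR_pos hp hz).ne'
    have hV := (chV_pos hp hz).ne'
    fin_cases i <;> fin_cases j <;> simp [cholC, Fin.sum_univ_three] <;> field_simp <;> ring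

end Cholesky

/-! ### The divergence identity for a family of constant mean curvature surfaces -/

/-- The pointwise algebra behind the divergence identity. Subscripts denote derivatives in the
coordinate directions; `(p, q, r, s, u, v)` is the coframe, `w` the connection form of the leaves,
`a` their second fundamental form, `H` their mean curvature, and `(y0, y1)` the acceleration of the
unit normal in the normal direction (multiplied by the speed `v`). -/
lemma divergence_algebra
    {p q r s u v w0 w1 w2 a00 a01 a10 a11 a20 a21 H y0 y1
      p0 p1 p2 q0 q1 q2 r0 r1 r2 s0 s1 u0 u1 v0 v1 w01 w10
      a00_0 a00_1 a00_2 a01_0 a01_1 a01_2 a10_0 a11_0 a11_1 a11_2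
      a20_0 a21_0 a21_1 H2 y0_0 y1_0 y1_1 c00 c10 c11 c20 c21 c22 : ℝ}
    (hp : p ≠ 0) (hr : r ≠ 0) (hv : v ≠ 0)
    (hc00 : c00 = 1 / p) (hc11 : c11 = 1 / r) (hc10 : c10 = -q / (p * r)) (hc22 : c22 = 1 / v)
    (hc21 : c21 = -u / (v * r)) (hc20 : c20 = (-s + u * q / r) / (p * v))
    (t1 : p1 = q0 + r * w0) (t2 : r0 = q * w0 - p * w1) (t3 : a10 = (q * a00 + r * a01) / p)
    (t4 : p2 = s0 + u * w0 + v * a00) (t5 : u0 = s * w0 - v * a01 - p * w2)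
    (t6 : v0 = s * a00 + u * a01 - p * a20)
    (t7 : q2 = s1 + u * w1 + v * a10 - r * w2) (t8 : r2 = u1 - s * w1 + v * a11 + q * w2)
    (t9 : v1 = s * a10 + u * a11 - q * a20 - r * a21)
    (hH : H = (r * a00 - q * a01 + p * a11) / (p * r))
    (hH0 : p0 * r * H + p * r0 * H = r0 * a00 + r * a00_0 - q0 * a01 - q * a01_0 + p0 * a11
      + p * a11_0)
    (hH1 : p1 * r * H + p * r1 * H = r1 * a00 + r * a00_1 - q1 * a01 - q * a01_1 + p1 * a11
      + p * a11_1)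
    (hH2 : p2 * r * H + p * r2 * H + p * r * H2 = r2 * a00 + r * a00_2 - q2 * a01 - q * a01_2
      + p2 * a11 + p * a11_2)
    (ha0 : p0 * a10 + p * a10_0 = q0 * a00 + q * a00_0 + r0 * a01 + r * a01_0)
    (hy0 : y0 = - v0 / p) (hy1 : y1 = (q * v0 - p * v1) / (p * r))
    (hy00 : p0 * r * y0 + p * r0 * y0 + p * r * y0_0
      = p0 * r * a20 + p * r0 * a20 + p * r * a20_0
        - (s0 * r * a00 + s * r0 * a00 + s * r * a00_0) + (u0 * q * a00 + u * q0 * a00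
      + u * q * a00_0)
        - (u0 * p * a10 + u * p0 * a10 + u * p * a10_0))
    (hy10 : p0 * r * y1 + p * r0 * y1 + p * r * y1_0
      = p0 * r * a21 + p * r0 * a21 + p * r * a21_0
        - (s0 * r * a01 + s * r0 * a01 + s * r * a01_0) + (u0 * q * a01 + u * q0 * a01
      + u * q * a01_0)
        - (u0 * p * a11 + u * p0 * a11 + u * p * a11_0))
    (hy11 : p1 * r * y1 + p * r1 * y1 + p * r * y1_1
      = p1 * r * a21 + p * r1 * a21 + p * r * a21_1
        - (s1 * r * a01 + s * r1 * a01 + s * r * a01_1) + (u1 * q * a01 + u * q1 * a01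
      + u * q * a01_1)
        - (u1 * p * a11 + u * p1 * a11 + u * p * a11_1)) :
    (r0 * y0 + r * y0_0 - q0 * y1 - q * y1_0) / v - (r * y0 - q * y1) * v0 / v ^ 2 + w10
      + (p1 * y1 + p * y1_1) / v - p * y1 * v1 / v ^ 2 - w01
    = p * r * (H2 / v
      + (c00 * c11 * (w10 - w01 - (a11 * a00 - a01 * a10))
        + c00 * (c21 * (a10_0 - a00_1 + a11 * w0 - a01 * w1)
          + c22 * (a20_0 - a00_2 + a21 * w0 - a01 * w2))
        + c10 * (c21 * (a11_0 - a01_1 - (a10 * w0 - a00 * w1))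
          + c22 * (a21_0 - a01_2 - (a20 * w0 - a00 * w2)))
        + c11 * (-c20 * (a11_0 - a01_1 - (a10 * w0 - a00 * w1))
          + c22 * (a21_1 - a11_2 - (a20 * w1 - a10 * w2))))
      + (1 / 2) * (H ^ 2 + (a00 ^ 2 / p ^ 2 + 2 * (a01 / p) ^ 2 + ((a11 - q * a01 / p) / r) ^ 2))
      + (y0 ^ 2 + y1 ^ 2) / v ^ 2) := by
  have e1 : y0_0 = (p0 * r * a20 + p * r0 * a20 + p * r * a20_0
        - (s0 * r * a00 + s * r0 * a00 + s * r * a00_0) + (u0 * q * a00 + u * q0 * a00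
      + u * q * a00_0)
        - (u0 * p * a10 + u * p0 * a10 + u * p * a10_0) - (p0 * r * y0
      + p * r0 * y0)) / (p * r) := by
    field_simp; linear_combination hy00
  have e2 : y1_0 = (p0 * r * a21 + p * r0 * a21 + p * r * a21_0
        - (s0 * r * a01 + s * r0 * a01 + s * r * a01_0) + (u0 * q * a01 + u * q0 * a01
      + u * q * a01_0)
        - (u0 * p * a11 + u * p0 * a11 + u * p * a11_0) - (p0 * r * y1
      + p * r0 * y1)) / (p * r) := by
    field_simp; linear_combination hy10
  have e3 : y1_1 = (p1 * r * a21 + p * r1 * a21 + p * r * a21_1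
        - (s1 * r * a01 + s * r1 * a01 + s * r * a01_1) + (u1 * q * a01 + u * q1 * a01
      + u * q * a01_1)
        - (u1 * p * a11 + u * p1 * a11 + u * p * a11_1) - (p1 * r * y1
      + p * r1 * y1)) / (p * r) := by
    field_simp; linear_combination hy11
  have e4 : a10_0 = (q0 * a00 + q * a00_0 + r0 * a01 + r * a01_0 - p0 * a10) / p := by
    field_simp; linear_combination ha0
  have e6 : a11_0 = (p0 * r * H + p * r0 * H - (r0 * a00 + r * a00_0 - q0 * a01 - q * a01_0
      + p0 * a11)) / p := by
    field_simp; linear_combination -hH0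
  have e7 : a11_1 = (p1 * r * H + p * r1 * H - (r1 * a00 + r * a00_1 - q1 * a01 - q * a01_1
      + p1 * a11)) / p := by
    field_simp; linear_combination -hH1
  have e8 : H2 = (r2 * a00 + r * a00_2 - q2 * a01 - q * a01_2 + p2 * a11 + p * a11_2
      - (p2 * r * H + p * r2 * H)) / (p * r) := by
    field_simp; linear_combination hH2
  rw [e1, e2, e3, e8, e4, e6, e7, hc00, hc10, hc11, hc20, hc21, hc22, hy0, hy1, hH]
  rw [t4, t7, t8, t9, t6, t5, t1, t2, t3]
  field_simp
  ring

section Divergence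

variable {V : Type*} [NormedAddCommGroup V] [NormedSpace ℝ V] {n : ℕ} {S : Set V} {e : Fin n → V}
  {z : V} {k : Fin n} {f g : V → ℝ}

lemma pdv_mul (hu : UniqueDiffWithinAt ℝ S z) (hf : DifferentiableWithinAt ℝ f S z)
    (hg : DifferentiableWithinAt ℝ g S z) :
    pdv S e k (fun y => f y * g y) z = pdv S e k f z * g z + f z * pdv S e k g z := by
  simp only [pdv, fderivWithin_fun_mul hu hf hg, _root_.add_apply, _root_.smul_apply, smul_eq_mul]
  ring

lemma pdv_add (hu : UniqueDiffWithinAt ℝ S z) (hf : DifferentiableWithinAt ℝ f S z)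
    (hg : DifferentiableWithinAt ℝ g S z) :
    pdv S e k (fun y => f y + g y) z = pdv S e k f z + pdv S e k g z := by
  simp only [pdv, fderivWithin_fun_add hu hf hg, _root_.add_apply]

lemma pdv_sub (hu : UniqueDiffWithinAt ℝ S z) (hf : DifferentiableWithinAt ℝ f S z)
    (hg : DifferentiableWithinAt ℝ g S z) :
    pdv S e k (fun y => f y - g y) z = pdv S e k f z - pdv S e k g z := by
  simp only [pdv, fderivWithin_fun_sub hu hf hg, _root_.sub_apply]

lemma pdv_div (hu : UniqueDiffWithinAt ℝ S z) (hf : DifferentiableWithinAt ℝ f S z)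
    (hg : DifferentiableWithinAt ℝ g S z) (h0 : g z ≠ 0) :
    pdv S e k (fun y => f y / g y) z = pdv S e k f z / g z - f z * pdv S e k g z / g z ^ 2 := by
  have h1 : HasFDerivWithinAt (fun y => (g y)⁻¹) (-(g z ^ 2)⁻¹ • fderivWithin ℝ g S z) S z :=
    (hasDerivAt_inv h0).comp_hasFDerivWithinAt z hg.hasFDerivWithinAt
  have h2 := (hf.hasFDerivWithinAt.mul h1).fderivWithin hu
  simp only [pdv, div_eq_mul_inv]
  change fderivWithin ℝ (f * fun y => (g y)⁻¹) S z (e k) = _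
  rw [h2]
  simp only [_root_.add_apply, _root_.smul_apply, smul_eq_mul]
  ring

lemma differentiableWithinAt_div (hf : DifferentiableWithinAt ℝ f S z)
    (hg : DifferentiableWithinAt ℝ g S z) (h0 : g z ≠ 0) :
    DifferentiableWithinAt ℝ (fun y => f y / g y) S z := by
  have h1 : HasFDerivWithinAt (fun y => (g y)⁻¹) (-(g z ^ 2)⁻¹ • fderivWithin ℝ g S z) S z :=
    (hasDerivAt_inv h0).comp_hasFDerivWithinAt z hg.hasFDerivWithinAt
  simp only [div_eq_mul_inv]
  exact hf.mul h1.differentiableWithinAt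

lemma pdv_congr (hz : z ∈ S) (h : EqOn f g S) : pdv S e k f z = pdv S e k g z := by
  simp only [pdv, fderivWithin_congr h (h hz)]

/-- A metric `h` on the parameter domain, whose Gram-Schmidt frame satisfies the structure
equations of the Levi-Civita connection. -/
structure IsMovingFrame (S : Set V) (e : Fin 3 → V) (h : Fin 3 → Fin 3 → V → ℝ) : Prop where
  uniqueDiff : UniqueDiffOn ℝ S
  smooth : ∀ k l, ContDiffOn ℝ ∞ (h k l) S
  posDef : IsPosDefOn S h
  antisymm : ∀ z ∈ S, ∀ k i j, conn S e h (cholC h) k i j z = -conn S e h (cholC h) k j i z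
  structure_eq : ∀ z ∈ S, ∀ k l i, pdv S e k (coframe h (cholC h) l i) z
      + ∑ j, coframe h (cholC h) l j z * conn S e h (cholC h) k j i z
    = pdv S e l (coframe h (cholC h) k i) z
      + ∑ j, coframe h (cholC h) k j z * conn S e h (cholC h) l j i z

/-- The components of `∇_{vN} N = -∇v` in the frame, where `∂ₜ = v N + T` with `T` tangent to the
leaves. -/
def accel (S : Set V) (e : Fin 3 → V) (h : Fin 3 → Fin 3 → V → ℝ) (i : Fin 3) (z : V) : ℝ :=
  conn S e h (cholC h) 2 2 i z - chS h z / chP h z * conn S e h (cholC h) 0 2 i z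
    + chU h z * chQ h z / (chP h z * chR h z) * conn S e h (cholC h) 0 2 i z
    - chU h z / chR h z * conn S e h (cholC h) 1 2 i z

/-- The first component of the flux: the sum of `-√(det h) ∇ log v` and of the rotated connection
form of the leaves. -/
def flux0 (S : Set V) (e : Fin 3 → V) (h : Fin 3 → Fin 3 → V → ℝ) (z : V) : ℝ :=
  (chR h z * accel S e h 0 z - chQ h z * accel S e h 1 z) / chV h z
    + conn S e h (cholC h) 1 1 0 z

/-- The second component of the flux. -/
def flux1 (S : Set V) (e : Fin 3 → V) (h : Fin 3 → Fin 3 → V → ℝ) (z : V) : ℝ :=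
  chP h z * accel S e h 1 z / chV h z - conn S e h (cholC h) 0 1 0 z

/-- The mean curvature of the leaves `{t = const}`, as the trace of the connection form. -/
def leafMean (S : Set V) (e : Fin 3 → V) (h : Fin 3 → Fin 3 → V → ℝ) (z : V) : ℝ :=
  ∑ i : Fin 2, ∑ k : Fin 2, cholC h i.castSucc k.castSucc z
    * conn S e h (cholC h) k.castSucc 2 i.castSucc z

/-- The scalar curvature in terms of the connection forms. -/
def frameScalar (S : Set V) (e : Fin 3 → V) (h : Fin 3 → Fin 3 → V → ℝ) (z : V) : ℝ :=
  ∑ i, ∑ j, ∑ k, ∑ l, cholC h i k z * cholC h j l z * curvForm S e h (cholC h) k l j i z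

namespace IsMovingFrame

variable {S : Set V} {e : Fin 3 → V} {h : Fin 3 → Fin 3 → V → ℝ} {z : V}
  (hM : IsMovingFrame S e h)
include hM

lemma smooth_conn (k i j : Fin 3) : ContDiffOn ℝ ∞ (conn S e h (cholC h) k i j) S :=
  (isFrame_chol hM.smooth hM.posDef).contDiffOn_conn hM.uniqueDiff k i j

lemma smooth_accel (i : Fin 3) : ContDiffOn ℝ ∞ (accel S e h i) S := by
  obtain ⟨a1, a2, a3, a4, a5, a6⟩ := contDiffOn_chol hM.smooth hM.posDef
  have n1 : ∀ z ∈ S, chP h z ≠ 0 := fun z hz => (chP_pos hM.posDef hz).ne'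
  have n2 : ∀ z ∈ S, chR h z ≠ 0 := fun z hz => (chR_pos hM.posDef hz).ne'
  exact (((hM.smooth_conn 2 2 i).sub ((a4.div a1 n1).mul (hM.smooth_conn 0 2 i))).add
    (((a5.mul a2).div (a1.mul a3) fun z hz => mul_ne_zero (n1 z hz) (n2 z hz)).mul
      (hM.smooth_conn 0 2 i))).sub ((a5.div a3 n2).mul (hM.smooth_conn 1 2 i))

lemma smooth_flux0 : ContDiffOn ℝ ∞ (flux0 S e h) S := by
  obtain ⟨a1, a2, a3, a4, a5, a6⟩ := contDiffOn_chol hM.smooth hM.posDef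
  exact (((a3.mul (hM.smooth_accel 0)).sub (a2.mul (hM.smooth_accel 1))).div a6
    fun z hz => (chV_pos hM.posDef hz).ne').add (hM.smooth_conn 1 1 0)

lemma smooth_flux1 : ContDiffOn ℝ ∞ (flux1 S e h) S := by
  obtain ⟨a1, a2, a3, a4, a5, a6⟩ := contDiffOn_chol hM.smooth hM.posDef
  exact ((a1.mul (hM.smooth_accel 1)).div a6
    fun z hz => (chV_pos hM.posDef hz).ne').sub (hM.smooth_conn 0 1 0)

lemma leafMean_eq (hz : z ∈ S) : leafMean S e h z
    = (chR h z * conn S e h (cholC h) 0 2 0 z - chQ h z * conn S e h (cholC h) 0 2 1 z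
      + chP h z * conn S e h (cholC h) 1 2 1 z) / (chP h z * chR h z) := by
  have n1 := (chP_pos hM.posDef hz).ne'
  have n2 := (chR_pos hM.posDef hz).ne'
  simp [leafMean, Fin.sum_univ_two, cholC]
  field_simp
  ring

lemma smooth_leafMean : ContDiffOn ℝ ∞ (leafMean S e h) S :=
  ContDiffOn.sum fun _ _ => ContDiffOn.sum fun _ _ =>
    ((isFrame_chol hM.smooth hM.posDef).smooth_c _ _).mul (hM.smooth_conn _ _ _)

lemma conn_self (hz : z ∈ S) (k i : Fin 3) : conn S e h (cholC h) k i i z = 0 := by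
  have := hM.antisymm z hz k i i; linarith

/-- The structure equations, written out in the components of the Cholesky factor. -/
lemma structure_scalars (hz : z ∈ S) :
    let Ω := fun k i j => conn S e h (cholC h) k i j z
    pdv S e 1 (chP h) z = pdv S e 0 (chQ h) z + chR h z * Ω 0 1 0
    ∧ pdv S e 0 (chR h) z = chQ h z * Ω 0 1 0 - chP h z * Ω 1 1 0
    ∧ Ω 1 2 0 = (chQ h z * Ω 0 2 0 + chR h z * Ω 0 2 1) / chP h z
    ∧ pdv S e 2 (chP h) z = pdv S e 0 (chS h) z + chU h z * Ω 0 1 0 + chV h z * Ω 0 2 0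
    ∧ pdv S e 0 (chU h) z = chS h z * Ω 0 1 0 - chV h z * Ω 0 2 1 - chP h z * Ω 2 1 0
    ∧ pdv S e 0 (chV h) z = chS h z * Ω 0 2 0 + chU h z * Ω 0 2 1 - chP h z * Ω 2 2 0
    ∧ pdv S e 2 (chQ h) z
      = pdv S e 1 (chS h) z + chU h z * Ω 1 1 0 + chV h z * Ω 1 2 0 - chR h z * Ω 2 1 0
    ∧ pdv S e 2 (chR h) z
      = pdv S e 1 (chU h) z - chS h z * Ω 1 1 0 + chV h z * Ω 1 2 1 + chQ h z * Ω 2 1 0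
    ∧ pdv S e 1 (chV h) z
      = chS h z * Ω 1 2 0 + chU h z * Ω 1 2 1 - chQ h z * Ω 2 2 0 - chR h z * Ω 2 2 1 := by
  intro Ω
  have cf : ∀ (k i : Fin 3) (f : V → ℝ),
      (∀ y ∈ S, ![![chP h y, 0, 0], ![chQ h y, chR h y, 0], ![chS h y, chU h y, chV h y]] k i
        = f y) → coframe h (cholC h) k i z = f z ∧
      ∀ j, pdv S e j (coframe h (cholC h) k i) z = pdv S e j f z := by
    intro k i f hf
    have : EqOn (coframe h (cholC h) k i) f S := fun y hy =>
      (coframe_chol hM.posDef hy k i).trans (hf y hy)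
    exact ⟨this hz, fun j => pdv_congr hz this⟩
  have c00 := cf 0 0 (chP h) (fun y _ => rfl)
  have c01 := cf 0 1 (fun _ => 0) (fun y _ => rfl)
  have c02 := cf 0 2 (fun _ => 0) (fun y _ => rfl)
  have c10 := cf 1 0 (chQ h) (fun y _ => rfl)
  have c11 := cf 1 1 (chR h) (fun y _ => rfl)
  have c12 := cf 1 2 (fun _ => 0) (fun y _ => rfl)
  have c20 := cf 2 0 (chS h) (fun y _ => rfl)
  have c21 := cf 2 1 (chU h) (fun y _ => rfl)
  have c22 := cf 2 2 (chV h) (fun y _ => rfl)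
  have z0 : ∀ k : Fin 3, pdv S e k (fun _ => (0 : ℝ)) z = 0 := fun k => by simp [pdv]
  have as01 : ∀ k, Ω k 0 1 = -Ω k 1 0 := fun k => hM.antisymm z hz k 0 1
  have as02 : ∀ k, Ω k 0 2 = -Ω k 2 0 := fun k => hM.antisymm z hz k 0 2
  have as12 : ∀ k, Ω k 1 2 = -Ω k 2 1 := fun k => hM.antisymm z hz k 1 2
  have asd : ∀ k i, Ω k i i = 0 := fun k i => hM.conn_self hz k i
  have key : ∀ k l i, pdv S e k (coframe h (cholC h) l i) z
      + (coframe h (cholC h) l 0 z * Ω k 0 i + coframe h (cholC h) l 1 z * Ω k 1 i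
        + coframe h (cholC h) l 2 z * Ω k 2 i)
    = pdv S e l (coframe h (cholC h) k i) z
      + (coframe h (cholC h) k 0 z * Ω l 0 i + coframe h (cholC h) k 1 z * Ω l 1 i
        + coframe h (cholC h) k 2 z * Ω l 2 i) := by
    intro k l i
    have := hM.structure_eq z hz k l i
    simpa only [Fin.sum_univ_three] using this
  have hP := (chP_pos hM.posDef hz).ne'
  have k1 := key 0 1 0
  have k2 := key 0 1 1
  have k3 := key 0 1 2
  have k4 := key 0 2 0
  have k5 := key 0 2 1
  have k6 := key 0 2 2
  have k7 := key 1 2 0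
  have k8 := key 1 2 1
  have k9 := key 1 2 2
  simp only [c00, c01, c02, c10, c11, c12, c20, c21, c22, z0, as01, as02, as12, asd]
    at k1 k2 k3 k4 k5 k6 k7 k8 k9
  refine ⟨by linarith, by linarith, ?_, by linarith, by linarith, by linarith, by linarith,
    by linarith, by linarith⟩
  field_simp
  linarith

lemma frameScalar_eq (hz : z ∈ S) :
    let Ω := fun k i j => conn S e h (cholC h) k i j
    let c := fun i k => cholC h i k z
    frameScalar S e h z = 2 * (c 0 0 * c 1 1 * (pdv S e 0 (Ω 1 1 0) z - pdv S e 1 (Ω 0 1 0) z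
          - (Ω 1 2 1 z * Ω 0 2 0 z - Ω 0 2 1 z * Ω 1 2 0 z))
        + c 0 0 * (c 2 1 * (pdv S e 0 (Ω 1 2 0) z - pdv S e 1 (Ω 0 2 0) z
              + Ω 1 2 1 z * Ω 0 1 0 z - Ω 0 2 1 z * Ω 1 1 0 z)
          + c 2 2 * (pdv S e 0 (Ω 2 2 0) z - pdv S e 2 (Ω 0 2 0) z
              + Ω 2 2 1 z * Ω 0 1 0 z - Ω 0 2 1 z * Ω 2 1 0 z))
        + c 1 0 * (c 2 1 * (pdv S e 0 (Ω 1 2 1) z - pdv S e 1 (Ω 0 2 1) z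
              - (Ω 1 2 0 z * Ω 0 1 0 z - Ω 0 2 0 z * Ω 1 1 0 z))
          + c 2 2 * (pdv S e 0 (Ω 2 2 1) z - pdv S e 2 (Ω 0 2 1) z
              - (Ω 2 2 0 z * Ω 0 1 0 z - Ω 0 2 0 z * Ω 2 1 0 z)))
        + c 1 1 * (-c 2 0 * (pdv S e 0 (Ω 1 2 1) z - pdv S e 1 (Ω 0 2 1) z
              - (Ω 1 2 0 z * Ω 0 1 0 z - Ω 0 2 0 z * Ω 1 1 0 z))
          + c 2 2 * (pdv S e 1 (Ω 2 2 1) z - pdv S e 2 (Ω 1 2 1) z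
              - (Ω 2 2 0 z * Ω 1 1 0 z - Ω 1 2 0 z * Ω 2 1 0 z)))) := by
  intro Ω c
  have neg : ∀ k i j l, pdv S e l (Ω k i j) z = -pdv S e l (Ω k j i) z := by
    intro k i j l
    have h1 : EqOn (Ω k i j) (fun y => -Ω k j i y) S := fun y hy => hM.antisymm y hy k i j
    rw [pdv_congr hz h1]
    have h2 := (((hM.smooth_conn k j i z hz).differentiableWithinAt (by simp)).hasFDerivWithinAt
      ).neg.fderivWithin (hM.uniqueDiff z hz)
    exact congrArg (fun L : V →L[ℝ] ℝ => L (e l)) h2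
  have cs : ∀ k l i j, curvForm S e h (cholC h) k l i j z
      = pdv S e k (Ω l i j) z - pdv S e l (Ω k i j) z
    - ((Ω l i 0 z * Ω k j 0 z - Ω k i 0 z * Ω l j 0 z)
      + (Ω l i 1 z * Ω k j 1 z - Ω k i 1 z * Ω l j 1 z)
      + (Ω l i 2 z * Ω k j 2 z - Ω k i 2 z * Ω l j 2 z)) := by
    intro k l i j
    rw [curvForm, Fin.sum_univ_three]
  have as01 : ∀ k, Ω k 0 1 z = -Ω k 1 0 z := fun k => hM.antisymm z hz k 0 1
  have as02 : ∀ k, Ω k 0 2 z = -Ω k 2 0 z := fun k => hM.antisymm z hz k 0 2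
  have as12 : ∀ k, Ω k 1 2 z = -Ω k 2 1 z := fun k => hM.antisymm z hz k 1 2
  have asd : ∀ k i, Ω k i i z = 0 := fun k i => hM.conn_self hz k i
  have dsd : ∀ k i l, pdv S e l (Ω k i i) z = 0 := fun k i l => by
    have := neg k i i l; linarith
  have ds01 : ∀ k l, pdv S e l (Ω k 0 1) z = -pdv S e l (Ω k 1 0) z := fun k l => neg k 0 1 l
  have ds02 : ∀ k l, pdv S e l (Ω k 0 2) z = -pdv S e l (Ω k 2 0) z := fun k l => neg k 0 2 l
  have ds12 : ∀ k l, pdv S e l (Ω k 1 2) z = -pdv S e l (Ω k 2 1) z := fun k l => neg k 1 2 l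
  have u01 : c 0 1 = 0 := rfl
  have u02 : c 0 2 = 0 := rfl
  have u12 : c 1 2 = 0 := rfl
  change ∑ i, ∑ j, ∑ k, ∑ l, c i k * c j l * curvForm S e h (cholC h) k l j i z = _
  simp only [Fin.sum_univ_three, u01, u02, u12, cs, as01, as02, as12, asd, ds01, ds02, ds12, dsd]
  ring

/-- The divergence identity: if the mean curvature of the leaves is constant on each of them, the
divergence of the flux controls the derivative of the mean curvature. -/
lemma divergence_ge (hz : z ∈ S) (hH : ∀ k : Fin 3, k ≠ 2 → pdv S e k (leafMean S e h) z = 0)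
    (hR : 0 ≤ frameScalar S e h z) :
    chP h z * chR h z * (pdv S e 2 (leafMean S e h) z / chV h z)
      ≤ pdv S e 0 (flux0 S e h) z + pdv S e 1 (flux1 S e h) z := by
  obtain ⟨a1, a2, a3, a4, a5, a6⟩ := contDiffOn_chol hM.smooth hM.posDef
  have dd : ∀ {f : V → ℝ}, ContDiffOn ℝ ∞ f S → DifferentiableWithinAt ℝ f S z := fun hf =>
    (hf z hz).differentiableWithinAt (by simp)
  have n1 : ∀ z ∈ S, chP h z ≠ 0 := fun z hz => (chP_pos hM.posDef hz).ne'
  have n2 : ∀ z ∈ S, chR h z ≠ 0 := fun z hz => (chR_pos hM.posDef hz).ne'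
  have n3 : ∀ z ∈ S, chV h z ≠ 0 := fun z hz => (chV_pos hM.posDef hz).ne'
  have hu := hM.uniqueDiff z hz
  set Ω := conn S e h (cholC h) with hΩ
  have dP := dd a1
  have dQ := dd a2
  have dR := dd a3
  have dS := dd a4
  have dU := dd a5
  have dV := dd a6
  have dΩ : ∀ k i j, DifferentiableWithinAt ℝ (Ω k i j) S z := fun k i j => dd (hM.smooth_conn k i j)
  have dY : ∀ i, DifferentiableWithinAt ℝ (accel S e h i) S z := fun i => dd (hM.smooth_accel i)
  obtain ⟨t1, t2, t3, t4, t5, t6, t7, t8, t9⟩ := hM.structure_scalars hz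
  have hA : EqOn (fun y => chP h y * Ω 1 2 0 y)
      (fun y => chQ h y * Ω 0 2 0 y + chR h y * Ω 0 2 1 y) S := by
    intro y hy
    have := (hM.structure_scalars hy).2.2.1
    have := n1 y hy
    simp only [hΩ]
    field_simp at *
    linarith
  have hHe : EqOn (fun y => chP h y * chR h y * leafMean S e h y)
      (fun y => chR h y * Ω 0 2 0 y - chQ h y * Ω 0 2 1 y + chP h y * Ω 1 2 1 y) S := by
    intro y hy
    have h1 := n1 y hy
    have h2 := n2 y hy
    simp only [hM.leafMean_eq hy]
    field_simp
    rfl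
  have hY : ∀ i, EqOn (fun y => chP h y * chR h y * accel S e h i y)
      (fun y => chP h y * chR h y * Ω 2 2 i y - chS h y * chR h y * Ω 0 2 i y
        + chU h y * chQ h y * Ω 0 2 i y - chU h y * chP h y * Ω 1 2 i y) S := by
    intro i y hy
    have h1 := n1 y hy
    have h2 := n2 y hy
    simp only [accel, hΩ]
    field_simp
  have dH : DifferentiableWithinAt ℝ (leafMean S e h) S z := dd hM.smooth_leafMean
  have dY0 := dY 0
  have dY1 := dY 1
  have d020 := dΩ 0 2 0
  have d120 := dΩ 1 2 0
  have d021 := dΩ 0 2 1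
  have d121 := dΩ 1 2 1
  have d220 := dΩ 2 2 0
  have d221 := dΩ 2 2 1
  have d110 := dΩ 1 1 0
  have d010 := dΩ 0 1 0
  have eA := pdv_congr (k := 0) (e := e) hz hA
  have eH := fun k => pdv_congr (k := k) (e := e) hz hHe
  have eY0 := fun k => pdv_congr (k := k) (e := e) hz (hY 0)
  have eY1 := fun k => pdv_congr (k := k) (e := e) hz (hY 1)
  simp (disch := first | assumption | fun_prop) only [pdv_mul hu, pdv_add hu, pdv_sub hu]
    at eA eH eY0 eY1
  have eW0 : pdv S e 0 (flux0 S e h) z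
      = (pdv S e 0 (chR h) z * accel S e h 0 z + chR h z * pdv S e 0 (accel S e h 0) z
        - (pdv S e 0 (chQ h) z * accel S e h 1 z + chQ h z * pdv S e 0 (accel S e h 1) z)) / chV h z
        - (chR h z * accel S e h 0 z - chQ h z * accel S e h 1 z) * pdv S e 0 (chV h) z
          / chV h z ^ 2 + pdv S e 0 (Ω 1 1 0) z := by
    unfold flux0
    rw [pdv_add hu (differentiableWithinAt_div (by fun_prop) dV (n3 z hz)) d110,
      pdv_div hu (by fun_prop) dV (n3 z hz)]
    simp (disch := first | assumption | fun_prop) only [pdv_mul hu, pdv_sub hu]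
  have eW1 : pdv S e 1 (flux1 S e h) z
      = (pdv S e 1 (chP h) z * accel S e h 1 z + chP h z * pdv S e 1 (accel S e h 1) z) / chV h z
        - (chP h z * accel S e h 1 z) * pdv S e 1 (chV h) z
          / chV h z ^ 2 - pdv S e 1 (Ω 0 1 0) z := by
    unfold flux1
    rw [pdv_sub hu (differentiableWithinAt_div (by fun_prop) dV (n3 z hz)) d010,
      pdv_div hu (by fun_prop) dV (n3 z hz)]
    simp (disch := first | assumption | fun_prop) only [pdv_mul hu]
  have eH0 := eH 0
  have eH1 := eH 1
  have eH2 := eH 2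
  rw [hH 0 (by decide)] at eH0
  rw [hH 1 (by decide)] at eH1
  have hAz : Ω 1 2 0 z = (chQ h z * Ω 0 2 0 z + chR h z * Ω 0 2 1 z) / chP h z := t3
  -- `∇_{vN} N = -∇v` on the leaves, by the vanishing of the torsion
  have y0v : accel S e h 0 z = -pdv S e 0 (chV h) z / chP h z := by
    have := hY 0 hz
    have h1 := n1 z hz
    have h2 := n2 z hz
    rw [t6]
    simp only at this
    rw [hAz] at this
    field_simp at this ⊢
    apply mul_left_cancel₀ h2
    linear_combination this
  have y1v : accel S e h 1 z = (chQ h z * pdv S e 0 (chV h) z - chP h z * pdv S e 1 (chV h) z)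
      / (chP h z * chR h z) := by
    have := hY 1 hz
    have h1 := n1 z hz
    have h2 := n2 z hz
    rw [t6, t9, t3]
    simp only at this
    field_simp at this ⊢
    linear_combination this
  have main := divergence_algebra
    (p := chP h z) (q := chQ h z) (r := chR h z) (s := chS h z) (u := chU h z) (v := chV h z)
    (w0 := Ω 0 1 0 z) (a00 := Ω 0 2 0 z) (a01 := Ω 0 2 1 z) (w1 := Ω 1 1 0 z) (a10 := Ω 1 2 0 z)
    (a11 := Ω 1 2 1 z) (w2 := Ω 2 1 0 z) (a20 := Ω 2 2 0 z) (a21 := Ω 2 2 1 z)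
    (H := leafMean S e h z) (y0 := accel S e h 0 z) (y1 := accel S e h 1 z)
    (p0 := pdv S e 0 (chP h) z) (p1 := pdv S e 1 (chP h) z) (p2 := pdv S e 2 (chP h) z)
    (q0 := pdv S e 0 (chQ h) z) (q1 := pdv S e 1 (chQ h) z) (q2 := pdv S e 2 (chQ h) z)
    (r0 := pdv S e 0 (chR h) z) (r1 := pdv S e 1 (chR h) z) (r2 := pdv S e 2 (chR h) z)
    (s0 := pdv S e 0 (chS h) z) (s1 := pdv S e 1 (chS h) z) (u0 := pdv S e 0 (chU h) z)
    (u1 := pdv S e 1 (chU h) z) (v0 := pdv S e 0 (chV h) z) (v1 := pdv S e 1 (chV h) z)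
    (a00_0 := pdv S e 0 (Ω 0 2 0) z) (a00_1 := pdv S e 1 (Ω 0 2 0) z)
    (a00_2 := pdv S e 2 (Ω 0 2 0) z) (a01_0 := pdv S e 0 (Ω 0 2 1) z)
    (a01_1 := pdv S e 1 (Ω 0 2 1) z) (a01_2 := pdv S e 2 (Ω 0 2 1) z)
    (a10_0 := pdv S e 0 (Ω 1 2 0) z)
    (a11_0 := pdv S e 0 (Ω 1 2 1) z) (a11_1 := pdv S e 1 (Ω 1 2 1) z)
    (a11_2 := pdv S e 2 (Ω 1 2 1) z) (a20_0 := pdv S e 0 (Ω 2 2 0) z)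
    (a21_0 := pdv S e 0 (Ω 2 2 1) z)
    (a21_1 := pdv S e 1 (Ω 2 2 1) z) (H2 := pdv S e 2 (leafMean S e h) z)
    (y0_0 := pdv S e 0 (accel S e h 0) z) (y1_0 := pdv S e 0 (accel S e h 1) z)
    (y1_1 := pdv S e 1 (accel S e h 1) z) (w01 := pdv S e 1 (Ω 0 1 0) z)
    (w10 := pdv S e 0 (Ω 1 1 0) z) (c00 := cholC h 0 0 z) (c10 := cholC h 1 0 z)
    (c11 := cholC h 1 1 z) (c20 := cholC h 2 0 z) (c21 := cholC h 2 1 z) (c22 := cholC h 2 2 z)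
    (n1 z hz) (n2 z hz) (n3 z hz) rfl rfl rfl rfl rfl rfl
    t1 t2 t3 t4 t5 t6 t7 t8 t9 (hM.leafMean_eq hz)
    (by linear_combination eH0) (by linear_combination eH1) (by linear_combination eH2)
    (by linear_combination eA) y0v y1v (by linear_combination eY0 0)
    (by linear_combination eY1 0) (by linear_combination eY1 1)
  have hsc := hM.frameScalar_eq hz
  have hpr : 0 < chP h z * chR h z := mul_pos (chP_pos hM.posDef hz) (chR_pos hM.posDef hz)
  rw [eW0, eW1]
  simp only at hsc
  have hbr : pdv S e 2 (leafMean S e h) z / chV h z ≤ pdv S e 2 (leafMean S e h) z / chV h z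
      + frameScalar S e h z / 2
      + (1 / 2) * (leafMean S e h z ^ 2 + (Ω 0 2 0 z ^ 2 / chP h z ^ 2
        + 2 * (Ω 0 2 1 z / chP h z) ^ 2
        + ((Ω 1 2 1 z - chQ h z * Ω 0 2 1 z / chP h z) / chR h z) ^ 2))
      + (accel S e h 0 z ^ 2 + accel S e h 1 z ^ 2) / chV h z ^ 2 := by
    have : 0 ≤ frameScalar S e h z / 2
      + (1 / 2) * (leafMean S e h z ^ 2 + (Ω 0 2 0 z ^ 2 / chP h z ^ 2
        + 2 * (Ω 0 2 1 z / chP h z) ^ 2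
        + ((Ω 1 2 1 z - chQ h z * Ω 0 2 1 z / chP h z) / chR h z) ^ 2))
      + (accel S e h 0 z ^ 2 + accel S e h 1 z ^ 2) / chV h z ^ 2 := by positivity
    linarith
  refine (mul_le_mul_of_nonneg_left hbr hpr.le).trans (le_of_eq ?_)
  rw [hsc]
  linear_combination -main

end IsMovingFrame

end Divergence

/-! ### The moving frame of a family of surfaces in a manifold -/

section Transfer

variable {V : Type*} [NormedAddCommGroup V] [NormedSpace ℝ V] {n : ℕ} {S O : Set V}
  {e : Fin n → V} {h c : Fin n → Fin n → V → ℝ} {z : V}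

lemma pdv_inter (hO : IsOpen O) (hz : z ∈ O) (k : Fin n) (f : V → ℝ) :
    pdv (S ∩ O) e k f z = pdv S e k f z := by
  simp only [pdv, fderivWithin_inter (hO.mem_nhds hz)]

lemma conn_inter (hO : IsOpen O) (hz : z ∈ O) (k i j : Fin n) :
    conn (S ∩ O) e h c k i j z = conn S e h c k i j z := by
  simp only [conn, firstKind, pdv_inter hO hz]

lemma curvForm_inter (hO : IsOpen O) (hz : z ∈ S ∩ O) (k l i j : Fin n) :
    curvForm (S ∩ O) e h c k l i j z = curvForm S e h c k l i j z := by
  have h1 : ∀ k i j k', pdv (S ∩ O) e k' (conn (S ∩ O) e h c k i j) z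
      = pdv S e k' (conn S e h c k i j) z := fun k i j k' => by
    have h2 : EqOn (conn (S ∩ O) e h c k i j) (conn S e h c k i j) (S ∩ O) := fun y hy =>
      conn_inter hO hy.2 k i j
    rw [pdv_congr hz h2, pdv_inter hO hz.2]
  simp only [curvForm, h1, conn_inter hO hz.2]

end Transfer

section Pullback

variable {M : Type*} [TopologicalSpace M] [ChartedSpace (EuclideanHalfSpace 3) M]
  [IsManifold (𝓡∂ 3) ∞ M] {V : Type*} [NormedAddCommGroup V] [NormedSpace ℝ V]

/-- The components of the metric pulled back by `f`, in the directions `e`. -/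
def pullMetric {n : ℕ} (g : Metric3 M) (S : Set V) (e : Fin n → V) (f : V → M) (k l : Fin n)
    (z : V) : ℝ := met g (f z) (dm S f z (e k)) (dm S f z (e l))

variable {g : Metric3 M} {S : Set V} {e : Fin 3 → V} {f : V → M} {z₀ : V}

/-- Near every point, a map into the manifold is a pullback in the sense of coordinates. -/
lemma exists_isPullback (hS : UniqueDiffOn ℝ S) (hd : S ⊆ closure (interior S))
    (hf : ContMDiffOn 𝓘(ℝ, V) (𝓡∂ 3) ∞ f S) (p : M) (hz : z₀ ∈ S)
    (hp : f z₀ ∈ (extChartAt (𝓡∂ 3) p).source) {c : Fin 3 → Fin 3 → V → ℝ}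
    (hF : IsFrame S (pullMetric g S e f) c) :
    ∃ O, IsOpen O ∧ z₀ ∈ O ∧ MapsTo f (S ∩ O) (extChartAt (𝓡∂ 3) p).source ∧
      IsPullback (range (𝓡∂ 3)) (extChartAt (𝓡∂ 3) p).target (chartG g p) (S ∩ O) e
        (fun z => extChartAt (𝓡∂ 3) p (f z)) (pullMetric g S e f) c := by
  have hc := hf.continuousOn z₀ hz
  have hn := hc (extChartAt_source_mem_nhds' hp)
  obtain ⟨O, hO, hzO, hsub⟩ := mem_nhdsWithin.1 hn
  have hms : MapsTo f (S ∩ O) (extChartAt (𝓡∂ 3) p).source := fun z hz => hsub ⟨hz.2, hz.1⟩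
  have hu := hS.inter hO
  refine ⟨O, hO, hzO, hms, ?_⟩
  refine
    { smooth_h := fun k l => (hF.smooth_h k l).mono inter_subset_left
      smooth_c := fun i k => (hF.smooth_c i k).mono inter_subset_left
      orthonormal := fun z hz => hF.orthonormal z hz.1
      metric := isRiemannOn_chartG g p
      uniqueDiff := hu
      dense_interior := ?_
      smooth := contMDiffOn_chart_comp p (hf.mono inter_subset_left) hms
      mapsTo := fun z hz => (extChartAt (𝓡∂ 3) p).map_source (hms hz)
      pullback := ?_ }
  · rintro z ⟨h1, h2⟩
    rw [interior_inter, hO.interior_eq, inter_comm]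
    exact hO.inter_closure ⟨h2, hd h1⟩
  · intro z hz k l
    have hfz : MDifferentiableWithinAt 𝓘(ℝ, V) (𝓡∂ 3) f (S ∩ O) z :=
      ((hf z hz.1).mono inter_subset_left).mdifferentiableWithinAt (by simp)
    rw [chartG_along g p (hu z hz) hfz (hms hz)]
    have e1 : dm (S ∩ O) f z = dm S f z := mfderivWithin_inter (hO.mem_nhds hz.2)
    rw [e1]; rfl

lemma smooth_pullMetric (hS : UniqueDiffOn ℝ S) (hf : ContMDiffOn 𝓘(ℝ, V) (𝓡∂ 3) ∞ f S)
    (k l : Fin 3) : ContDiffOn ℝ ∞ (pullMetric g S e f k l) S :=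
  contDiffOn_pullback g hS hf (e k) (e l)

lemma isMovingFrame_pullMetric (hS : UniqueDiffOn ℝ S) (hd : S ⊆ closure (interior S))
    (hf : ContMDiffOn 𝓘(ℝ, V) (𝓡∂ 3) ∞ f S) (hp : IsPosDefOn S (pullMetric g S e f)) :
    IsMovingFrame S e (pullMetric g S e f) := by
  have hF := isFrame_chol (smooth_pullMetric (g := g) (e := e) hS hf) hp
  refine ⟨hS, smooth_pullMetric hS hf, hp, fun z hz k i j => ?_, fun z hz k l i => ?_⟩
  · obtain ⟨O, hO, hzO, -, hP⟩ := exists_isPullback hS hd hf (f z) hz (mem_extChartAt_source _) hF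
    have := hP.conn_antisymm ⟨hz, hzO⟩ k i j
    rwa [conn_inter hO hzO, conn_inter hO hzO] at this
  · obtain ⟨O, hO, hzO, -, hP⟩ := exists_isPullback hS hd hf (f z) hz (mem_extChartAt_source _) hF
    have := hP.structure_eq ⟨hz, hzO⟩ k l i
    simpa only [conn_inter hO hzO, pdv_inter hO hzO] using this

lemma frameScalar_pullMetric (hS : UniqueDiffOn ℝ S) (hd : S ⊆ closure (interior S))
    (hf : ContMDiffOn 𝓘(ℝ, V) (𝓡∂ 3) ∞ f S) (hp : IsPosDefOn S (pullMetric g S e f))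
    (hz : z₀ ∈ S) : frameScalar S e (pullMetric g S e f) z₀ = scalarCurvature g (f z₀) := by
  have hF := isFrame_chol (smooth_pullMetric (g := g) (e := e) hS hf) hp
  obtain ⟨O, hO, hzO, -, hP⟩ := exists_isPullback hS hd hf (f z₀) hz (mem_extChartAt_source _) hF
  have := hP.scalarCoord_eq ⟨hz, hzO⟩
  simp only [curvForm_inter hO ⟨hz, hzO⟩] at this
  exact this.symm

end Pullback


section Slab

variable {M : Type*} [TopologicalSpace M] [ChartedSpace (EuclideanHalfSpace 3) M]
  [IsManifold (𝓡∂ 3) ∞ M]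

/-- The parameter domain of the family of disks. -/
def slab (a b : ℝ) : Set (𝔼 2 × ℝ) := disk ×ˢ Ioo a b

/-- The coordinate directions of the parameter domain. -/
def slabDir : Fin 3 → 𝔼 2 × ℝ := ![(vec 0, 0), (vec 1, 0), (0, 1)]

lemma interior_disk_nonempty : (interior disk).Nonempty :=
  ⟨0, by rw [disk, interior_closedBall _ one_ne_zero]; simp⟩

lemma convex_disk : Convex ℝ disk := convex_closedBall 0 1

lemma uniqueDiffOn_disk : UniqueDiffOn ℝ disk :=
  uniqueDiffOn_convex convex_disk interior_disk_nonempty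

lemma uniqueDiffOn_slab (a b : ℝ) : UniqueDiffOn ℝ (slab a b) :=
  uniqueDiffOn_disk.prod isOpen_Ioo.uniqueDiffOn

lemma slab_subset_closure_interior (a b : ℝ) : slab a b ⊆ closure (interior (slab a b)) := by
  rw [slab, interior_prod_eq, closure_prod_eq, isOpen_Ioo.interior_eq]
  refine prod_mono ?_ subset_closure
  rw [disk, interior_closedBall _ one_ne_zero, closure_ball _ one_ne_zero]

omit [IsManifold (𝓡∂ 3) ∞ M] in
/-- The differential of a leaf is the restriction of the differential of the family. -/
lemma surfDeriv_leaf {a b : ℝ} {ψ : 𝔼 2 × ℝ → M} {x : 𝔼 2} {t : ℝ}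
    (hψ : ContMDiffOn 𝓘(ℝ, 𝔼 2 × ℝ) (𝓡∂ 3) ∞ ψ (slab a b)) (hx : x ∈ disk) (ht : t ∈ Ioo a b)
    (ξ : 𝔼 2) : surfDeriv disk (leaf ψ t) x ξ = dm (slab a b) ψ (x, t) (ξ, 0) := by
  have h1 : HasFDerivWithinAt (fun x : 𝔼 2 => (x, t)) (ContinuousLinearMap.inl ℝ (𝔼 2) ℝ) disk x :=
    (hasFDerivAt_prodMk_left x t).hasFDerivWithinAt
  have h2 := mfderivWithin_comp (I := 𝓘(ℝ, 𝔼 2)) (I' := 𝓘(ℝ, 𝔼 2 × ℝ)) (I'' := 𝓡∂ 3) (s := disk)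
    (f := fun x : 𝔼 2 => (x, t)) (g := ψ) (u := slab a b) x
    ((hψ (x, t) ⟨hx, ht⟩).mdifferentiableWithinAt (by simp))
    h1.differentiableWithinAt.mdifferentiableWithinAt
    (fun y hy => ⟨hy, ht⟩) (uniqueDiffOn_disk x hx).uniqueMDiffWithinAt
  rw [mfderivWithin_eq_fderivWithin, h1.fderivWithin (uniqueDiffOn_disk x hx)] at h2
  exact congrArg (fun L : 𝔼 2 →L[ℝ] 𝔼 3 => L ξ) h2

lemma slabDir_castSucc (i : Fin 2) : slabDir i.castSucc = (vec i, 0) := by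
  fin_cases i <;> rfl

variable {g : Metric3 M} {X : ∀ p : M, TangentSpace (𝓡∂ 3) p} {tm tp : ℝ} {r : ℝ → ℝ}
  {j : M → 𝔼 3} {a b : ℝ} {ψ : 𝔼 2 × ℝ → M} {N : ∀ z, TangentSpace (𝓡∂ 3) (ψ z)} {H : ℝ → ℝ}

/-- The normal field of the family of disks, with the tangent spaces read as `𝔼 3`. -/
def normalVec (N : ∀ z, TangentSpace (𝓡∂ 3) (ψ z)) (z : 𝔼 2 × ℝ) : 𝔼 3 := N z

/-- The metric of the family of disks, in the parameters. -/
abbrev slabMetric (g : Metric3 M) (a b : ℝ) (ψ : 𝔼 2 × ℝ → M) : Fin 3 → Fin 3 → 𝔼 2 × ℝ → ℝ :=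
  pullMetric g (slab a b) slabDir ψ

namespace IsCMCCapillaryFoliation

variable (hψ : IsCMCCapillaryFoliation g X tm tp r j a b ψ N H) {z : 𝔼 2 × ℝ}
include hψ

lemma inner_leaf_normal (hz : z ∈ slab a b) (ξ : 𝔼 2) :
    met g (ψ z) (dm (slab a b) ψ z (ξ, 0)) (normalVec N z) = 0 := by
  rw [← surfDeriv_leaf hψ.smooth hz.1 hz.2]
  exact hψ.normal z.2 hz.2 z.1 hz.1 ξ

lemma posDef : IsPosDefOn (slab a b) (slabMetric g a b ψ) where
  symm z _ k l := met_symm g _ _ _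
  pos z hz x hx := by
    set w : 𝔼 3 := ∑ k, x k • dm (slab a b) ψ z (slabDir k) with hw
    have e1 : ∑ k, ∑ l, x k * x l * slabMetric g a b ψ k l z = met g (ψ z) w w := by
      rw [hw]
      simp only [map_sum, map_smul, _root_.sum_apply, _root_.smul_apply, smul_eq_mul,
        pullMetric, Finset.mul_sum]
      rw [Finset.sum_comm]
      exact Finset.sum_congr rfl fun a _ => Finset.sum_congr rfl fun b _ => by ring
    rw [e1]
    refine met_pos g _ fun h0 => hx ?_
    have e2 : w = dm (slab a b) ψ z (x 0 • vec 0 + x 1 • vec 1, 0)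
        + x 2 • dm (slab a b) ψ z (0, 1) := by
      simp only [hw, Fin.sum_univ_three, ← map_smul, ← map_add]
      congr 1
      simp [slabDir]
    have e3 : met g (ψ z) w (normalVec N z) = x 2 * speed g a b ψ N z := by
      rw [e2, map_add, map_smul, _root_.add_apply, _root_.smul_apply,
        hψ.inner_leaf_normal hz, zero_add]
      rfl
    have hs := hψ.speed_pos z.2 hz.2 z.1 hz.1
    rw [h0, map_zero, _root_.zero_apply] at e3
    have x2 : x 2 = 0 := (mul_eq_zero.1 e3.symm).resolve_right hs.ne'
    have e4 : x 0 • vec 0 + x 1 • vec 1 = (0 : 𝔼 2) := by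
      apply hψ.immersion z.2 hz.2 z.1 hz.1
      rw [surfDeriv_leaf hψ.smooth hz.1 hz.2, surfDeriv_leaf hψ.smooth hz.1 hz.2]
      rw [x2, zero_smul, add_zero, h0] at e2
      rw [← e2, show ((0 : 𝔼 2), (0 : ℝ)) = 0 from rfl, map_zero]
    funext k
    have k0 := congrArg (fun y : 𝔼 2 => y 0) e4
    have k1 := congrArg (fun y : 𝔼 2 => y 1) e4
    simp [vec] at k0 k1
    fin_cases k
    · exact k0
    · exact k1
    · exact x2

lemma isMovingFrame : IsMovingFrame (slab a b) slabDir (slabMetric g a b ψ) :=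
  isMovingFrame_pullMetric (uniqueDiffOn_slab a b) (slab_subset_closure_interior a b) hψ.smooth
    hψ.posDef

lemma frameScalar_nonneg (hR : ∀ p : M, 0 ≤ scalarCurvature g p) (hz : z ∈ slab a b) :
    0 ≤ frameScalar (slab a b) slabDir (slabMetric g a b ψ) z := by
  rw [frameScalar_pullMetric (uniqueDiffOn_slab a b) (slab_subset_closure_interior a b) hψ.smooth
    hψ.posDef hz]
  exact hR _

/-- The frame `E i` of the family of disks. -/
def _root_.Capillary.slabFrame (g : Metric3 M) (a b : ℝ) (ψ : 𝔼 2 × ℝ → M) (i : Fin 3)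
    (z : 𝔼 2 × ℝ) : 𝔼 3 :=
  ∑ k, cholC (slabMetric g a b ψ) i k z • dm (slab a b) ψ z (slabDir k)

omit hψ in
lemma inner_dm_slabFrame (k i : Fin 3) :
    met g (ψ z) (dm (slab a b) ψ z (slabDir k)) (slabFrame g a b ψ i z)
      = coframe (slabMetric g a b ψ) (cholC (slabMetric g a b ψ)) k i z := by
  simp only [slabFrame, map_sum, map_smul, smul_eq_mul, coframe, pullMetric]

lemma inner_slabFrame (hz : z ∈ slab a b) (i k : Fin 3) :
    met g (ψ z) (slabFrame g a b ψ i z) (slabFrame g a b ψ k z) = if i = k then 1 else 0 := by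
  rw [← (isFrame_chol hψ.isMovingFrame.smooth hψ.posDef).orthonormal z hz i k]
  simp only [slabFrame, map_sum, map_smul, _root_.sum_apply, _root_.smul_apply, smul_eq_mul,
    Finset.mul_sum, pullMetric]
  rw [Finset.sum_comm]
  exact Finset.sum_congr rfl fun a _ => Finset.sum_congr rfl fun b _ => by ring

/-- The unit normal is the third vector of the frame, and the speed the last entry of the Cholesky
factor. -/
lemma normal_eq (hz : z ∈ slab a b) :
    normalVec N z = slabFrame g a b ψ 2 z ∧ speed g a b ψ N z = chV (slabMetric g a b ψ) z := by
  set E := fun i => slabFrame g a b ψ i z with hE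
  have h0 : ∀ ξ, met g (ψ z) (normalVec N z) (dm (slab a b) ψ z (ξ, 0)) = 0 := fun ξ => by
    rw [met_symm]; exact hψ.inner_leaf_normal hz ξ
  have hN0 : met g (ψ z) (normalVec N z) (E 0) = 0 := by
    simp only [hE, slabFrame, Fin.sum_univ_three]
    simp [slabDir, cholC, h0]
  have hN1 : met g (ψ z) (normalVec N z) (E 1) = 0 := by
    simp only [hE, slabFrame, Fin.sum_univ_three]
    simp [slabDir, cholC, h0]
  have hexp := orthonormal_expand (met g (ψ z)) E (hψ.inner_slabFrame hz) (normalVec N z)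
  rw [Fin.sum_univ_three, hN0, hN1, zero_smul, zero_smul, zero_add, zero_add] at hexp
  set α := met g (ψ z) (normalVec N z) (E 2) with hα
  have hV := chV_pos hψ.posDef hz
  have hsp : speed g a b ψ N z = α * chV (slabMetric g a b ψ) z := by
    have h1 := inner_dm_slabFrame (g := g) (a := a) (b := b) (ψ := ψ) (z := z) 2 2
    rw [coframe_chol hψ.posDef hz] at h1
    have h2 : speed g a b ψ N z = met g (ψ z) (dm (slab a b) ψ z (slabDir 2)) (normalVec N z) := rfl
    rw [h2, ← hexp, map_smul, smul_eq_mul, hE, h1]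
    rfl
  have hpos := hψ.speed_pos z.2 hz.2 z.1 hz.1
  have hα0 : 0 < α := by
    change 0 < speed g a b ψ N z at hpos
    rw [hsp] at hpos
    exact pos_of_mul_pos_left hpos hV.le
  have hu : met g (ψ z) (normalVec N z) (normalVec N z) = 1 := hψ.unit z.2 hz.2 z.1 hz.1
  have hα1 : α = 1 := by
    rw [← hexp, map_smul, map_smul, _root_.smul_apply, smul_eq_mul, smul_eq_mul,
      hψ.inner_slabFrame hz, if_pos rfl] at hu
    nlinarith
  exact ⟨by rw [← hexp, hα1, one_smul], by rw [hsp, hα1, one_mul]⟩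

end IsCMCCapillaryFoliation

end Slab

/-! ### The mean curvature of the leaves -/

section MeanCurvature

/-- The mean curvature as a sum over an orthonormal basis of the tangent plane. -/
lemma meanCurvCoord_eq_sum {n : ℕ} (R : Set (𝔼 n)) (G : 𝔼 n → 𝔼 n →L[ℝ] 𝔼 n →L[ℝ] ℝ)
    (U : Set (𝔼 2)) (F : 𝔼 2 → 𝔼 n) (x : 𝔼 2) (N : 𝔼 n) (E : Fin 2 → Fin 2 → ℝ)
    (hE : ∀ i j, ∑ a, ∑ b, E i a * firstFormCoord (unc G) U F x a b * E j b
      = if i = j then 1 else 0) :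
    meanCurvCoord R (unc G) U F x N
      = -∑ i, ∑ a, ∑ b, E i a * E i b * G (F x) (covD R G U F (pd U b F) x (vec a)) N := by
  have h1 : ∀ a b, covDerivCoord R (unc G) U F a b x = covD R G U F (pd U b F) x (vec a) := by
    intro a b
    rw [covDerivCoord, covD, Gam_apply]
    rfl
  simp only [meanCurvCoord, h1]
  congr 1
  have h2 : ∀ i a b, E i a * E i b * G (F x) (covD R G U F (pd U b F) x (vec a)) N
      = E i a * E i b * unc G (F x) (covD R G U F (pd U b F) x (vec a)) N := fun _ _ _ => rfl
  simp only [h2, inv_eq_sum_of_orthonormal _ E hE]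
  simp only [Fin.sum_univ_two]
  ring

variable {E : Type*} [NormedAddCommGroup E] [NormedSpace ℝ E] {a b : ℝ} {O : Set (𝔼 2 × ℝ)}
  {x : 𝔼 2} {t : ℝ}

lemma fderivWithin_slice (hO : IsOpen O) {f : 𝔼 2 × ℝ → E} (hz : (x, t) ∈ slab a b ∩ O)
    (hf : DifferentiableWithinAt ℝ f (slab a b ∩ O) (x, t)) (ξ : 𝔼 2) :
    fderivWithin ℝ (fun y => f (y, t)) disk x ξ = fderivWithin ℝ f (slab a b ∩ O) (x, t) (ξ, 0) := by
  have h1 : HasFDerivWithinAt (fun x : 𝔼 2 => (x, t)) (ContinuousLinearMap.inl ℝ (𝔼 2) ℝ)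
      (disk ∩ (fun y => (y, t)) ⁻¹' O) x := (hasFDerivAt_prodMk_left x t).hasFDerivWithinAt
  have hO' : IsOpen ((fun y : 𝔼 2 => (y, t)) ⁻¹' O) := hO.preimage (by fun_prop)
  have hm : MapsTo (fun x : 𝔼 2 => (x, t)) (disk ∩ (fun y => (y, t)) ⁻¹' O) (slab a b ∩ O) :=
    fun y hy => ⟨⟨hy.1, hz.1.2⟩, hy.2⟩
  have h2 := hf.hasFDerivWithinAt.comp x h1 hm
  rw [← fderivWithin_inter (hO'.mem_nhds hz.2)]
  have h3 := h2.fderivWithin ((uniqueDiffOn_disk.inter hO') x ⟨hz.1.1, hz.2⟩)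
  exact congrArg (fun L : 𝔼 2 →L[ℝ] E => L ξ) h3

variable {n : ℕ} {R T : Set (𝔼 3)} {G : 𝔼 3 → 𝔼 3 →L[ℝ] 𝔼 3 →L[ℝ] ℝ} {φ : 𝔼 2 × ℝ → 𝔼 3}
  {h : Fin 3 → Fin 3 → 𝔼 2 × ℝ → ℝ}

lemma meanCurvCoord_leaf (hO : IsOpen O) (hp : IsPosDefOn (slab a b) h)
    (hP : IsPullback R T G (slab a b ∩ O) slabDir φ h (cholC h)) (hz : (x, t) ∈ slab a b ∩ O) :
    meanCurvCoord R (unc G) disk (fun y => φ (y, t)) x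
      (frameAlong (slab a b ∩ O) slabDir φ (cholC h) 2 (x, t))
      = leafMean (slab a b) slabDir h (x, t) := by
  have hO' : IsOpen ((fun y : 𝔼 2 => (y, t)) ⁻¹' O) := hO.preimage (by fun_prop)
  have hd : ∀ z ∈ slab a b ∩ O, DifferentiableWithinAt ℝ φ (slab a b ∩ O) z := fun z hz =>
    (hP.smooth z hz).differentiableWithinAt (by simp)
  have e1 : ∀ y ∈ disk ∩ (fun y : 𝔼 2 => (y, t)) ⁻¹' O, ∀ k : Fin 2,
      pd disk k (fun y => φ (y, t)) y
        = fderivWithin ℝ φ (slab a b ∩ O) (y, t) (slabDir k.castSucc) := fun y hy k => by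
    rw [pd, fderivWithin_slice hO ⟨⟨hy.1, hz.1.2⟩, hy.2⟩ (hd _ ⟨⟨hy.1, hz.1.2⟩, hy.2⟩),
      slabDir_castSucc]
  have hx : x ∈ disk ∩ (fun y : 𝔼 2 => (y, t)) ⁻¹' O := ⟨hz.1.1, hz.2⟩
  have e2 : ∀ k l : Fin 2, covD R G disk (fun y => φ (y, t)) (pd disk l (fun y => φ (y, t))) x (vec k)
      = covD R G (slab a b ∩ O) φ
        (fun z => fderivWithin ℝ φ (slab a b ∩ O) z (slabDir l.castSucc)) (x, t)
        (slabDir k.castSucc) := by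
    intro k l
    have h1 : pd disk l (fun y => φ (y, t)) =ᶠ[𝓝[disk] x]
        fun y => fderivWithin ℝ φ (slab a b ∩ O) (y, t) (slabDir l.castSucc) := by
      filter_upwards [self_mem_nhdsWithin, mem_nhdsWithin_of_mem_nhds (hO'.mem_nhds hx.2)]
        with y h1 h2 using e1 y ⟨h1, h2⟩ l
    have h2 : fderivWithin ℝ (fun y => φ (y, t)) disk x (vec k)
        = fderivWithin ℝ φ (slab a b ∩ O) (x, t) (slabDir k.castSucc) := e1 x hx k
    rw [covD_congr h1 hx.1, covD, covD, h2, fderivWithin_slice hO hz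
      (((hP.contDiffOn_dφ (slabDir l.castSucc)) (x, t) hz).differentiableWithinAt (by simp)),
      ← slabDir_castSucc]
  have hf : ∀ k l : Fin 2, firstFormCoord (unc G) disk (fun y => φ (y, t)) x k l
      = h k.castSucc l.castSucc (x, t) := fun k l => by
    rw [← hP.pullback _ hz, ← e1 x hx, ← e1 x hx]; rfl
  have hor := hP.orthonormal (x, t) hz
  have hc2 : ∀ i : Fin 2, cholC h i.castSucc 2 (x, t) = 0 := fun i => by fin_cases i <;> rfl
  rw [meanCurvCoord_eq_sum R G disk _ x _ (fun i k => cholC h i.castSucc k.castSucc (x, t))]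
  · have hco := fun k i => coframe_chol hp hz.1 k i
    have key : ∀ k l : Fin 2, G (φ (x, t)) (covD R G (slab a b ∩ O) φ
        (fun z => fderivWithin ℝ φ (slab a b ∩ O) z (slabDir l.castSucc)) (x, t)
        (slabDir k.castSucc)) (frameAlong (slab a b ∩ O) slabDir φ (cholC h) 2 (x, t))
        = -∑ j : Fin 3, coframe h (cholC h) l.castSucc j (x, t)
          * conn (slab a b) slabDir h (cholC h) k.castSucc 2 j (x, t) := by
      intro k l
      have h1 := fderivWithin_inner_along hP.metric hP.uniqueDiff hP.smooth hP.mapsTo hz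
        ((hP.contDiffOn_dφ (slabDir l.castSucc) _ hz).differentiableWithinAt (by simp))
        ((hP.contDiffOn_frame 2 _ hz).differentiableWithinAt (by simp)) (slabDir k.castSucc)
      have h2 : EqOn (fun z => G (φ z) (fderivWithin ℝ φ (slab a b ∩ O) z (slabDir l.castSucc))
          (frameAlong (slab a b ∩ O) slabDir φ (cholC h) 2 z)) (fun _ => 0) (slab a b ∩ O) := by
        intro y hy
        simp only [hP.inner_coframe hy, coframe_chol hp hy.1]
        fin_cases l <;> rfl
      rw [fderivWithin_congr h2 (h2 hz), fderivWithin_const_apply, _root_.zero_apply] at h1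
      have h3 := orthonormal_inner (G (φ (x, t))) _ (hP.inner_frame hz)
        (fderivWithin ℝ φ (slab a b ∩ O) (x, t) (slabDir l.castSucc))
        (covD R G (slab a b ∩ O) φ (frameAlong (slab a b ∩ O) slabDir φ (cholC h) 2) (x, t)
          (slabDir k.castSucc))
      simp only [hP.inner_coframe hz, hP.inner_conn hz, conn_inter hO hz.2] at h3
      linarith
    simp only [e2, key]
    simp only [leafMean, Fin.sum_univ_two, Fin.sum_univ_three, hco]
    have hP0 := (chP_pos hp hz.1).ne'
    have hR0 := (chR_pos hp hz.1).ne'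
    simp [cholC]
    field_simp
    ring
  · intro i j
    have := hor i.castSucc j.castSucc
    simp only [Fin.sum_univ_castSucc (n := 2), show Fin.last 2 = 2 from rfl, hc2, zero_mul,
      mul_zero, add_zero, Finset.sum_const_zero] at this
    simp only [hf, Fin.castSucc_inj] at this ⊢
    rw [← this]
    exact Finset.sum_congr rfl fun _ _ => Finset.sum_congr rfl fun _ _ => by ring

end MeanCurvature

section Leaves

variable {M : Type*} [TopologicalSpace M] [ChartedSpace (EuclideanHalfSpace 3) M]
  [IsManifold (𝓡∂ 3) ∞ M]
  {g : Metric3 M} {X : ∀ p : M, TangentSpace (𝓡∂ 3) p} {tm tp : ℝ} {r : ℝ → ℝ}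
  {j : M → 𝔼 3} {a b : ℝ} {ψ : 𝔼 2 × ℝ → M} {N : ∀ z, TangentSpace (𝓡∂ 3) (ψ z)} {H : ℝ → ℝ}

namespace IsCMCCapillaryFoliation

variable (hψ : IsCMCCapillaryFoliation g X tm tp r j a b ψ N H) {z : 𝔼 2 × ℝ}
include hψ

lemma leafMean_eq (hz : z ∈ slab a b) :
    leafMean (slab a b) slabDir (slabMetric g a b ψ) z = H z.2 := by
  obtain ⟨x, t⟩ := z
  have hF := isFrame_chol hψ.isMovingFrame.smooth hψ.posDef
  obtain ⟨O, hO, hzO, hs, hP⟩ := exists_isPullback (uniqueDiffOn_slab a b)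
    (slab_subset_closure_interior a b) hψ.smooth (ψ (x, t)) hz (mem_extChartAt_source _) hF
  rw [← hψ.cmc t hz.2 x hz.1, ← meanCurvCoord_leaf hO hψ.posDef hP ⟨hz, hzO⟩]
  have hdm : ∀ ξ, fderivWithin ℝ (fun z => extChartAt (𝓡∂ 3) (ψ (x, t)) (ψ z)) (slab a b ∩ O) (x, t) ξ
      = dm (slab a b) ψ (x, t) ξ := fun ξ => by
    rw [fderivWithin_inter (hO.mem_nhds hzO)]
    exact fderivWithin_chart_self (uniqueDiffOn_slab a b _ hz)
      ((hψ.smooth _ hz).mdifferentiableWithinAt (by simp)) ξ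
  have hN : frameAlong (slab a b ∩ O) slabDir (fun z => extChartAt (𝓡∂ 3) (ψ (x, t)) (ψ z))
      (cholC (slabMetric g a b ψ)) 2 (x, t) = coords (ψ (x, t)) (normalVec N (x, t)) := by
    rw [coords_eq, (hψ.normal_eq hz).1]
    simp only [frameAlong, hdm, slabFrame]
  rw [hN]
  rfl

lemma H_eq {t : ℝ} (ht : t ∈ Ioo a b) :
    H t = leafMean (slab a b) slabDir (slabMetric g a b ψ) (0, t) :=
  (hψ.leafMean_eq (z := (0, t)) ⟨by simp [disk], ht⟩).symm

lemma contDiffOn_H : ContDiffOn ℝ ∞ H (Ioo a b) := by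
  have h1 : ContDiffOn ℝ ∞ (fun t : ℝ => leafMean (slab a b) slabDir (slabMetric g a b ψ) (0, t))
      (Ioo a b) :=
    hψ.isMovingFrame.smooth_leafMean.comp (by fun_prop) fun t ht => ⟨by simp [disk], ht⟩
  exact h1.congr fun t ht => hψ.H_eq ht

lemma hasFDerivWithinAt_leafMean (hz : z ∈ slab a b) :
    HasFDerivWithinAt (leafMean (slab a b) slabDir (slabMetric g a b ψ))
      ((deriv H z.2) • ContinuousLinearMap.snd ℝ (𝔼 2) ℝ) (slab a b) z := by
  have h1 : HasDerivAt H (deriv H z.2) z.2 :=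
    ((hψ.contDiffOn_H.contDiffAt (isOpen_Ioo.mem_nhds hz.2)).differentiableAt (by simp)).hasDerivAt
  have h2 : HasFDerivWithinAt (fun z : 𝔼 2 × ℝ => H z.2)
      ((deriv H z.2) • ContinuousLinearMap.snd ℝ (𝔼 2) ℝ) (slab a b) z :=
    h1.comp_hasFDerivWithinAt z hasFDerivWithinAt_snd
  exact h2.congr (fun y hy => hψ.leafMean_eq hy) (hψ.leafMean_eq hz)

/-- The divergence of the flux controls the derivative of the mean curvature. -/
lemma deriv_mean_le (hR : ∀ p : M, 0 ≤ scalarCurvature g p) (hz : z ∈ slab a b) :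
    deriv H z.2 * (chP (slabMetric g a b ψ) z * chR (slabMetric g a b ψ) z
        / chV (slabMetric g a b ψ) z)
      ≤ pdv (slab a b) slabDir 0 (flux0 (slab a b) slabDir (slabMetric g a b ψ)) z
        + pdv (slab a b) slabDir 1 (flux1 (slab a b) slabDir (slabMetric g a b ψ)) z := by
  have h1 := (hψ.hasFDerivWithinAt_leafMean hz).fderivWithin (uniqueDiffOn_slab a b z hz)
  have h2 := hψ.isMovingFrame.divergence_ge hz (fun k hk => ?_) (hψ.frameScalar_nonneg hR hz)
  · refine le_trans (le_of_eq ?_) h2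
    rw [pdv, h1]
    simp [slabDir]
    ring
  · rw [pdv, h1]
    fin_cases k
    · simp [slabDir]
    · simp [slabDir]
    · exact absurd rfl hk

end IsCMCCapillaryFoliation

end Leaves

/-! ### The model surface of revolution -/

section Model

/-- The cosine of the angle `γ̄` of the model surface, as a function of the height. -/
def cosA (r : ℝ → ℝ) (s : ℝ) : ℝ := -deriv r s / Real.sqrt (1 + deriv r s ^ 2)

/-- The sine of the angle `γ̄` of the model surface, as a function of the height. -/
def sinA (r : ℝ → ℝ) (s : ℝ) : ℝ := 1 / Real.sqrt (1 + deriv r s ^ 2)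

/-- The derivative of the angle `γ̄` of the model surface with respect to the height. -/
def angleRate (r : ℝ → ℝ) (s : ℝ) : ℝ := deriv (deriv r) s / (1 + deriv r s ^ 2)

lemma sqrt_slope_pos (r : ℝ → ℝ) (s : ℝ) : 0 < Real.sqrt (1 + deriv r s ^ 2) :=
  Real.sqrt_pos.2 (by positivity)

lemma sinA_pos (r : ℝ → ℝ) (s : ℝ) : 0 < sinA r s := one_div_pos.2 (sqrt_slope_pos r s)

lemma cosA_sq_add_sinA_sq (r : ℝ → ℝ) (s : ℝ) : cosA r s ^ 2 + sinA r s ^ 2 = 1 := by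
  have h := sqrt_slope_pos r s
  have h2 : Real.sqrt (1 + deriv r s ^ 2) ^ 2 = 1 + deriv r s ^ 2 := Real.sq_sqrt (by positivity)
  rw [cosA, sinA]
  field_simp
  linarith

lemma cos_modelAngle (r : ℝ → ℝ) (q : 𝔼 3) : Real.cos (modelAngle r q) = cosA r (q 2) := by
  have h1 : inner ℝ (modelNormal r q) (vec 2) = cosA r (q 2) := by
    simp [modelNormal, vec, cosA, PiLp.inner_apply]
    ring
  have h2 := cosA_sq_add_sinA_sq r (q 2)
  rw [modelAngle, h1, Real.cos_arccos] <;> nlinarith [sq_nonneg (sinA r (q 2))]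

lemma sin_modelAngle (r : ℝ → ℝ) (q : 𝔼 3) : Real.sin (modelAngle r q) = sinA r (q 2) := by
  have h0 : 0 ≤ Real.sin (modelAngle r q) := by
    rw [modelAngle, Real.sin_arccos]; positivity
  have h2 := cosA_sq_add_sinA_sq r (q 2)
  have h3 := Real.sin_sq_add_cos_sq (modelAngle r q)
  rw [cos_modelAngle] at h3
  exact (pow_left_inj₀ h0 (sinA_pos r _).le two_ne_zero).1 (by linarith)

lemma cot_modelAngle (r : ℝ → ℝ) (q : 𝔼 3) :
    Real.cot (modelAngle r q) = cosA r (q 2) / sinA r (q 2) := by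
  rw [Real.cot_eq_cos_div_sin, cos_modelAngle, sin_modelAngle]

lemma isOpen_strip (tm tp : ℝ) : IsOpen (strip tm tp) :=
  isOpen_Ioo.preimage (show Continuous fun x : 𝔼 2 => x 1 by fun_prop)

lemma pd_strip_mul {tm tp : ℝ} {A B : ℝ → ℝ} {A' B' : ℝ} {x : 𝔼 2} (hx : x ∈ strip tm tp)
    (hA : HasDerivAt A A' (x 1)) (hB : HasDerivAt B B' (x 0)) (ξ : 𝔼 2) :
    fderivWithin ℝ (fun x : 𝔼 2 => A (x 1) * B (x 0)) (strip tm tp) x ξ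
      = A (x 1) * B' * ξ 0 + A' * B (x 0) * ξ 1 := by
  have p0 : HasFDerivAt (fun x : 𝔼 2 => x 0) (EuclideanSpace.proj 0 : 𝔼 2 →L[ℝ] ℝ) x :=
    (EuclideanSpace.proj 0 : 𝔼 2 →L[ℝ] ℝ).hasFDerivAt
  have p1 : HasFDerivAt (fun x : 𝔼 2 => x 1) (EuclideanSpace.proj 1 : 𝔼 2 →L[ℝ] ℝ) x :=
    (EuclideanSpace.proj 1 : 𝔼 2 →L[ℝ] ℝ).hasFDerivAt
  have h := (hA.comp_hasFDerivAt x p1).mul (hB.comp_hasFDerivAt x p0)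
  rw [fderivWithin_of_isOpen (isOpen_strip tm tp) hx]
  change fderiv ℝ ((A ∘ fun x : 𝔼 2 => x 1) * (B ∘ fun x : 𝔼 2 => x 0)) x ξ = _
  rw [h.fderiv]
  simp
  ring

lemma fderivWithin_component {V : Type*} [NormedAddCommGroup V] [NormedSpace ℝ V] {S : Set V}
    {n : ℕ} {f : V → 𝔼 n} {x : V} (hu : UniqueDiffWithinAt ℝ S x)
    (hf : DifferentiableWithinAt ℝ f S x) (ξ : V) (i : Fin n) :
    fderivWithin ℝ f S x ξ i = fderivWithin ℝ (fun y => f y i) S x ξ := by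
  have h := ((EuclideanSpace.proj i : 𝔼 n →L[ℝ] ℝ).hasFDerivAt (x := f x)).comp_hasFDerivWithinAt x
    hf.hasFDerivWithinAt
  exact (congrArg (fun L : V →L[ℝ] ℝ => L ξ) (h.fderivWithin hu)).symm

variable {tm tp : ℝ} {r : ℝ → ℝ} (hr : IsProfile tm tp r)
include hr

namespace IsProfile

lemma contDiffAt {s : ℝ} (hs : s ∈ Ioo tm tp) : ContDiffAt ℝ ∞ r s :=
  hr.smooth.contDiffAt (isOpen_Ioo.mem_nhds hs)

lemma contDiffOn_deriv : ContDiffOn ℝ ∞ (deriv r) (Ioo tm tp) :=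
  hr.smooth.deriv_of_isOpen isOpen_Ioo (by simp)

lemma hasDerivAt {s : ℝ} (hs : s ∈ Ioo tm tp) : HasDerivAt r (deriv r s) s :=
  ((hr.contDiffAt hs).differentiableAt (by simp)).hasDerivAt

lemma hasDerivAt_deriv {s : ℝ} (hs : s ∈ Ioo tm tp) :
    HasDerivAt (deriv r) (deriv (deriv r) s) s :=
  ((hr.contDiffOn_deriv.contDiffAt (isOpen_Ioo.mem_nhds hs)).differentiableAt (by simp)).hasDerivAt

lemma hasDerivAt_sqrt_slope {s : ℝ} (hs : s ∈ Ioo tm tp) :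
    HasDerivAt (fun s => Real.sqrt (1 + deriv r s ^ 2))
      (deriv r s * deriv (deriv r) s / Real.sqrt (1 + deriv r s ^ 2)) s := by
  have h1 : HasDerivAt (fun s => 1 + deriv r s ^ 2) (2 * deriv r s * deriv (deriv r) s) s := by
    simpa using ((hr.hasDerivAt_deriv hs).fun_pow 2).const_add 1
  convert h1.sqrt (by positivity) using 1
  field_simp

lemma hasDerivAt_cosA {s : ℝ} (hs : s ∈ Ioo tm tp) :
    HasDerivAt (cosA r) (-sinA r s * angleRate r s) s := by
  have h0 := sqrt_slope_pos r s
  have h2 : Real.sqrt (1 + deriv r s ^ 2) ^ 2 = 1 + deriv r s ^ 2 := Real.sq_sqrt (by positivity)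
  have h1 := hr.hasDerivAt_deriv hs
  have h3 : HasDerivAt (cosA r) _ s := h1.fun_neg.fun_div (hr.hasDerivAt_sqrt_slope hs) h0.ne'
  convert h3 using 1
  rw [sinA, angleRate]
  generalize Real.sqrt (1 + deriv r s ^ 2) = w at *
  rw [← h2]
  field_simp
  linear_combination deriv (deriv r) s * h2

lemma hasDerivAt_sinA {s : ℝ} (hs : s ∈ Ioo tm tp) :
    HasDerivAt (sinA r) (cosA r s * angleRate r s) s := by
  have h0 := sqrt_slope_pos r s
  have h2 : Real.sqrt (1 + deriv r s ^ 2) ^ 2 = 1 + deriv r s ^ 2 := Real.sq_sqrt (by positivity)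
  have h1 := hr.hasDerivAt_deriv hs
  have h3 : HasDerivAt (sinA r) _ s := (hasDerivAt_const s (1 : ℝ)).fun_div (hr.hasDerivAt_sqrt_slope hs) h0.ne'
  convert h3 using 1
  rw [cosA, angleRate]
  generalize Real.sqrt (1 + deriv r s ^ 2) = w at *
  rw [← h2]
  field_simp
  ring

lemma angleRate_nonpos {s : ℝ} (hs : s ∈ Ioo tm tp) : angleRate r s ≤ 0 := by
  have h1 : AntitoneOn (deriv r) (Ioo tm tp) := by
    exact hr.concave.antitoneOn_deriv fun x hx => (hr.hasDerivAt hx).differentiableAt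
  have h2 : deriv (deriv r) s ≤ 0 := by
    rw [← derivWithin_of_isOpen isOpen_Ioo hs]
    exact h1.derivWithin_nonpos
  exact div_nonpos_of_nonpos_of_nonneg h2 (by positivity)

lemma contDiffOn_modelSurface : ContDiffOn ℝ ∞ (modelSurface r) (strip tm tp) := by
  have h1 : ContDiffOn ℝ ∞ (fun x : 𝔼 2 => r (x 1)) (strip tm tp) :=
    hr.smooth.comp (by fun_prop) fun x hx => hx
  refine contDiffOn_euclidean.2 fun i => ?_
  fin_cases i
  · exact h1.mul (by fun_prop)
  · exact h1.mul (by fun_prop)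
  · change ContDiffOn ℝ ∞ (fun x : 𝔼 2 => x 1) (strip tm tp)
    fun_prop

lemma fderivWithin_modelSurface {x : 𝔼 2} (hx : x ∈ strip tm tp) (ξ : 𝔼 2) :
    fderivWithin ℝ (modelSurface r) (strip tm tp) x ξ
      = !₂[r (x 1) * -Real.sin (x 0) * ξ 0 + deriv r (x 1) * Real.cos (x 0) * ξ 1,
        r (x 1) * Real.cos (x 0) * ξ 0 + deriv r (x 1) * Real.sin (x 0) * ξ 1, ξ 1] := by
  have hu : UniqueDiffWithinAt ℝ (strip tm tp) x := (isOpen_strip tm tp).uniqueDiffOn x hx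
  have hd := (hr.contDiffOn_modelSurface x hx).differentiableWithinAt (by simp)
  ext i
  rw [fderivWithin_component hu hd]
  fin_cases i
  · exact pd_strip_mul hx (hr.hasDerivAt hx) (Real.hasDerivAt_cos _) ξ
  · exact pd_strip_mul hx (hr.hasDerivAt hx) (Real.hasDerivAt_sin _) ξ
  · have := pd_strip_mul hx (hasDerivAt_id (x 1)) (hasDerivAt_const (x 0) (1 : ℝ)) ξ
    simp only [id_eq, mul_one, mul_zero, zero_mul, zero_add, one_mul] at this
    exact this

lemma norm_sq_fderivWithin_modelSurface {x : 𝔼 2} (hx : x ∈ strip tm tp) (ξ : 𝔼 2) :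
    ‖fderivWithin ℝ (modelSurface r) (strip tm tp) x ξ‖ ^ 2
      = r (x 1) ^ 2 * ξ 0 ^ 2 + (1 + deriv r (x 1) ^ 2) * ξ 1 ^ 2 := by
  rw [hr.fderivWithin_modelSurface hx, EuclideanSpace.norm_sq_eq, Fin.sum_univ_three]
  simp
  linear_combination (r (x 1) ^ 2 * ξ 0 ^ 2 + deriv r (x 1) ^ 2 * ξ 1 ^ 2)
    * Real.sin_sq_add_cos_sq (x 0)

lemma modelMeanCurvature_eq {x : 𝔼 2} (hx : x ∈ strip tm tp) :
    modelMeanCurvature tm tp r x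
      = sinA r (x 1) / r (x 1) - angleRate r (x 1) * sinA r (x 1) := by
  have hu : UniqueDiffOn ℝ (strip tm tp) := (isOpen_strip tm tp).uniqueDiffOn
  set G : 𝔼 3 → 𝔼 3 →L[ℝ] 𝔼 3 →L[ℝ] ℝ := fun _ => innerSL ℝ with hG
  have hGam : ∀ y, Gam univ G y = 0 := fun y => by
    have hc : ∀ k i j, christoffel univ (unc G) k i j y = 0 := fun k i j => by
      have h1 : ∀ i j, (fun z => gram (unc G) z i j) = fun _ => inner ℝ (vec i : 𝔼 3) (vec j) :=
        fun i j => rfl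
      simp [christoffel, h1, pd]
    ext u v k
    simp [Gam, hc]
  have hx' : 0 < r (x 1) := hr.pos _ hx
  have hs := sqrt_slope_pos r (x 1)
  have h2 : Real.sqrt (1 + deriv r (x 1) ^ 2) ^ 2 = 1 + deriv r (x 1) ^ 2 :=
    Real.sq_sqrt (by positivity)
  have hp : ∀ y ∈ strip tm tp, ∀ k : Fin 2, pd (strip tm tp) k (modelSurface r) y
      = ![!₂[r (y 1) * -Real.sin (y 0), r (y 1) * Real.cos (y 0), 0],
        !₂[deriv r (y 1) * Real.cos (y 0), deriv r (y 1) * Real.sin (y 0), 1]] k := by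
    intro y hy k
    rw [pd, hr.fderivWithin_modelSurface hy]
    fin_cases k <;> simp [vec]
  have hcov : ∀ a b, covD univ G (strip tm tp) (modelSurface r)
      (pd (strip tm tp) b (modelSurface r)) x (vec a)
      = fderivWithin ℝ (pd (strip tm tp) b (modelSurface r)) (strip tm tp) x (vec a) := by
    intro a b
    simp [covD, hGam]
  have hdp : ∀ b, DifferentiableWithinAt ℝ (pd (strip tm tp) b (modelSurface r)) (strip tm tp) x :=
    fun b => (((hr.contDiffOn_modelSurface.fderivWithin hu (m := ∞) (by simp)).clm_apply
      contDiffOn_const) x hx).differentiableWithinAt (by simp)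
  have c0 : inner ℝ (fderivWithin ℝ (pd (strip tm tp) 0 (modelSurface r)) (strip tm tp) x (vec 0))
      (modelNormal r (modelSurface r x)) = -r (x 1) * sinA r (x 1) := by
    have e : ∀ i, fderivWithin ℝ (pd (strip tm tp) 0 (modelSurface r)) (strip tm tp) x (vec 0) i
        = ![-r (x 1) * Real.cos (x 0), -r (x 1) * Real.sin (x 0), 0] i := by
      intro i
      rw [fderivWithin_component (hu x hx) (hdp 0),
        fderivWithin_congr (fun y hy => by rw [hp y hy 0]) (by rw [hp x hx 0])]
      fin_cases i
      · have := pd_strip_mul hx (hr.hasDerivAt hx) (Real.hasDerivAt_sin _).neg (vec 0)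
        simpa [vec] using this
      · have := pd_strip_mul hx (hr.hasDerivAt hx) (Real.hasDerivAt_cos _) (vec 0)
        simpa [vec] using this
      · simp
    rw [PiLp.inner_apply, Fin.sum_univ_three]
    simp only [e]
    simp [modelNormal, modelSurface, sinA]
    field_simp
    linear_combination -Real.sin_sq_add_cos_sq (x 0)
  have c1 : inner ℝ (fderivWithin ℝ (pd (strip tm tp) 1 (modelSurface r)) (strip tm tp) x (vec 1))
      (modelNormal r (modelSurface r x)) = deriv (deriv r) (x 1) * sinA r (x 1) := by
    have e : ∀ i, fderivWithin ℝ (pd (strip tm tp) 1 (modelSurface r)) (strip tm tp) x (vec 1) i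
        = ![deriv (deriv r) (x 1) * Real.cos (x 0), deriv (deriv r) (x 1) * Real.sin (x 0), 0] i := by
      intro i
      rw [fderivWithin_component (hu x hx) (hdp 1),
        fderivWithin_congr (fun y hy => by rw [hp y hy 1]) (by rw [hp x hx 1])]
      fin_cases i
      · have := pd_strip_mul hx (hr.hasDerivAt_deriv hx) (Real.hasDerivAt_cos _) (vec 1)
        simpa [vec] using this
      · have := pd_strip_mul hx (hr.hasDerivAt_deriv hx) (Real.hasDerivAt_sin _) (vec 1)
        simpa [vec] using this
      · simp
    rw [PiLp.inner_apply, Fin.sum_univ_three]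
    simp only [e]
    simp [modelNormal, modelSurface, sinA]
    field_simp
    linear_combination deriv (deriv r) (x 1) * Real.sin_sq_add_cos_sq (x 0)
  change meanCurvCoord univ (unc G) _ _ _ _ = _
  rw [meanCurvCoord_eq_sum univ G (strip tm tp) (modelSurface r) x _
    ![![1 / r (x 1), 0], ![0, sinA r (x 1)]]]
  · simp only [hcov, Fin.sum_univ_two]
    have hG : ∀ u w : 𝔼 3, G (modelSurface r x) u w = inner ℝ u w := fun _ _ => rfl
    simp [c0, c1, hG, sinA, angleRate]
    generalize Real.sqrt (1 + deriv r (x 1) ^ 2) = w at *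
    rw [← h2]
    field_simp
    ring
  · have hf : ∀ a b, firstFormCoord (unc G) (strip tm tp) (modelSurface r) x a b
        = inner ℝ (pd (strip tm tp) a (modelSurface r) x) (pd (strip tm tp) b (modelSurface r) x) :=
      fun a b => rfl
    have hsc := Real.sin_sq_add_cos_sq (x 0)
    have hin : ∀ a b : ℝ, inner ℝ a b = a * b := fun a b => by simp [mul_comm]
    have f00 : firstFormCoord (unc G) (strip tm tp) (modelSurface r) x 0 0 = r (x 1) ^ 2 := by
      simp only [hf, hp x hx, PiLp.inner_apply, Fin.sum_univ_three, hin]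
      simp
      linear_combination r (x 1) ^ 2 * hsc
    have f01 : firstFormCoord (unc G) (strip tm tp) (modelSurface r) x 0 1 = 0 := by
      simp only [hf, hp x hx, PiLp.inner_apply, Fin.sum_univ_three, hin]
      simp
      ring
    have f10 : firstFormCoord (unc G) (strip tm tp) (modelSurface r) x 1 0 = 0 := by
      simp only [hf, hp x hx, PiLp.inner_apply, Fin.sum_univ_three, hin]
      simp
      ring
    have f11 : firstFormCoord (unc G) (strip tm tp) (modelSurface r) x 1 1
        = 1 + deriv r (x 1) ^ 2 := by
      simp only [hf, hp x hx, PiLp.inner_apply, Fin.sum_univ_three, hin]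
      simp
      linear_combination deriv r (x 1) ^ 2 * hsc
    intro i j
    simp only [Fin.sum_univ_two, f00, f01, f10, f11, sinA]
    generalize Real.sqrt (1 + deriv r (x 1) ^ 2) = w at *
    rw [← h2]
    fin_cases i <;> fin_cases j <;> simp <;> field_simp

end IsProfile

end Model

/-! ### Lifting maps into the boundary to the parameters of the model surface -/

section Lift

lemma fderivWithin_component_eq_zero {V : Type*} [NormedAddCommGroup V] [NormedSpace ℝ V]
    {S : Set V} {n : ℕ} {f : V → 𝔼 n} {x : V} (hu : UniqueDiffWithinAt ℝ S x)
    (hf : DifferentiableWithinAt ℝ f S x) (hx : x ∈ S) (i : Fin n) (h0 : ∀ y ∈ S, f y i = 0)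
    (ξ : V) : fderivWithin ℝ f S x ξ i = 0 := by
  rw [fderivWithin_component hu hf, fderivWithin_congr (f := fun _ => (0 : ℝ)) h0 (h0 x hx)]
  simp

/-- The projection of `𝔼 3` to the last two coordinates. -/
def tangentProj : 𝔼 3 →L[ℝ] 𝔼 2 :=
  (EuclideanSpace.proj 1 : 𝔼 3 →L[ℝ] ℝ).smulRight (vec 0)
    + (EuclideanSpace.proj 2 : 𝔼 3 →L[ℝ] ℝ).smulRight (vec 1)

lemma tangentProj_apply (y : 𝔼 3) : tangentProj y 0 = y 1 ∧ tangentProj y 1 = y 2 := by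
  simp [tangentProj, vec]

lemma eq_of_tangentProj_eq {y y' : 𝔼 3} (h : tangentProj y = tangentProj y') (h0 : y 0 = y' 0) :
    y = y' := by
  have h1 := tangentProj_apply y
  have h2 := tangentProj_apply y'
  ext i
  fin_cases i
  · exact h0
  · exact h1.1.symm.trans ((by rw [h]) : tangentProj y 0 = tangentProj y' 0) |>.trans h2.1
  · exact h1.2.symm.trans ((by rw [h]) : tangentProj y 1 = tangentProj y' 1) |>.trans h2.2

variable {M : Type*} [TopologicalSpace M] [ChartedSpace (EuclideanHalfSpace 3) M]
  [IsManifold (𝓡∂ 3) ∞ M] {tm tp : ℝ} {r : ℝ → ℝ} {j : M → 𝔼 3} {B : 𝔼 2 → M}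
  {V : Type*} [NormedAddCommGroup V] [NormedSpace ℝ V]

/-- A parametrized piece of `∂M` at a point, in the preferred chart. -/
lemma exists_boundary_chart (hB : IsBoundaryIdentification tm tp r j B) {x : 𝔼 2}
    (hx : x ∈ strip tm tp) : ∃ O, IsOpen O ∧ x ∈ O ∧ O ⊆ strip tm tp ∧
      MapsTo B O (extChartAt (𝓡∂ 3) (B x)).source ∧
      ContDiffOn ℝ ∞ (fun y => extChartAt (𝓡∂ 3) (B x) (B y)) O ∧
      (∀ y ∈ O, extChartAt (𝓡∂ 3) (B x) (B y) 0 = 0) ∧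
      ∀ ξ, fderivWithin ℝ (fun y => extChartAt (𝓡∂ 3) (B x) (B y)) O x ξ
        = dm (strip tm tp) B x ξ := by
  have hn := hB.smooth.continuousOn x hx (extChartAt_source_mem_nhds (I := 𝓡∂ 3) (B x))
  obtain ⟨O, hO, hxO, hsub⟩ := mem_nhdsWithin.1 hn
  have hS := isOpen_strip tm tp
  have hm : MapsTo B (strip tm tp ∩ O) (extChartAt (𝓡∂ 3) (B x)).source :=
    fun y hy => hsub ⟨hy.2, hy.1⟩
  refine ⟨strip tm tp ∩ O, hS.inter hO, ⟨hx, hxO⟩, inter_subset_left, hm,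
    contMDiffOn_chart_comp (B x) (hB.smooth.mono inter_subset_left) hm, fun y hy => ?_, fun ξ => ?_⟩
  · refine chart_zero_of_mem_boundary (B x) (hm hy) ?_
    rw [← hB.image]; exact mem_image_of_mem B hy.1
  · rw [fderivWithin_inter (hO.mem_nhds hxO)]
    exact fderivWithin_chart_self (hS.uniqueDiffOn x hx)
      ((hB.smooth x hx).mdifferentiableWithinAt (by simp)) ξ

/-- Smooth maps into `∂M` lift locally to the parameters of the model surface. -/
lemma exists_lift (hB : IsBoundaryIdentification tm tp r j B) {D : Set V} (hD : IsOpen D)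
    {f : V → M} (hf : ContMDiffOn 𝓘(ℝ, V) (𝓡∂ 3) ∞ f D)
    (hb : ∀ y ∈ D, f y ∈ (𝓡∂ 3).boundary M) {y₀ : V} (hy₀ : y₀ ∈ D) :
    ∃ β : V → 𝔼 2, ContDiffAt ℝ ∞ β y₀ ∧ ∀ᶠ y in 𝓝 y₀, β y ∈ strip tm tp ∧ B (β y) = f y := by
  obtain ⟨x₀, hx₀, hBx⟩ : f y₀ ∈ B '' strip tm tp := by rw [hB.image]; exact hb y₀ hy₀
  obtain ⟨O, hO, hxO, hOs, hm, hFs, hF0, hFd⟩ := exists_boundary_chart hB hx₀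
  set F := fun y => extChartAt (𝓡∂ 3) (B x₀) (B y) with hF
  have hFat : ContDiffAt ℝ ∞ F x₀ := hFs.contDiffAt (hO.mem_nhds hxO)
  have hFdiff := hFat.differentiableAt (by simp)
  have hLat : ContDiffAt ℝ ∞ (fun y => tangentProj (F y)) x₀ :=
    tangentProj.contDiff.contDiffAt.comp x₀ hFat
  have hd : HasFDerivAt (fun y => tangentProj (F y)) (tangentProj.comp (fderiv ℝ F x₀)) x₀ :=
    tangentProj.hasFDerivAt.comp x₀ hFdiff.hasFDerivAt
  have hinj : Function.Injective (tangentProj.comp (fderiv ℝ F x₀)).toLinearMap := by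
    rw [injective_iff_map_eq_zero]
    intro ξ hξ
    have h1 : fderiv ℝ F x₀ ξ = 0 := by
      refine eq_of_tangentProj_eq (by rw [map_zero]; exact hξ) ?_
      rw [← fderivWithin_of_isOpen hO hxO]
      exact fderivWithin_component_eq_zero (hO.uniqueDiffOn x₀ hxO)
        hFdiff.differentiableWithinAt hxO 0 hF0 ξ
    rw [← fderivWithin_of_isOpen hO hxO, hFd] at h1
    exact hB.immersion x₀ hx₀ (h1.trans (map_zero (dm (strip tm tp) B x₀)).symm)
  set e : 𝔼 2 ≃L[ℝ] 𝔼 2 :=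
    (LinearEquiv.ofInjectiveEndo _ hinj).toContinuousLinearEquiv with he
  have hd' : HasFDerivAt (fun y => tangentProj (F y)) (e : 𝔼 2 →L[ℝ] 𝔼 2) x₀ := by
    have : (e : 𝔼 2 →L[ℝ] 𝔼 2) = tangentProj.comp (fderiv ℝ F x₀) := by ext1 ξ; rfl
    rw [this]; exact hd
  have hst := hLat.hasStrictFDerivAt' hd' (by simp)
  set κ := hLat.localInverse hd' (by simp) with hκ
  have hκs : ContDiffAt ℝ ∞ κ (tangentProj (F x₀)) := hLat.to_localInverse hd' (by simp)
  have hκ0 : κ (tangentProj (F x₀)) = x₀ := hLat.localInverse_apply_image hd' (by simp)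
  have hκr : ∀ᶠ y in 𝓝 (tangentProj (F x₀)), tangentProj (F (κ y)) = y :=
    hst.eventually_right_inverse
  have hfn : f ⁻¹' (extChartAt (𝓡∂ 3) (B x₀)).source ∈ 𝓝 y₀ := by
    refine ((hf y₀ hy₀).continuousWithinAt.continuousAt (hD.mem_nhds hy₀)) ?_
    rw [← hBx]; exact extChartAt_source_mem_nhds _
  have hch : ContDiffAt ℝ ∞ (fun y => extChartAt (𝓡∂ 3) (B x₀) (f y)) y₀ := by
    obtain ⟨U, hU, hUo, hyU⟩ := mem_nhds_iff.1 hfn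
    exact (contMDiffOn_chart_comp (B x₀) (hf.mono inter_subset_left)
      (fun y hy => hU hy.2)).contDiffAt ((hD.inter hUo).mem_nhds ⟨hy₀, hyU⟩)
  have hval : extChartAt (𝓡∂ 3) (B x₀) (f y₀) = F x₀ := by rw [← hBx]
  have hg : ContDiffAt ℝ ∞ (fun y => tangentProj (extChartAt (𝓡∂ 3) (B x₀) (f y))) y₀ :=
    tangentProj.contDiff.contDiffAt.comp y₀ hch
  have hg0 : tangentProj (extChartAt (𝓡∂ 3) (B x₀) (f y₀)) = tangentProj (F x₀) := by rw [hval]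
  have hβ : ContDiffAt ℝ ∞ (fun y => κ (tangentProj (extChartAt (𝓡∂ 3) (B x₀) (f y)))) y₀ :=
    ContDiffAt.comp y₀ (by rw [hg0]; exact hκs) hg
  refine ⟨_, hβ, ?_⟩
  have h1 : ∀ᶠ y in 𝓝 y₀, κ (tangentProj (extChartAt (𝓡∂ 3) (B x₀) (f y))) ∈ O := by
    refine hβ.continuousAt (hO.mem_nhds ?_)
    simpa only [hg0, hκ0] using hxO
  have h2 : ∀ᶠ y in 𝓝 y₀, tangentProj (F (κ (tangentProj (extChartAt (𝓡∂ 3) (B x₀) (f y)))))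
      = tangentProj (extChartAt (𝓡∂ 3) (B x₀) (f y)) := by
    refine hg.continuousAt.eventually (p := fun w => tangentProj (F (κ w)) = w) ?_
    simpa only [hg0] using hκr
  filter_upwards [h1, h2, hfn, hD.mem_nhds hy₀] with y hy1 hy2 hy3 hy4
  refine ⟨hOs hy1, ?_⟩
  have h3 := eq_of_tangentProj_eq hy2
    ((hF0 _ hy1).trans (chart_zero_of_mem_boundary (B x₀) hy3 (hb y hy4)).symm)
  exact (extChartAt (𝓡∂ 3) (B x₀)).injOn (hm hy1) hy3 h3

end Lift

/-! ### The second fundamental form of the boundary -/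

section BoundaryForm

section CovD

variable {n : ℕ} {V : Type*} [NormedAddCommGroup V] [NormedSpace ℝ V]
  {V' : Type*} [NormedAddCommGroup V'] [NormedSpace ℝ V']
  {R : Set (𝔼 n)} {G : 𝔼 n → 𝔼 n →L[ℝ] 𝔼 n →L[ℝ] ℝ} {S O : Set V}

/-- The covariant derivative of a coordinate field is local. -/
lemma covD_inter {F : V → 𝔼 n} {y : V} (hO : IsOpen O) (hy : y ∈ S ∩ O) (ξ ζ : V) :
    covD R G (S ∩ O) F (fun z => fderivWithin ℝ F (S ∩ O) z ζ) y ξ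
      = covD R G S F (fun z => fderivWithin ℝ F S z ζ) y ξ := by
  have h1 : EqOn (fun z => fderivWithin ℝ F (S ∩ O) z ζ) (fun z => fderivWithin ℝ F S z ζ)
      (S ∩ O) := fun z hz => by simp only [fderivWithin_inter (hO.mem_nhds hz.2)]
  simp only [covD, fderivWithin_inter (hO.mem_nhds hy.2)]
  rw [← fderivWithin_inter (f := fun z => fderivWithin ℝ F (S ∩ O) z ζ) (hO.mem_nhds hy.2),
    fderivWithin_congr h1 (h1 hy), fderivWithin_inter (hO.mem_nhds hy.2)]

/-- The covariant derivative along a composition. -/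
lemma covD_comp {φ W : V → 𝔼 n} {D : Set V'} {c : V' → V} {c' : V' →L[ℝ] V} {y : V'}
    (hu : UniqueDiffWithinAt ℝ D y) (hc : HasFDerivWithinAt c c' D y) (hm : MapsTo c D S)
    (hφ : DifferentiableWithinAt ℝ φ S (c y)) (hW : DifferentiableWithinAt ℝ W S (c y)) (ξ : V') :
    covD R G D (fun y => φ (c y)) (fun y => W (c y)) y ξ = covD R G S φ W (c y) (c' ξ) := by
  have h1 := (hφ.hasFDerivWithinAt.comp y hc hm).fderivWithin hu
  have h2 := (hW.hasFDerivWithinAt.comp y hc hm).fderivWithin hu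
  have h1' := congrArg (fun L : V' →L[ℝ] 𝔼 n => L ξ) h1
  have h2' := congrArg (fun L : V' →L[ℝ] 𝔼 n => L ξ) h2
  simp only [ContinuousLinearMap.comp_apply] at h1' h2'
  rw [covD, covD, ← h1', ← h2']
  rfl

end CovD

variable {M : Type*} [TopologicalSpace M] [ChartedSpace (EuclideanHalfSpace 3) M]
  [IsManifold (𝓡∂ 3) ∞ M] {V : Type*} [NormedAddCommGroup V] [NormedSpace ℝ V]

/-- A map into `M`, in the chart at the image of one of its points. -/
lemma exists_chart_inter {S : Set V} {f : V → M} (hf : ContMDiffOn 𝓘(ℝ, V) (𝓡∂ 3) ∞ f S) {y : V}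
    (hy : y ∈ S) : ∃ O, IsOpen O ∧ y ∈ O ∧ MapsTo f (S ∩ O) (extChartAt (𝓡∂ 3) (f y)).source ∧
      ContDiffOn ℝ ∞ (fun z => extChartAt (𝓡∂ 3) (f y) (f z)) (S ∩ O) := by
  have hn := hf.continuousOn y hy (extChartAt_source_mem_nhds (I := 𝓡∂ 3) (f y))
  obtain ⟨O, hO, hyO, hsub⟩ := mem_nhdsWithin.1 hn
  have hm : MapsTo f (S ∩ O) (extChartAt (𝓡∂ 3) (f y)).source := fun z hz => hsub ⟨hz.2, hz.1⟩
  exact ⟨O, hO, hyO, hm, contMDiffOn_chart_comp (f y) (hf.mono inter_subset_left) hm⟩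

/-- The differential of a map into `∂M` is tangent to `∂M`. -/
lemma dm_component_zero {S : Set V} (hS : UniqueDiffOn ℝ S) {f : V → M}
    (hf : ContMDiffOn 𝓘(ℝ, V) (𝓡∂ 3) ∞ f S) (hb : ∀ y ∈ S, f y ∈ (𝓡∂ 3).boundary M) {y : V}
    (hy : y ∈ S) (ξ : V) : dm S f y ξ 0 = 0 := by
  obtain ⟨O, hO, hyO, hm, hF⟩ := exists_chart_inter hf hy
  rw [← fderivWithin_chart_self (hS y hy) ((hf y hy).mdifferentiableWithinAt (by simp)),
    ← fderivWithin_inter (hO.mem_nhds hyO)]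
  exact fderivWithin_component_eq_zero (hS.inter hO y ⟨hy, hyO⟩)
    ((hF y ⟨hy, hyO⟩).differentiableWithinAt (by simp)) ⟨hy, hyO⟩ 0
    (fun z hz => chart_zero_of_mem_boundary _ (hm hz) (hb z hz.1)) ξ

/-- At a boundary point, the differential of a map into `M` maps inward directions of the parameter
domain to inward vectors. -/
lemma dm_component_nonneg {S : Set V} (hS : UniqueDiffOn ℝ S) {f : V → M}
    (hf : ContMDiffOn 𝓘(ℝ, V) (𝓡∂ 3) ∞ f S) {y : V} (hy : y ∈ S)
    (hb : f y ∈ (𝓡∂ 3).boundary M) {η : V} (hη : segment ℝ y (y + η) ⊆ S) :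
    0 ≤ dm S f y η 0 := by
  obtain ⟨O, hO, hyO, hm, hF⟩ := exists_chart_inter hf hy
  have hd : DifferentiableWithinAt ℝ (fun z => extChartAt (𝓡∂ 3) (f y) (f z)) S y :=
    (differentiableWithinAt_inter (hO.mem_nhds hyO)).1
      ((hF y ⟨hy, hyO⟩).differentiableWithinAt (by simp))
  rw [← fderivWithin_chart_self (hS y hy) ((hf y hy).mdifferentiableWithinAt (by simp)),
    fderivWithin_component (hS y hy) hd]
  have hmin : IsLocalMinOn (fun z => extChartAt (𝓡∂ 3) (f y) (f z) 0) S y := by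
    filter_upwards [self_mem_nhdsWithin, mem_nhdsWithin_of_mem_nhds (hO.mem_nhds hyO)] with z h1 h2
    rw [chart_zero_of_mem_boundary (f y) (mem_extChartAt_source _) hb]
    have := extChartAt_target_subset_range (I := 𝓡∂ 3) (f y)
      ((extChartAt (𝓡∂ 3) (f y)).map_source (hm ⟨h1, h2⟩))
    rwa [range_modelWithCornersEuclideanHalfSpace] at this
  exact hmin.fderivWithin_nonneg (mem_posTangentConeAt_of_segment_subset hη)

/-- The second fundamental form of `∂M` at `p` with respect to the normal `Y`: since maps into
`{y₀ = 0}` have second derivatives in this face, only the Christoffel symbols contribute. -/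
def sff (g : Metric3 M) (p : M) (Y u w : 𝔼 3) : ℝ :=
  -met g p (Gam (range (𝓡∂ 3)) (chartG g p) (extChartAt (𝓡∂ 3) p p) u w) Y

/-- The second fundamental form of `∂M`, from the second derivatives of any map into `∂M`. -/
lemma inner_covD_boundary (g : Metric3 M) {S : Set V} (hS : UniqueDiffOn ℝ S) {f : V → M}
    (hf : ContMDiffOn 𝓘(ℝ, V) (𝓡∂ 3) ∞ f S) (hb : ∀ y ∈ S, f y ∈ (𝓡∂ 3).boundary M) {y : V}
    (hy : y ∈ S) {Y : 𝔼 3} (hY : ∀ w : 𝔼 3, w 0 = 0 → met g (f y) w Y = 0) (ξ ζ : V) :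
    -met g (f y) (covD (range (𝓡∂ 3)) (chartG g (f y)) S (fun z => extChartAt (𝓡∂ 3) (f y) (f z))
      (fun z => fderivWithin ℝ (fun z => extChartAt (𝓡∂ 3) (f y) (f z)) S z ζ) y ξ) Y
      = sff g (f y) Y (dm S f y ξ) (dm S f y ζ) := by
  obtain ⟨O, hO, hyO, hm, hF⟩ := exists_chart_inter hf hy
  have hu := hS.inter hO
  have hfy : ∀ ξ, fderivWithin ℝ (fun z => extChartAt (𝓡∂ 3) (f y) (f z)) S y ξ = dm S f y ξ :=
    fun ξ => fderivWithin_chart_self (hS y hy) ((hf y hy).mdifferentiableWithinAt (by simp)) ξ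
  rw [← covD_inter hO ⟨hy, hyO⟩, covD, map_add, _root_.add_apply, hY, zero_add, sff]
  · simp only [fderivWithin_inter (hO.mem_nhds hyO), hfy]
  · have hF' := ((hF.fderivWithin hu (m := ∞) (by simp)).clm_apply (contDiffOn_const (c := ζ)))
    exact fderivWithin_component_eq_zero (hu y ⟨hy, hyO⟩)
      ((hF' y ⟨hy, hyO⟩).differentiableWithinAt (by simp)) ⟨hy, hyO⟩ 0
      (fun z hz => fderivWithin_component_eq_zero (hu z hz)
        ((hF z hz).differentiableWithinAt (by simp)) hz 0
        (fun z hz => chart_zero_of_mem_boundary _ (hm hz) (hb z hz.1)) ζ) ξ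

lemma sff_add_left (g : Metric3 M) (p : M) (Y u u' w : 𝔼 3) :
    sff g p Y (u + u') w = sff g p Y u w + sff g p Y u' w := by
  simp only [sff, map_add, _root_.add_apply]; ring

lemma sff_smul_left (g : Metric3 M) (p : M) (Y u w : 𝔼 3) (k : ℝ) :
    sff g p Y (k • u) w = k * sff g p Y u w := by
  simp only [sff, map_smul, _root_.smul_apply, smul_eq_mul]; ring

lemma sff_add_right (g : Metric3 M) (p : M) (Y u w w' : 𝔼 3) :
    sff g p Y u (w + w') = sff g p Y u w + sff g p Y u w' := by
  simp only [sff, map_add, _root_.add_apply]; ring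

lemma sff_smul_right (g : Metric3 M) (p : M) (Y u w : 𝔼 3) (k : ℝ) :
    sff g p Y u (k • w) = k * sff g p Y u w := by
  simp only [sff, map_smul, _root_.smul_apply, smul_eq_mul]; ring

variable {tm tp : ℝ} {r : ℝ → ℝ} {j : M → 𝔼 3} {B : 𝔼 2 → M}

/-- The mean curvature of `∂M` as the trace of its second fundamental form. -/
lemma meanCurvature_boundary (g : Metric3 M) (hB : IsBoundaryIdentification tm tp r j B) {x : 𝔼 2}
    (hx : x ∈ strip tm tp) {Y : 𝔼 3}
    (hY : ∀ w : 𝔼 3, w 0 = 0 → met g (B x) w Y = 0) (E : Fin 2 → 𝔼 2)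
    (hE : ∀ i k, met g (B x) (dm (strip tm tp) B x (E i)) (dm (strip tm tp) B x (E k))
      = if i = k then 1 else 0) :
    meanCurvature g (strip tm tp) B x Y
      = ∑ i, sff g (B x) Y (dm (strip tm tp) B x (E i)) (dm (strip tm tp) B x (E i)) := by
  have hS : UniqueDiffOn ℝ (strip tm tp) := (isOpen_strip tm tp).uniqueDiffOn
  have hb : ∀ y ∈ strip tm tp, B y ∈ (𝓡∂ 3).boundary M := fun y hy => by
    rw [← hB.image]; exact mem_image_of_mem B hy
  have hexp : ∀ i, E i = ∑ k, E i k • vec k := fun i => (sum_smul_vec (E i)).symm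
  have hfy : ∀ ξ, fderivWithin ℝ (fun z => extChartAt (𝓡∂ 3) (B x) (B z)) (strip tm tp) x ξ
      = dm (strip tm tp) B x ξ := fun ξ =>
    fderivWithin_chart_self (hS x hx) ((hB.smooth x hx).mdifferentiableWithinAt (by simp)) ξ
  have hff : ∀ k l, firstFormCoord (chartMetric g (B x)) (strip tm tp)
      (fun z => extChartAt (𝓡∂ 3) (B x) (B z)) x k l
      = met g (B x) (dm (strip tm tp) B x (vec k)) (dm (strip tm tp) B x (vec l)) := fun k l => by
    rw [← chartG_self g (B x), ← hfy, ← hfy]; rfl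
  have h1 := meanCurvCoord_eq_sum (range (𝓡∂ 3)) (chartG g (B x)) (strip tm tp)
    (fun z => extChartAt (𝓡∂ 3) (B x) (B z)) x Y (fun i k => E i k) (by
      intro i k
      rw [unc_chartG]
      simp only [hff]
      rw [← hE i k, hexp i, hexp k]
      simp [Fin.sum_univ_two, vec_apply]
      ring)
  have h2 : meanCurvature g (strip tm tp) B x Y = meanCurvCoord (range (𝓡∂ 3))
      (unc (chartG g (B x))) (strip tm tp) (fun z => extChartAt (𝓡∂ 3) (B x) (B z)) x Y := by
    rw [unc_chartG]
    exact congrArg (meanCurvCoord (range (𝓡∂ 3)) (chartMetric g (B x)) (strip tm tp)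
      (fun z => extChartAt (𝓡∂ 3) (B x) (B z)) x) (coords_eq (B x) Y)
  rw [h2, h1, ← Finset.sum_neg_distrib]
  refine Finset.sum_congr rfl fun i _ => ?_
  have h3 : ∀ k l, chartG g (B x) (extChartAt (𝓡∂ 3) (B x) (B x)) (covD (range (𝓡∂ 3))
      (chartG g (B x)) (strip tm tp) (fun z => extChartAt (𝓡∂ 3) (B x) (B z))
      (pd (strip tm tp) l (fun z => extChartAt (𝓡∂ 3) (B x) (B z))) x (vec k)) Y
      = -sff g (B x) Y (dm (strip tm tp) B x (vec k)) (dm (strip tm tp) B x (vec l)) := by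
    intro k l
    rw [chartG_self, ← inner_covD_boundary g hS hB.smooth hb hx hY, neg_neg]
    rfl
  simp only [h3]
  conv_rhs => rw [hexp i]
  simp only [Fin.sum_univ_two, map_add, map_smul, sff_add_left, sff_add_right, sff_smul_left,
    sff_smul_right]
  ring

end BoundaryForm

/-! ### The boundary curves of the family of disks -/

section Circle

/-- The point of the unit circle at the angle `α`. -/
def circlePt (α : ℝ) : 𝔼 2 := !₂[Real.cos α, Real.sin α]

/-- The counterclockwise unit tangent vector of the unit circle at the angle `α`. -/
def circleDir (α : ℝ) : 𝔼 2 := !₂[-Real.sin α, Real.cos α]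

/-- The boundary of the parameter domain, parametrized by the angle and the time. -/
def circ (y : ℝ × ℝ) : 𝔼 2 × ℝ := (circlePt y.1, y.2)

/-- The parameters of the boundary. -/
def cyl (a b : ℝ) : Set (ℝ × ℝ) := univ ×ˢ Ioo a b

/-- The components of the differential of `circ` in the coordinate directions. -/
def circCoef (y ξ : ℝ × ℝ) : Fin 3 → ℝ := ![-Real.sin y.1 * ξ.1, Real.cos y.1 * ξ.1, ξ.2]

lemma isOpen_cyl (a b : ℝ) : IsOpen (cyl a b) := isOpen_univ.prod isOpen_Ioo

lemma norm_circlePt (α : ℝ) : ‖circlePt α‖ = 1 := by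
  rw [EuclideanSpace.norm_eq, Fin.sum_univ_two]
  simp [circlePt]

lemma circlePt_mem_sphere (α : ℝ) : circlePt α ∈ Metric.sphere (0 : 𝔼 2) 1 := by
  simp [norm_circlePt]

lemma circlePt_mem_disk (α : ℝ) : circlePt α ∈ disk :=
  Metric.sphere_subset_closedBall (circlePt_mem_sphere α)

lemma circ_mem {a b : ℝ} {y : ℝ × ℝ} (hy : y ∈ cyl a b) : circ y ∈ slab a b :=
  ⟨circlePt_mem_disk _, hy.2⟩

lemma contDiff_circlePt : ContDiff ℝ ∞ circlePt := by
  refine contDiff_euclidean.2 fun i => ?_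
  fin_cases i
  · exact Real.contDiff_cos
  · exact Real.contDiff_sin

lemma contDiff_circ : ContDiff ℝ ∞ circ :=
  (contDiff_circlePt.comp contDiff_fst).prodMk contDiff_snd

lemma hasDerivAt_circlePt (α : ℝ) : HasDerivAt circlePt (circleDir α) α := by
  have h : circlePt = fun α => Real.cos α • vec 0 + Real.sin α • vec 1 := by
    funext α; ext i; fin_cases i <;> simp [circlePt, vec]
  have h' : circleDir α = -Real.sin α • vec 0 + Real.cos α • vec 1 := by
    ext i; fin_cases i <;> simp [circleDir, vec]
  rw [h, h']
  exact ((Real.hasDerivAt_cos α).smul_const _).add ((Real.hasDerivAt_sin α).smul_const _)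

/-- The differential of `circ`. -/
def dcirc (y : ℝ × ℝ) : ℝ × ℝ →L[ℝ] 𝔼 2 × ℝ :=
  ((ContinuousLinearMap.fst ℝ ℝ ℝ).smulRight (circleDir y.1)).prod (ContinuousLinearMap.snd ℝ ℝ ℝ)

lemma hasFDerivAt_circ (y : ℝ × ℝ) : HasFDerivAt circ (dcirc y) y := by
  have h := (hasDerivAt_circlePt y.1).hasFDerivAt.comp y (hasFDerivAt_fst (𝕜 := ℝ) (p := y))
  exact (h.prodMk hasFDerivAt_snd)

lemma dcirc_apply (y ξ : ℝ × ℝ) : dcirc y ξ = ∑ k, circCoef y ξ k • slabDir k := by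
  rw [Fin.sum_univ_three]
  refine Prod.ext ?_ ?_
  · ext i
    fin_cases i <;> simp [dcirc, circCoef, slabDir, circleDir, vec, mul_comm]
  · simp [dcirc, circCoef, slabDir]

variable {M : Type*} [TopologicalSpace M] [ChartedSpace (EuclideanHalfSpace 3) M]
  [IsManifold (𝓡∂ 3) ∞ M]

/-- The components, in the frame, of the image of a tangent vector of the boundary. -/
def tanComp (h : Fin 3 → Fin 3 → 𝔼 2 × ℝ → ℝ) (y ξ : ℝ × ℝ) (i : Fin 3) : ℝ :=
  ∑ k, circCoef y ξ k * coframe h (cholC h) k i (circ y)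

/-- The connection form of the frame along the boundary. -/
def connAlong (a b : ℝ) (h : Fin 3 → Fin 3 → 𝔼 2 × ℝ → ℝ) (y ξ : ℝ × ℝ) (i l : Fin 3) : ℝ :=
  ∑ k, circCoef y ξ k * conn (slab a b) slabDir h (cholC h) k i l (circ y)

/-- The boundary curves `∂Σ_t`, parametrized by the angle and the time. -/
def bdryMap (ψ : 𝔼 2 × ℝ → M) (y : ℝ × ℝ) : M := ψ (circ y)

variable {g : Metric3 M} {X : ∀ p : M, TangentSpace (𝓡∂ 3) p} {tm tp : ℝ} {r : ℝ → ℝ}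
  {j : M → 𝔼 3} {a b : ℝ} {ψ : 𝔼 2 × ℝ → M} {N : ∀ z, TangentSpace (𝓡∂ 3) (ψ z)} {H : ℝ → ℝ}

namespace IsCMCCapillaryFoliation

variable (hψ : IsCMCCapillaryFoliation g X tm tp r j a b ψ N H) {y : ℝ × ℝ}
include hψ

lemma contMDiffOn_bdryMap : ContMDiffOn 𝓘(ℝ, ℝ × ℝ) (𝓡∂ 3) ∞ (bdryMap ψ) (cyl a b) :=
  hψ.smooth.comp contDiff_circ.contMDiff.contMDiffOn fun _ hy => circ_mem hy

lemma bdryMap_mem (hy : y ∈ cyl a b) : bdryMap ψ y ∈ (𝓡∂ 3).boundary M :=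
  hψ.boundary y.2 hy.2 _ (circlePt_mem_sphere y.1)

lemma dm_bdryMap (hy : y ∈ cyl a b) (ξ : ℝ × ℝ) :
    dm (cyl a b) (bdryMap ψ) y ξ = dm (slab a b) ψ (circ y) (dcirc y ξ) := by
  have hu : UniqueDiffWithinAt ℝ (cyl a b) y := (isOpen_cyl a b).uniqueDiffOn y hy
  have h1 := (hasFDerivAt_circ y).hasFDerivWithinAt (s := cyl a b)
  have h2 := mfderivWithin_comp (I := 𝓘(ℝ, ℝ × ℝ)) (I' := 𝓘(ℝ, 𝔼 2 × ℝ)) (I'' := 𝓡∂ 3)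
    (s := cyl a b) (f := circ) (g := ψ) (u := slab a b) y
    ((hψ.smooth (circ y) (circ_mem hy)).mdifferentiableWithinAt (by simp))
    h1.differentiableWithinAt.mdifferentiableWithinAt
    (fun y hy => circ_mem hy) hu.uniqueMDiffWithinAt
  rw [mfderivWithin_eq_fderivWithin, h1.fderivWithin hu] at h2
  exact congrArg (fun L : ℝ × ℝ →L[ℝ] 𝔼 3 => L ξ) h2

lemma inner_dm_bdryMap (hy : y ∈ cyl a b) (ξ : ℝ × ℝ) (i : Fin 3) :
    met g (bdryMap ψ y) (dm (cyl a b) (bdryMap ψ) y ξ) (slabFrame g a b ψ i (circ y))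
      = tanComp (slabMetric g a b ψ) y ξ i := by
  rw [hψ.dm_bdryMap hy, dcirc_apply]
  simp only [map_sum, map_smul, _root_.sum_apply, _root_.smul_apply, smul_eq_mul, tanComp]
  exact Finset.sum_congr rfl fun k _ => by
    rw [← inner_dm_slabFrame (g := g) (a := a) (b := b) (ψ := ψ)]; rfl

/-- The second fundamental form of `∂M` along the boundary curves, for a normal field which is given
by its components `x` in the frame. -/
lemma sff_bdryMap (hy : y ∈ cyl a b) {x : Fin 3 → ℝ × ℝ → ℝ} (hx : ∀ i, DifferentiableAt ℝ (x i) y)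
    (hperp : ∀ᶠ y' in 𝓝 y, ∀ ζ, ∑ i, tanComp (slabMetric g a b ψ) y' ζ i * x i y' = 0)
    {Y : 𝔼 3} (hYx : Y = ∑ i, x i y • slabFrame g a b ψ i (circ y))
    (hY : ∀ w : 𝔼 3, w 0 = 0 → met g (bdryMap ψ y) w Y = 0) (ξ ζ : ℝ × ℝ) :
    sff g (bdryMap ψ y) Y (dm (cyl a b) (bdryMap ψ) y ξ) (dm (cyl a b) (bdryMap ψ) y ζ)
      = ∑ i, tanComp (slabMetric g a b ψ) y ζ i * (fderiv ℝ (x i) y ξ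
        + ∑ l, x l y * connAlong a b (slabMetric g a b ψ) y ξ l i) := by
  set h := slabMetric g a b ψ with hh
  have hC : UniqueDiffOn ℝ (cyl a b) := (isOpen_cyl a b).uniqueDiffOn
  have hF := isFrame_chol hψ.isMovingFrame.smooth hψ.posDef
  obtain ⟨O, hO, hzO, hs, hP⟩ := exists_isPullback (uniqueDiffOn_slab a b)
    (slab_subset_closure_interior a b) hψ.smooth (bdryMap ψ y) (circ_mem hy)
    (mem_extChartAt_source _) hF
  set φ : 𝔼 2 × ℝ → 𝔼 3 := fun z => extChartAt (𝓡∂ 3) (bdryMap ψ y) (ψ z) with hφ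
  replace hP : IsPullback (range (𝓡∂ 3)) (extChartAt (𝓡∂ 3) (bdryMap ψ y)).target
    (chartG g (bdryMap ψ y)) (slab a b ∩ O) slabDir φ h (cholC h) := hP
  have hO2 : IsOpen (circ ⁻¹' O) := hO.preimage contDiff_circ.continuous
  set D := cyl a b ∩ circ ⁻¹' O with hD
  have hDo : IsOpen D := (isOpen_cyl a b).inter hO2
  have hu : UniqueDiffOn ℝ D := hDo.uniqueDiffOn
  have hm : MapsTo circ D (slab a b ∩ O) := fun y hy => ⟨circ_mem hy.1, hy.2⟩
  have hyD : y ∈ D := ⟨hy, hzO⟩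
  have hFs : ContDiffOn ℝ ∞ (fun y => φ (circ y)) D :=
    hP.smooth.comp contDiff_circ.contDiffOn hm
  have hFm : MapsTo (fun y => φ (circ y)) D (extChartAt (𝓡∂ 3) (bdryMap ψ y)).target :=
    fun y hy => hP.mapsTo (hm hy)
  have hdF : ∀ y' ∈ D, ∀ ξ, fderivWithin ℝ (fun y => φ (circ y)) D y' ξ
      = fderivWithin ℝ φ (slab a b ∩ O) (circ y') (dcirc y' ξ) := by
    intro y' hy' ξ
    have h2 := (((hP.smooth (circ y') (hm hy')).differentiableWithinAt
      (by simp)).hasFDerivWithinAt.comp y' (hasFDerivAt_circ y').hasFDerivWithinAt hm).fderivWithin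
      (hu y' hy')
    exact congrArg (fun L : ℝ × ℝ →L[ℝ] 𝔼 3 => L ξ) h2
  have hu1 : ∀ y' ∈ D, ∀ ξ i, chartG g (bdryMap ψ y) (φ (circ y'))
      (fderivWithin ℝ (fun y => φ (circ y)) D y' ξ)
      (frameAlong (slab a b ∩ O) slabDir φ (cholC h) i (circ y')) = tanComp h y' ξ i := by
    intro y' hy' ξ i
    rw [hdF y' hy', dcirc_apply]
    simp only [map_sum, map_smul, _root_.sum_apply, _root_.smul_apply, smul_eq_mul, tanComp,
      hP.inner_coframe (hm hy')]
  have hfr : ∀ i, DifferentiableWithinAt ℝ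
      (fun y => frameAlong (slab a b ∩ O) slabDir φ (cholC h) i (circ y)) D y := fun i =>
    ((hP.contDiffOn_frame i _ (hm hyD)).differentiableWithinAt (by simp)).comp y
      (hasFDerivAt_circ y).differentiableAt.differentiableWithinAt hm
  have hW : DifferentiableWithinAt ℝ (fun y => ∑ i, x i y •
      frameAlong (slab a b ∩ O) slabDir φ (cholC h) i (circ y)) D y :=
    DifferentiableWithinAt.fun_sum fun i _ => (hx i).differentiableWithinAt.smul (hfr i)
  have hdFζ : DifferentiableWithinAt ℝ
      (fun y' => fderivWithin ℝ (fun y => φ (circ y)) D y' ζ) D y :=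
    (((hFs.fderivWithin hu (m := ∞) (by simp)).clm_apply contDiffOn_const) y
      hyD).differentiableWithinAt (by simp)
  have hal := fderivWithin_inner_along hP.metric hu hFs hFm hyD hdFζ hW ξ
  have hz : (fun y' => chartG g (bdryMap ψ y) (φ (circ y'))
      (fderivWithin ℝ (fun y => φ (circ y)) D y' ζ)
      (∑ i, x i y' • frameAlong (slab a b ∩ O) slabDir φ (cholC h) i (circ y')))
      =ᶠ[𝓝[D] y] fun _ => (0 : ℝ) := by
    filter_upwards [self_mem_nhdsWithin, mem_nhdsWithin_of_mem_nhds hperp] with y' h1 h2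
    simp only [map_sum, map_smul, smul_eq_mul, hu1 y' h1]
    rw [← h2 ζ]
    exact Finset.sum_congr rfl fun i _ => mul_comm _ _
  rw [hz.fderivWithin_eq_of_mem hyD, fderivWithin_const_apply, _root_.zero_apply] at hal
  have hdm : ∀ ξ, fderivWithin ℝ φ (slab a b ∩ O) (circ y) ξ = dm (slab a b) ψ (circ y) ξ :=
    fun ξ => by
      rw [fderivWithin_inter (hO.mem_nhds hzO)]
      exact fderivWithin_chart_self (uniqueDiffOn_slab a b _ (circ_mem hy))
        ((hψ.smooth _ (circ_mem hy)).mdifferentiableWithinAt (by simp)) ξ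
  have hfy : ∀ i, frameAlong (slab a b ∩ O) slabDir φ (cholC h) i (circ y)
      = slabFrame g a b ψ i (circ y) := fun i => by simp only [frameAlong, hdm, slabFrame, hh]
  have hWy : ∑ i, x i y • frameAlong (slab a b ∩ O) slabDir φ (cholC h) i (circ y) = Y := by
    rw [hYx]; simp only [hfy]
  rw [← inner_covD_boundary g hC hψ.contMDiffOn_bdryMap (fun y hy => hψ.bdryMap_mem hy) hy hY,
    ← covD_inter hO2 hyD, ← chartG_self]
  rw [hWy] at hal
  have hal' := neg_eq_of_add_eq_zero_right hal.symm
  refine hal'.trans ?_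
  rw [covD_sum hu hyD (fun i => (hx i).differentiableWithinAt) hfr]
  simp only [fderivWithin_of_isOpen hDo hyD]
  rw [← fderivWithin_of_isOpen hDo hyD]
  have hcov : ∀ i, covD (range (𝓡∂ 3)) (chartG g (bdryMap ψ y)) D (fun y => φ (circ y))
      (fun y => frameAlong (slab a b ∩ O) slabDir φ (cholC h) i (circ y)) y ξ
      = ∑ k, circCoef y ξ k • covD (range (𝓡∂ 3)) (chartG g (bdryMap ψ y)) (slab a b ∩ O) φ
        (frameAlong (slab a b ∩ O) slabDir φ (cholC h) i) (circ y) (slabDir k) := by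
    intro i
    rw [covD_comp (hu y hyD) (hasFDerivAt_circ y).hasFDerivWithinAt hm
      ((hP.smooth _ (hm hyD)).differentiableWithinAt (by simp))
      ((hP.contDiffOn_frame i _ (hm hyD)).differentiableWithinAt (by simp)), dcirc_apply]
    simp only [Fin.sum_univ_three, covD_add_dir, covD_smul_dir]
  simp only [hcov, map_sum, map_add, map_smul, smul_eq_mul, hu1 y hyD]
  have hin : ∀ k i, chartG g (bdryMap ψ y) (φ (circ y))
      (fderivWithin ℝ (fun y => φ (circ y)) D y ζ)
      (covD (range (𝓡∂ 3)) (chartG g (bdryMap ψ y)) (slab a b ∩ O) φ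
        (frameAlong (slab a b ∩ O) slabDir φ (cholC h) i) (circ y) (slabDir k))
      = ∑ l, tanComp h y ζ l * conn (slab a b) slabDir h (cholC h) k i l (circ y) := by
    intro k i
    rw [orthonormal_inner (chartG g (bdryMap ψ y) (φ (circ y))) _ (hP.inner_frame (hm hyD))]
    simp only [hu1 y hyD, hP.inner_conn (hm hyD), conn_inter hO hzO]
  simp only [hin, connAlong, Fin.sum_univ_three]
  ring

end IsCMCCapillaryFoliation

end Circle

/-! ### The outward normal along the boundary curves -/

section BoundaryNormal

/-- The first component of the tangent vector of the boundary curves in the frame. -/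
def bw0 (h : Fin 3 → Fin 3 → 𝔼 2 × ℝ → ℝ) (y : ℝ × ℝ) : ℝ :=
  -Real.sin y.1 * chP h (circ y) + Real.cos y.1 * chQ h (circ y)

/-- The second component of the tangent vector of the boundary curves in the frame. -/
def bw1 (h : Fin 3 → Fin 3 → 𝔼 2 × ℝ → ℝ) (y : ℝ × ℝ) : ℝ := Real.cos y.1 * chR h (circ y)

/-- The length element of the boundary curves. -/
def bl (h : Fin 3 → Fin 3 → 𝔼 2 × ℝ → ℝ) (y : ℝ × ℝ) : ℝ := Real.sqrt (bw0 h y ^ 2 + bw1 h y ^ 2)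

/-- The first component of the unit tangent vector of the boundary curves. -/
def be0 (h : Fin 3 → Fin 3 → 𝔼 2 × ℝ → ℝ) (y : ℝ × ℝ) : ℝ := bw0 h y / bl h y

/-- The second component of the unit tangent vector of the boundary curves. -/
def be1 (h : Fin 3 → Fin 3 → 𝔼 2 × ℝ → ℝ) (y : ℝ × ℝ) : ℝ := bw1 h y / bl h y

section Frame

variable {a b : ℝ} {h : Fin 3 → Fin 3 → 𝔼 2 × ℝ → ℝ} {y : ℝ × ℝ}

lemma tanComp_eq (hp : IsPosDefOn (slab a b) h) (hy : y ∈ cyl a b) (ξ : ℝ × ℝ) :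
    tanComp h y ξ 0 = ξ.1 * bw0 h y + ξ.2 * chS h (circ y) ∧
    tanComp h y ξ 1 = ξ.1 * bw1 h y + ξ.2 * chU h (circ y) ∧
    tanComp h y ξ 2 = ξ.2 * chV h (circ y) := by
  simp only [tanComp, coframe_chol hp (circ_mem hy), Fin.sum_univ_three, circCoef, bw0, bw1]
  refine ⟨?_, ?_, ?_⟩ <;> simp <;> ring

lemma bw_sq_pos (hp : IsPosDefOn (slab a b) h) (hy : y ∈ cyl a b) :
    0 < bw0 h y ^ 2 + bw1 h y ^ 2 := by
  have h1 := chP_pos hp (circ_mem hy)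
  have h2 := chR_pos hp (circ_mem hy)
  by_cases hc : Real.cos y.1 = 0
  · have hs : Real.sin y.1 ≠ 0 := fun hs => by
      have := Real.sin_sq_add_cos_sq y.1
      rw [hs, hc] at this; norm_num at this
    have : bw0 h y ≠ 0 := by
      rw [bw0, hc, zero_mul, add_zero]
      exact mul_ne_zero (neg_ne_zero.2 hs) h1.ne'
    positivity
  · have : bw1 h y ≠ 0 := mul_ne_zero hc h2.ne'
    positivity

lemma bl_pos (hp : IsPosDefOn (slab a b) h) (hy : y ∈ cyl a b) : 0 < bl h y :=
  Real.sqrt_pos.2 (bw_sq_pos hp hy)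

lemma bl_sq (hp : IsPosDefOn (slab a b) h) (hy : y ∈ cyl a b) :
    bl h y ^ 2 = bw0 h y ^ 2 + bw1 h y ^ 2 := Real.sq_sqrt (bw_sq_pos hp hy).le

lemma bw_eq (hp : IsPosDefOn (slab a b) h) (hy : y ∈ cyl a b) :
    bw0 h y = bl h y * be0 h y ∧ bw1 h y = bl h y * be1 h y := by
  have := (bl_pos hp hy).ne'
  constructor
  · rw [be0]; field_simp
  · rw [be1]; field_simp

lemma be_sq (hp : IsPosDefOn (slab a b) h) (hy : y ∈ cyl a b) : be0 h y ^ 2 + be1 h y ^ 2 = 1 := by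
  have h1 := (bl_pos hp hy).ne'
  have h2 := bl_sq hp hy
  rw [be0, be1]
  field_simp
  linarith

lemma contDiffOn_bw (hh : ∀ k l, ContDiffOn ℝ ∞ (h k l) (slab a b)) (hp : IsPosDefOn (slab a b) h) :
    ContDiffOn ℝ ∞ (bw0 h) (cyl a b) ∧ ContDiffOn ℝ ∞ (bw1 h) (cyl a b) := by
  obtain ⟨a1, a2, a3, -⟩ := contDiffOn_chol hh hp
  have hc : ∀ {f : 𝔼 2 × ℝ → ℝ}, ContDiffOn ℝ ∞ f (slab a b) →
      ContDiffOn ℝ ∞ (fun y => f (circ y)) (cyl a b) := fun hf =>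
    hf.comp contDiff_circ.contDiffOn fun _ hy => circ_mem hy
  have hs : ContDiffOn ℝ ∞ (fun y : ℝ × ℝ => Real.sin y.1) (cyl a b) := by fun_prop
  have hco : ContDiffOn ℝ ∞ (fun y : ℝ × ℝ => Real.cos y.1) (cyl a b) := by fun_prop
  exact ⟨(hs.neg.mul (hc a1)).add (hco.mul (hc a2)), hco.mul (hc a3)⟩

lemma contDiffOn_bl (hh : ∀ k l, ContDiffOn ℝ ∞ (h k l) (slab a b)) (hp : IsPosDefOn (slab a b) h) :
    ContDiffOn ℝ ∞ (bl h) (cyl a b) := by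
  obtain ⟨h0, h1⟩ := contDiffOn_bw hh hp
  exact ((h0.pow 2).add (h1.pow 2)).sqrt fun y hy => (bw_sq_pos hp hy).ne'

lemma contDiffOn_be (hh : ∀ k l, ContDiffOn ℝ ∞ (h k l) (slab a b)) (hp : IsPosDefOn (slab a b) h) :
    ContDiffOn ℝ ∞ (be0 h) (cyl a b) ∧ ContDiffOn ℝ ∞ (be1 h) (cyl a b) := by
  obtain ⟨h0, h1⟩ := contDiffOn_bw hh hp
  have h2 := contDiffOn_bl hh hp
  exact ⟨h0.div h2 fun y hy => (bl_pos hp hy).ne', h1.div h2 fun y hy => (bl_pos hp hy).ne'⟩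

/-- A unit vector `x` orthogonal to the boundary curve, with a given third component and outward
first two components. -/
lemma outward_components {x0 x1 C s e0 e1 A D : ℝ} (he : e0 ^ 2 + e1 ^ 2 = 1) (hs : 0 < s)
    (hC : C ^ 2 + s ^ 2 = 1) (hx : x0 ^ 2 + x1 ^ 2 + C ^ 2 = 1) (hxe : x0 * e0 + x1 * e1 = 0)
    (hd : 0 ≤ A * x0 + D * x1) (hd' : 0 < A * e1 - D * e0) : x0 = s * e1 ∧ x1 = -(s * e0) := by
  set μ := x0 * e1 - x1 * e0 with hμ
  have h0 : x0 = μ * e1 := by rw [hμ]; linear_combination (-x0) * he + e0 * hxe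
  have h1 : x1 = -(μ * e0) := by rw [hμ]; linear_combination (-x1) * he + e1 * hxe
  have h2 : μ ^ 2 = s ^ 2 := by rw [hμ]; linear_combination -(x0 * e0 + x1 * e1) * hxe + hx - hC
    + (x0 ^ 2 + x1 ^ 2) * he
  have h3 : 0 ≤ μ := by
    rw [h0, h1] at hd
    have : 0 ≤ μ * (A * e1 - D * e0) := by linarith
    exact nonneg_of_mul_nonneg_left this hd'
  have h4 : μ = s := (pow_left_inj₀ h3 hs.le two_ne_zero).1 h2
  rw [← h4]; exact ⟨h0, h1⟩

end Frame

variable {M : Type*} [TopologicalSpace M] [ChartedSpace (EuclideanHalfSpace 3) M]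
  [IsManifold (𝓡∂ 3) ∞ M]

/-- The outward normal field, with the tangent spaces read as `𝔼 3`. -/
def outerVec (X : ∀ p : M, TangentSpace (𝓡∂ 3) p) (p : M) : 𝔼 3 := X p

variable {g : Metric3 M} {X : ∀ p : M, TangentSpace (𝓡∂ 3) p} {tm tp : ℝ} {r : ℝ → ℝ}
  {j : M → 𝔼 3} {a b : ℝ} {ψ : 𝔼 2 × ℝ → M} {N : ∀ z, TangentSpace (𝓡∂ 3) (ψ z)} {H : ℝ → ℝ}

/-- The components of the outward normal in the frame, along the boundary curves. -/
def outerComp (h : Fin 3 → Fin 3 → 𝔼 2 × ℝ → ℝ) (r : ℝ → ℝ) (j : M → 𝔼 3) (ψ : 𝔼 2 × ℝ → M)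
    (i : Fin 3) (y : ℝ × ℝ) : ℝ :=
  ![sinA r (j (bdryMap ψ y) 2) * be1 h y, -(sinA r (j (bdryMap ψ y) 2) * be0 h y),
    cosA r (j (bdryMap ψ y) 2)] i

namespace IsCMCCapillaryFoliation

variable (hψ : IsCMCCapillaryFoliation g X tm tp r j a b ψ N H) {y : ℝ × ℝ}
  (hX : ∀ p ∈ (𝓡∂ 3).boundary M, IsOutwardUnitNormal g p (X p))
include hψ hX

lemma outer_perp (hy : y ∈ cyl a b) {w : 𝔼 3} (hw : w 0 = 0) :
    met g (bdryMap ψ y) w (outerVec X (bdryMap ψ y)) = 0 := by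
  rw [met_symm]
  refine (hX _ (hψ.bdryMap_mem hy)).2.1 w ?_
  rw [coords_eq]; exact hw

lemma inner_outer_slabFrame (hy : y ∈ cyl a b) (i : Fin 3) :
    met g (bdryMap ψ y) (outerVec X (bdryMap ψ y)) (slabFrame g a b ψ i (circ y))
      = outerComp (slabMetric g a b ψ) r j ψ i y := by
  set h := slabMetric g a b ψ with hh
  set Y := outerVec X (bdryMap ψ y) with hYdef
  have hpd : IsPosDefOn (slab a b) h := hψ.posDef
  have hz := circ_mem hy
  have hP := chP_pos hpd hz
  have hR := chR_pos hpd hz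
  have hl := bl_pos hpd hy
  obtain ⟨hu, -, hneg⟩ := hX _ (hψ.bdryMap_mem hy)
  replace hu : met g (bdryMap ψ y) Y Y = 1 := hu
  replace hneg : Y 0 < 0 := by
    have e1 : coords (bdryMap ψ y) Y = Y := coords_eq _ Y
    have e2 : coords (bdryMap ψ y) Y 0 < 0 := hneg
    rwa [e1] at e2
  set x : Fin 3 → ℝ := fun i => met g (bdryMap ψ y) Y (slabFrame g a b ψ i (circ y)) with hx
  have hon := orthonormal_inner (met g (bdryMap ψ y)) (fun i => slabFrame g a b ψ i (circ y))
    (hψ.inner_slabFrame hz)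
  have hx2 : x 2 = cosA r (j (bdryMap ψ y) 2) := by
    have h1 : met g (bdryMap ψ y) Y (normalVec N (circ y))
        = Real.cos (modelAngle r (j (bdryMap ψ y))) := hψ.angle y.2 hy.2 _ (circlePt_mem_sphere y.1)
    rw [(hψ.normal_eq hz).1, cos_modelAngle] at h1
    exact h1
  have hunit : x 0 ^ 2 + x 1 ^ 2 + cosA r (j (bdryMap ψ y) 2) ^ 2 = 1 := by
    rw [hon Y Y, Fin.sum_univ_three] at hu
    rw [← hx2]
    simp only [hx]
    linarith
  have htan : x 0 * be0 h y + x 1 * be1 h y = 0 := by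
    have h1 := hψ.outer_perp hX hy (dm_component_zero (isOpen_cyl a b).uniqueDiffOn
      hψ.contMDiffOn_bdryMap (fun y hy => hψ.bdryMap_mem hy) hy (1, 0))
    rw [hon] at h1
    obtain ⟨t0, t1, t2⟩ := tanComp_eq hpd hy (1, 0)
    obtain ⟨w0, w1⟩ := bw_eq hpd hy
    simp only [hψ.inner_dm_bdryMap hy, Fin.sum_univ_three, ← hh, ← hYdef, t0, t1, t2, w0, w1]
      at h1
    have h2 : bl h y * (x 0 * be0 h y + x 1 * be1 h y) = 0 := by
      rw [← h1]; simp only [hx]; ring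
    exact (mul_eq_zero.1 h2).resolve_left hl.ne'
  have hin : 0 ≤ (Real.cos y.1 * chP h (circ y) + Real.sin y.1 * chQ h (circ y)) * x 0
      + Real.sin y.1 * chR h (circ y) * x 1 := by
    set η : 𝔼 2 × ℝ := (-circlePt y.1, 0) with hη
    have hseg : segment ℝ (circ y) (circ y + η) ⊆ slab a b := by
      refine (convex_disk.prod (convex_Ioo a b)).segment_subset hz ?_
      simp only [hη, circ, Prod.mk_add_mk, add_neg_cancel, add_zero]
      exact ⟨by simp [disk], hy.2⟩
    have h1 := dm_component_nonneg (uniqueDiffOn_slab a b) hψ.smooth hz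
      (hψ.bdryMap_mem hy) hseg
    set w := dm (slab a b) ψ (circ y) η with hw
    have h2 : met g (bdryMap ψ y) Y w = w 0 / Y 0 := by
      have h3 := hψ.outer_perp hX hy (w := w - (w 0 / Y 0) • Y) (by
        simp only [PiLp.sub_apply, PiLp.smul_apply, smul_eq_mul]
        rw [div_mul_cancel₀ _ hneg.ne, sub_self])
      rw [met_symm, map_sub, map_smul, smul_eq_mul] at h3
      change met g (bdryMap ψ y) Y w - w 0 / Y 0 * met g (bdryMap ψ y) Y Y = 0 at h3
      rw [hu] at h3
      linarith
    have h4 : met g (bdryMap ψ y) Y w ≤ 0 := by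
      rw [h2]; exact div_nonpos_of_nonneg_of_nonpos h1 hneg.le
    have h5 : w = -(Real.cos y.1 • dm (slab a b) ψ (circ y) (slabDir 0)
        + Real.sin y.1 • dm (slab a b) ψ (circ y) (slabDir 1)) := by
      rw [hw, ← map_smul, ← map_smul, ← map_add, ← map_neg]
      congr 1
      refine Prod.ext ?_ ?_
      · ext i; fin_cases i <;> simp [hη, circlePt, slabDir, vec]
      · simp [hη, slabDir]
    have h6 : ∀ k, met g (bdryMap ψ y) Y (dm (slab a b) ψ (circ y) (slabDir k))
        = ∑ i, x i * coframe h (cholC h) k i (circ y) := by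
      intro k
      rw [hon]
      refine Finset.sum_congr rfl fun i _ => ?_
      rw [← inner_dm_slabFrame (g := g) (a := a) (b := b) (ψ := ψ)]
      rfl
    rw [h5, map_neg, map_add, map_smul, map_smul, h6, h6] at h4
    simp only [coframe_chol hpd hz, Fin.sum_univ_three] at h4
    simp at h4
    linarith
  have hdet : 0 < (Real.cos y.1 * chP h (circ y) + Real.sin y.1 * chQ h (circ y)) * be1 h y
      - Real.sin y.1 * chR h (circ y) * be0 h y := by
    have : (Real.cos y.1 * chP h (circ y) + Real.sin y.1 * chQ h (circ y)) * be1 h y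
      - Real.sin y.1 * chR h (circ y) * be0 h y = chP h (circ y) * chR h (circ y) / bl h y := by
      rw [be0, be1, bw0, bw1]
      field_simp
      linear_combination chP h (circ y) * Real.sin_sq_add_cos_sq y.1
    rw [this]
    positivity
  obtain ⟨r0, r1⟩ := outward_components (be_sq hpd hy) (sinA_pos r (j (bdryMap ψ y) 2))
    (cosA_sq_add_sinA_sq r _) hunit htan hin hdet
  fin_cases i
  · exact r0
  · exact r1
  · exact hx2

lemma outer_eq (hy : y ∈ cyl a b) : outerVec X (bdryMap ψ y)
    = ∑ i, outerComp (slabMetric g a b ψ) r j ψ i y • slabFrame g a b ψ i (circ y) := by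
  have h1 := orthonormal_expand (met g (bdryMap ψ y)) (fun i => slabFrame g a b ψ i (circ y))
    (hψ.inner_slabFrame (circ_mem hy)) (outerVec X (bdryMap ψ y))
  simp only [hψ.inner_outer_slabFrame hX hy] at h1
  exact h1.symm

lemma tanComp_perp (hy : y ∈ cyl a b) (ζ : ℝ × ℝ) :
    ∑ i, tanComp (slabMetric g a b ψ) y ζ i * outerComp (slabMetric g a b ψ) r j ψ i y = 0 := by
  have h1 := hψ.outer_perp hX hy (dm_component_zero (isOpen_cyl a b).uniqueDiffOn
    hψ.contMDiffOn_bdryMap (fun y hy => hψ.bdryMap_mem hy) hy ζ)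
  rw [orthonormal_inner (met g (bdryMap ψ y)) (fun i => slabFrame g a b ψ i (circ y))
    (hψ.inner_slabFrame (circ_mem hy))] at h1
  simpa only [hψ.inner_dm_bdryMap hy, hψ.inner_outer_slabFrame hX hy] using h1

end IsCMCCapillaryFoliation

end BoundaryNormal

/-! ### Comparison with the model along the boundary curves -/

section Comparison

/-- The angular speed about the axis of `𝔼 3`, in the direction `ξ`, of a map `q`. -/
def angRate (q : ℝ × ℝ → 𝔼 3) (y ξ : ℝ × ℝ) : ℝ :=
  (q y 0 * fderiv ℝ q y ξ 1 - q y 1 * fderiv ℝ q y ξ 0) / (q y 0 ^ 2 + q y 1 ^ 2)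

/-- The differential of a lift, in terms of the map into the model surface. -/
lemma lift_components {tm tp : ℝ} {r : ℝ → ℝ} (hr : IsProfile tm tp r) {q : ℝ × ℝ → 𝔼 3}
    {β : ℝ × ℝ → 𝔼 2} {y : ℝ × ℝ} (hβ : ContDiffAt ℝ ∞ β y)
    (hs : β y ∈ strip tm tp) (hq : q =ᶠ[𝓝 y] fun y' => modelSurface r (β y'))
    (ξ : ℝ × ℝ) : q y 2 = β y 1 ∧ fderiv ℝ (q) y ξ 2 = fderiv ℝ β y ξ 1 ∧
      angRate (q) y ξ = fderiv ℝ β y ξ 0 := by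
  have h0 : q y = modelSurface r (β y) := hq.self_of_nhds
  have hopen := isOpen_strip tm tp
  have h1 : DifferentiableAt ℝ (modelSurface r) (β y) :=
    (hr.contDiffOn_modelSurface.contDiffAt (hopen.mem_nhds hs)).differentiableAt (by simp)
  have h2 : fderiv ℝ (q) y ξ
      = fderivWithin ℝ (modelSurface r) (strip tm tp) (β y) (fderiv ℝ β y ξ) := by
    rw [hq.fderiv_eq, fderivWithin_of_isOpen hopen hs]
    exact congrArg (fun L : ℝ × ℝ →L[ℝ] 𝔼 3 => L ξ)
      (fderiv_comp y h1 (hβ.differentiableAt (by simp)))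
  rw [hr.fderivWithin_modelSurface hs] at h2
  have hpos := hr.pos _ hs
  refine ⟨by rw [h0]; rfl, by rw [h2]; rfl, ?_⟩
  rw [angRate, h0, h2]
  simp only [modelSurface, PiLp.toLp_apply, Matrix.cons_val_zero, Matrix.cons_val_one]
  have hsc := Real.sin_sq_add_cos_sq (β y 0)
  have hden : (r (β y 1) * Real.cos (β y 0)) ^ 2 + (r (β y 1) * Real.sin (β y 0)) ^ 2
      = r (β y 1) ^ 2 := by linear_combination r (β y 1) ^ 2 * hsc
  rw [hden]
  field_simp
  linear_combination r (β y 1) * (fderiv ℝ β y ξ) 0 * hsc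

variable {M : Type*} [TopologicalSpace M] [ChartedSpace (EuclideanHalfSpace 3) M]
  [IsManifold (𝓡∂ 3) ∞ M]
  {g : Metric3 M} {X : ∀ p : M, TangentSpace (𝓡∂ 3) p} {tm tp : ℝ} {r : ℝ → ℝ}
  {j : M → 𝔼 3} {B : 𝔼 2 → M} {a b : ℝ} {ψ : 𝔼 2 × ℝ → M} {N : ∀ z, TangentSpace (𝓡∂ 3) (ψ z)}
  {H : ℝ → ℝ}

/-- The boundary curves, as curves on the model surface. -/
def modelCurve (j : M → 𝔼 3) (ψ : 𝔼 2 × ℝ → M) (y : ℝ × ℝ) : 𝔼 3 := j (bdryMap ψ y)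

namespace IsCMCCapillaryFoliation

variable (hψ : IsCMCCapillaryFoliation g X tm tp r j a b ψ N H) {y : ℝ × ℝ}
  (hB : IsBoundaryIdentification tm tp r j B)
include hψ hB

lemma exists_lift_bdryMap (hy : y ∈ cyl a b) : ∃ β : ℝ × ℝ → 𝔼 2, ContDiffAt ℝ ∞ β y ∧
    β y ∈ strip tm tp ∧ B (β y) = bdryMap ψ y ∧
    (modelCurve j ψ =ᶠ[𝓝 y] fun y' => modelSurface r (β y')) ∧
    ∀ ξ, dm (strip tm tp) B (β y) (fderiv ℝ β y ξ) = dm (cyl a b) (bdryMap ψ) y ξ := by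
  obtain ⟨β, hβ, hev⟩ := exists_lift hB (isOpen_cyl a b) hψ.contMDiffOn_bdryMap
    (fun y hy => hψ.bdryMap_mem hy) hy
  obtain ⟨hs, hBy⟩ := hev.self_of_nhds
  refine ⟨β, hβ, hs, hBy, ?_, fun ξ => ?_⟩
  · filter_upwards [hev] with y' hy'
    rw [modelCurve, ← hy'.2, hB.comp _ hy'.1]
  · have hopen := isOpen_strip tm tp
    have hBd : MDifferentiableAt 𝓘(ℝ, 𝔼 2) (𝓡∂ 3) B (β y) :=
      ((hB.smooth (β y) hs).contMDiffAt (hopen.mem_nhds hs)).mdifferentiableAt (by simp)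
    have hβd := (hβ.differentiableAt (by simp)).mdifferentiableAt
    have h1 := mfderiv_comp (I := 𝓘(ℝ, ℝ × ℝ)) (I' := 𝓘(ℝ, 𝔼 2)) (I'' := 𝓡∂ 3) y hBd hβd
    have h2 : (fun y => B (β y)) =ᶠ[𝓝 y] bdryMap ψ := by
      filter_upwards [hev] with y' hy' using hy'.2
    have h3 : mfderiv 𝓘(ℝ, ℝ × ℝ) (𝓡∂ 3) (fun y => B (β y)) y
        = mfderiv 𝓘(ℝ, ℝ × ℝ) (𝓡∂ 3) (bdryMap ψ) y := h2.mfderiv_eq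
    have e1 : dm (strip tm tp) B (β y) = mfderiv 𝓘(ℝ, 𝔼 2) (𝓡∂ 3) B (β y) :=
      mfderivWithin_of_mem_nhds (hopen.mem_nhds hs)
    have e2 : dm (cyl a b) (bdryMap ψ) y = mfderiv 𝓘(ℝ, ℝ × ℝ) (𝓡∂ 3) (bdryMap ψ) y :=
      mfderivWithin_of_mem_nhds ((isOpen_cyl a b).mem_nhds hy)
    rw [mfderiv_eq_fderiv] at h1
    have h4 := congrArg (fun L : ℝ × ℝ →L[ℝ] 𝔼 3 => L ξ) (h3.symm.trans h1)
    rw [e1, e2]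
    exact h4.symm

lemma contDiffAt_modelCurve (hr : IsProfile tm tp r) (hy : y ∈ cyl a b) :
    ContDiffAt ℝ ∞ (modelCurve j ψ) y := by
  obtain ⟨β, hβ, hs, -, hq, -⟩ := hψ.exists_lift_bdryMap hB hy
  have h1 : ContDiffAt ℝ ∞ (modelSurface r) (β y) :=
    hr.contDiffOn_modelSurface.contDiffAt ((isOpen_strip tm tp).mem_nhds hs)
  exact (h1.comp y hβ).congr_of_eventuallyEq hq

lemma modelCurve_mem (hy : y ∈ cyl a b) : ∃ x ∈ strip tm tp, modelCurve j ψ y = modelSurface r x := by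
  obtain ⟨β, hβ, hs, -, hq, -⟩ := hψ.exists_lift_bdryMap hB hy
  exact ⟨β y, hs, hq.self_of_nhds⟩

lemma height_mem (hy : y ∈ cyl a b) : modelCurve j ψ y 2 ∈ Ioo tm tp := by
  obtain ⟨x, hx, h⟩ := hψ.modelCurve_mem hB hy
  rw [h]; exact hx

lemma modelCurve_sq (hy : y ∈ cyl a b) :
    modelCurve j ψ y 0 ^ 2 + modelCurve j ψ y 1 ^ 2 = r (modelCurve j ψ y 2) ^ 2 := by
  obtain ⟨x, hx, h⟩ := hψ.modelCurve_mem hB hy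
  rw [h]
  simp only [modelSurface, PiLp.toLp_apply, Matrix.cons_val_zero, Matrix.cons_val_one,
    Matrix.cons_val]
  linear_combination r (x 1) ^ 2 * Real.sin_sq_add_cos_sq (x 0)

/-- The comparison of the metrics, for tangent vectors of the boundary curves. -/
lemma metric_comparison (hr : IsProfile tm tp r) (hσ : MetricComparison g tm tp r B)
    (hy : y ∈ cyl a b) (ξ : ℝ × ℝ) :
    r (modelCurve j ψ y 2) ^ 2 * angRate (modelCurve j ψ) y ξ ^ 2
      + fderiv ℝ (modelCurve j ψ) y ξ 2 ^ 2 / sinA r (modelCurve j ψ y 2) ^ 2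
      ≤ ∑ i, tanComp (slabMetric g a b ψ) y ξ i ^ 2 := by
  obtain ⟨β, hβ, hs, hBy, hq, hd⟩ := hψ.exists_lift_bdryMap hB hy
  obtain ⟨c1, c2, c3⟩ := lift_components hr hβ hs hq ξ
  have h1 := hσ (β y) hs (fderiv ℝ β y ξ)
  rw [hr.norm_sq_fderivWithin_modelSurface hs] at h1
  have h2 : met g (B (β y)) (dm (strip tm tp) B (β y) (fderiv ℝ β y ξ))
      (dm (strip tm tp) B (β y) (fderiv ℝ β y ξ)) = ∑ i, tanComp (slabMetric g a b ψ) y ξ i ^ 2 := by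
    rw [hBy, hd, orthonormal_inner (met g (bdryMap ψ y)) (fun i => slabFrame g a b ψ i (circ y))
      (hψ.inner_slabFrame (circ_mem hy))]
    simp only [hψ.inner_dm_bdryMap hy, sq]
  rw [c1, c2, c3, ← h2]
  refine le_trans (le_of_eq ?_) h1
  have h3 : sinA r (β y 1) ^ 2 = 1 / (1 + deriv r (β y 1) ^ 2) := by
    rw [sinA, div_pow, Real.sq_sqrt (by positivity), one_pow]
  rw [h3]
  field_simp

/-- The comparison of the mean curvatures, along the boundary curves. -/
lemma mean_comparison (hr : IsProfile tm tp r)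
    (hX : ∀ p ∈ (𝓡∂ 3).boundary M, IsOutwardUnitNormal g p (X p))
    (hH : MeanCurvatureComparison g X tm tp r B) (hy : y ∈ cyl a b) (ζ : Fin 2 → ℝ × ℝ)
    (hζ : ∀ k l, ∑ i, tanComp (slabMetric g a b ψ) y (ζ k) i * tanComp (slabMetric g a b ψ) y (ζ l) i
      = if k = l then 1 else 0) :
    sinA r (modelCurve j ψ y 2) / r (modelCurve j ψ y 2)
        - angleRate r (modelCurve j ψ y 2) * sinA r (modelCurve j ψ y 2)
      ≤ ∑ k, sff g (bdryMap ψ y) (outerVec X (bdryMap ψ y)) (dm (cyl a b) (bdryMap ψ) y (ζ k))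
        (dm (cyl a b) (bdryMap ψ) y (ζ k)) := by
  obtain ⟨β, hβ, hs, hBy, hq, hd⟩ := hψ.exists_lift_bdryMap hB hy
  obtain ⟨c1, -, -⟩ := lift_components hr hβ hs hq 0
  have h1 := hH (β y) hs
  rw [hr.modelMeanCurvature_eq hs, ← c1] at h1
  refine h1.trans (le_of_eq ?_)
  have hperp : ∀ w : 𝔼 3, w 0 = 0 → met g (B (β y)) w (outerVec X (B (β y))) = 0 := by
    intro w hw
    rw [hBy]; exact hψ.outer_perp hX hy hw
  have h2 := meanCurvature_boundary g hB hs hperp (fun k => fderiv ℝ β y (ζ k)) (by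
    intro k l
    rw [hd, hd, hBy, ← hζ k l, orthonormal_inner (met g (bdryMap ψ y))
      (fun i => slabFrame g a b ψ i (circ y)) (hψ.inner_slabFrame (circ_mem hy))]
    simp only [hψ.inner_dm_bdryMap hy])
  refine Eq.trans (b := ∑ k, sff g (B (β y)) (outerVec X (B (β y)))
    (dm (strip tm tp) B (β y) (fderiv ℝ β y (ζ k)))
    (dm (strip tm tp) B (β y) (fderiv ℝ β y (ζ k)))) h2 ?_
  simp only [hd, hBy]

end IsCMCCapillaryFoliation

end Comparison

/-! ### The flux through the boundary curves -/

section BoundaryFlux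

/-- The pointwise algebra behind the boundary inequality. Here `(e0, e1)` is the unit tangent of
`∂Σ_t`, `ℓ` the length element, `C` and `s` the cosine and the sine of the contact angle, `k` the
derivative of the angle with respect to the height, `A` the second fundamental form of the leaf, `v`
the speed, `(S, U)` the tangential part of `∂ₜ` with components `f` along `e` and `m` along the
conormal, `(b0, b1)` the components of `∇ₜN`, and `w`, `w2` the connection form of the leaf. The
letters `p`, `s` and `x` followed by `a` or `t` are the derivatives, with respect to the angle and to
the time, of the direction of `e`, of the height, and of the components of the outward normal.
`II1` and `II2` are the values of the second fundamental form of `∂M` on the orthonormal basis `e`,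
`η = sin γ̄ N - cos γ̄ ν`. The left-hand side is the flux. -/
lemma boundary_algebra {ℓ v C s k e0 e1 f A00 A01 A11 w w2 b0 b1 pa pt sa st : ℝ}
    (he : e0 ^ 2 + e1 ^ 2 = 1) (hC : C ^ 2 + s ^ 2 = 1) (hs : s ≠ 0) (hl : ℓ ≠ 0) (hv : v ≠ 0)
    {S U II1 II2 m : ℝ} (hm : m = -C * v / s) (hS : S = f * e0 + m * e1) (hU : U = f * e1 - m * e0)
    {x0a x1a x2a x0t x1t x2t : ℝ}
    (h0a : x0a = C * k * sa * e1 + s * (e0 * pa))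
    (h1a : x1a = -(C * k * sa * e0 + s * (-e1 * pa)))
    (h2a : x2a = - s * k * sa)
    (h0t : x0t = C * k * st * e1 + s * (e0 * pt))
    (h1t : x1t = -(C * k * st * e0 + s * (-e1 * pt)))
    (h2t : x2t = - s * k * st)
    (h1 : II1 = e0 / ℓ * (x0a + -s * e0 * w + C * (ℓ * (e0 * A00 + e1 * A01)))
      + e1 / ℓ * (x1a - s * e1 * w + C * (ℓ * (e0 * A01 + e1 * A11))))
    (h2 : II2 = -C * e1 * (s / v) * (x0t + -s * e0 * w2 + C * b0 
          - f / ℓ * (x0a + -s * e0 * w + C * (ℓ * (e0 * A00 + e1 * A01))))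
      + C * e0 * (s / v) * (x1t - s * e1 * w2 + C * b1
          - f / ℓ * (x1a - s * e1 * w + C * (ℓ * (e0 * A01 + e1 * A11))))
      + s * (s / v) * (x2t - s * e1 * b0 + s * e0 * b1
          - f / ℓ * (x2a - s * e1 * (ℓ * (e0 * A00 + e1 * A01))
            + s * e0 * (ℓ * (e0 * A01 + e1 * A11))))) :
    ℓ / v * ((b0 - S * A00 - U * A01) * e1 - (b1 - S * A01 - U * A11) * e0) + w
      = pa + ℓ / s * (C * (A00 + A11) - (II1 + II2) - k * (s / v * (st - f / ℓ * sa))) := by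
  have g1 : II1 = s * (pa - w) / ℓ + C * (e0 ^ 2 * A00 + 2 * e0 * e1 * A01 + e1 ^ 2 * A11) := by
    rw [h1, h0a, h1a]
    field_simp
    linear_combination (s * (pa - w)) * he
  have g2 : II2 = (s / v) * (-k * (st - f / ℓ * sa)
     - (e1 * b0 - e0 * b1) + f * (e1 * (e0 * A00 + e1 * A01) - e0 * (e0 * A01 + e1 * A11))) := by
    rw [h2, h0a, h1a, h2a, h0t, h1t, h2t]
    field_simp
    linear_combination (-C ^ 2 * k * (ℓ * st - f * sa)) * he
      + (-k * (ℓ * st - f * sa) - (ℓ * (e1 * b0 - e0 * b1))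
        + ℓ * f * (e1 * (e0 * A00 + e1 * A01) - e0 * (e0 * A01 + e1 * A11))) * hC
  rw [g1, g2, hS, hU, hm]
  field_simp
  linear_combination (C * (A00 + A11) * ℓ * v) * he

/-- The rate of rotation of the unit tangent vector of the boundary curves in the frame. -/
def turn (h : Fin 3 → Fin 3 → 𝔼 2 × ℝ → ℝ) (y : ℝ × ℝ) : ℝ :=
  be0 h y * fderiv ℝ (be1 h) y (1, 0) - be1 h y * fderiv ℝ (be0 h) y (1, 0)

/-- A unit vector in the plane, at each point of an open set, moves by rotation. -/
lemma fderiv_be {a b : ℝ} {h : Fin 3 → Fin 3 → 𝔼 2 × ℝ → ℝ} {y : ℝ × ℝ}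
    (hh : ∀ k l, ContDiffOn ℝ ∞ (h k l) (slab a b)) (hp : IsPosDefOn (slab a b) h)
    (hy : y ∈ cyl a b) (ξ : ℝ × ℝ) :
    DifferentiableAt ℝ (be0 h) y ∧ DifferentiableAt ℝ (be1 h) y ∧
    fderiv ℝ (be0 h) y ξ = -be1 h y * (be0 h y * fderiv ℝ (be1 h) y ξ
      - be1 h y * fderiv ℝ (be0 h) y ξ) ∧
    fderiv ℝ (be1 h) y ξ = be0 h y * (be0 h y * fderiv ℝ (be1 h) y ξ
      - be1 h y * fderiv ℝ (be0 h) y ξ) := by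
  obtain ⟨h0, h1⟩ := contDiffOn_be hh hp
  have hn := (isOpen_cyl a b).mem_nhds hy
  have d0 : DifferentiableAt ℝ (be0 h) y := (h0.contDiffAt hn).differentiableAt (by simp)
  have d1 : DifferentiableAt ℝ (be1 h) y := (h1.contDiffAt hn).differentiableAt (by simp)
  have h2 : (fun y => be0 h y ^ 2 + be1 h y ^ 2) =ᶠ[𝓝 y] fun _ => (1 : ℝ) := by
    filter_upwards [hn] with y' hy' using be_sq hp hy'
  have h3 : 2 * be0 h y * fderiv ℝ (be0 h) y ξ + 2 * be1 h y * fderiv ℝ (be1 h) y ξ = 0 := by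
    have h4 := HasFDerivAt.fderiv ((d0.hasFDerivAt.pow 2).add (d1.hasFDerivAt.pow 2))
    have h5 := h2.fderiv_eq (𝕜 := ℝ)
    rw [fderiv_const_apply] at h5
    have h6 := congrArg (fun L : ℝ × ℝ →L[ℝ] ℝ => L ξ) (h4.symm.trans h5)
    simpa [mul_assoc] using h6
  have h7 := be_sq hp hy
  refine ⟨d0, d1, ?_, ?_⟩
  · linear_combination (-fderiv ℝ (be0 h) y ξ) * h7 + be0 h y / 2 * h3
  · linear_combination (-fderiv ℝ (be1 h) y ξ) * h7 + be1 h y / 2 * h3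

variable {M : Type*} [TopologicalSpace M] [ChartedSpace (EuclideanHalfSpace 3) M]
  [IsManifold (𝓡∂ 3) ∞ M]
  {g : Metric3 M} {X : ∀ p : M, TangentSpace (𝓡∂ 3) p} {tm tp : ℝ} {r : ℝ → ℝ}
  {j : M → 𝔼 3} {B : 𝔼 2 → M} {a b : ℝ} {ψ : 𝔼 2 × ℝ → M} {N : ∀ z, TangentSpace (𝓡∂ 3) (ψ z)}
  {H : ℝ → ℝ}

namespace IsCMCCapillaryFoliation

variable (hψ : IsCMCCapillaryFoliation g X tm tp r j a b ψ N H) {y : ℝ × ℝ}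
  (hB : IsBoundaryIdentification tm tp r j B)
include hψ hB

/-- The derivatives of the components of the outward normal. -/
lemma fderiv_outerComp (hr : IsProfile tm tp r) (hy : y ∈ cyl a b) (ξ : ℝ × ℝ) :
    let h := slabMetric g a b ψ
    let s := modelCurve j ψ y 2
    let ds := fderiv ℝ (modelCurve j ψ) y ξ 2
    let p := be0 h y * fderiv ℝ (be1 h) y ξ - be1 h y * fderiv ℝ (be0 h) y ξ
    (∀ i, DifferentiableAt ℝ (outerComp h r j ψ i) y) ∧
    fderiv ℝ (outerComp h r j ψ 0) y ξ
      = cosA r s * angleRate r s * ds * be1 h y + sinA r s * (be0 h y * p) ∧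
    fderiv ℝ (outerComp h r j ψ 1) y ξ
      = -(cosA r s * angleRate r s * ds * be0 h y + sinA r s * (-be1 h y * p)) ∧
    fderiv ℝ (outerComp h r j ψ 2) y ξ = -sinA r s * angleRate r s * ds := by
  intro h s ds p
  obtain ⟨d0, d1, e0, e1⟩ := fderiv_be (h := h) hψ.isMovingFrame.smooth hψ.posDef hy ξ
  have hq := (hψ.contDiffAt_modelCurve hB hr hy).differentiableAt (by simp)
  have hs : HasFDerivAt (fun y => modelCurve j ψ y 2)
      ((EuclideanSpace.proj (2 : Fin 3) : 𝔼 3 →L[ℝ] ℝ).comp (fderiv ℝ (modelCurve j ψ) y)) y :=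
    (EuclideanSpace.proj (2 : Fin 3) : 𝔼 3 →L[ℝ] ℝ).hasFDerivAt.comp y hq.hasFDerivAt
  have hmem := hψ.height_mem hB hy
  have hc := (hr.hasDerivAt_cosA hmem).comp_hasFDerivAt y hs
  have hsn := (hr.hasDerivAt_sinA hmem).comp_hasFDerivAt y hs
  have x0 : HasFDerivAt (outerComp h r j ψ 0) _ y := hsn.mul d1.hasFDerivAt
  have x1 : HasFDerivAt (outerComp h r j ψ 1) _ y := (hsn.mul d0.hasFDerivAt).neg
  have x2 : HasFDerivAt (outerComp h r j ψ 2) _ y := hc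
  refine ⟨?_, ?_, ?_, ?_⟩
  · intro i
    fin_cases i
    exacts [x0.differentiableAt, x1.differentiableAt, x2.differentiableAt]
  · rw [x0.fderiv, ← e1]
    simp [s, ds]; ring
  · rw [x1.fderiv, ← e0]
    simp [s, ds]; ring
  · rw [x2.fderiv]
    simp [s, ds]

set_option maxHeartbeats 1000000 in
/-- The flux through the boundary curves: the boundary inequality at a point. -/
lemma flux_le (hr : IsProfile tm tp r)
    (hX : ∀ p ∈ (𝓡∂ 3).boundary M, IsOutwardUnitNormal g p (X p))
    (hσ : MetricComparison g tm tp r B) (hH : MeanCurvatureComparison g X tm tp r B)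
    (hy : y ∈ cyl a b) :
    flux0 (slab a b) slabDir (slabMetric g a b ψ) (circ y) * Real.cos y.1
      + flux1 (slab a b) slabDir (slabMetric g a b ψ) (circ y) * Real.sin y.1
    ≤ turn (slabMetric g a b ψ) y + bl (slabMetric g a b ψ) y *
      (cosA r (modelCurve j ψ y 2) / sinA r (modelCurve j ψ y 2)) * H y.2
      - |angRate (modelCurve j ψ) y (1, 0)| := by
  have hM := hψ.isMovingFrame
  have hmc := hψ.mean_comparison hB hr hX hH hy
  have hme := hψ.metric_comparison hB hr hσ hy
  have hsf := hψ.sff_bdryMap hy (fun i => (hψ.fderiv_outerComp hB hr hy 0).1 i)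
    (Filter.eventually_of_mem ((isOpen_cyl a b).mem_nhds hy) fun y' hy' ζ =>
      hψ.tanComp_perp hX hy' ζ) (hψ.outer_eq hX hy) (fun w hw => hψ.outer_perp hX hy hw)
  have hpt := hψ.tanComp_perp hX hy (0, 1)
  have hdx := hψ.fderiv_outerComp hB hr hy
  have hmean := (hM.leafMean_eq (circ_mem hy)).symm.trans (hψ.leafMean_eq (circ_mem hy))
  have hk := hr.angleRate_nonpos (hψ.height_mem hB hy)
  have hrp := hr.pos _ (hψ.height_mem hB hy)
  set h := slabMetric g a b ψ with hh
  have hp : IsPosDefOn (slab a b) h := hψ.posDef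
  have hz := circ_mem hy
  have hP := chP_pos hp hz
  have hR := chR_pos hp hz
  have hV := chV_pos hp hz
  have hl := bl_pos hp hy
  have hs := sinA_pos r (modelCurve j ψ y 2)
  have hC := cosA_sq_add_sinA_sq r (modelCurve j ψ y 2)
  have he := be_sq hp hy
  obtain ⟨w0, w1⟩ := bw_eq hp hy
  have hT := tanComp_eq hp hy
  set s := sinA r (modelCurve j ψ y 2) with hsdef
  set C := cosA r (modelCurve j ψ y 2) with hCdef
  set k := angleRate r (modelCurve j ψ y 2) with hkdef
  set ℓ := bl h y with hℓ
  set e0 := be0 h y with he0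
  set e1 := be1 h y with he1
  have hx0 : outerComp h r j ψ 0 y = s * e1 := rfl
  have hx1 : outerComp h r j ψ 1 y = -(s * e0) := rfl
  have hx2 : outerComp h r j ψ 2 y = C := rfl
  set P := chP h (circ y) with hPd
  set Q := chQ h (circ y) with hQd
  set R := chR h (circ y) with hRd
  set S := chS h (circ y) with hSd
  set U := chU h (circ y) with hUd
  set V := chV h (circ y) with hVd
  set Ω : Fin 3 → Fin 3 → Fin 3 → ℝ :=
    fun k i j => conn (slab a b) slabDir h (cholC h) k i j (circ y) with hΩ
  have anti : ∀ k i j, Ω k i j = -Ω k j i := hM.antisymm _ hz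
  have self : ∀ k i, Ω k i i = 0 := fun k i => hM.conn_self hz k i
  have sym : Ω 1 2 0 = (Q * Ω 0 2 0 + R * Ω 0 2 1) / P := (hM.structure_scalars hz).2.2.1
  -- the second fundamental form of the leaf in the frame
  obtain ⟨A00, hA00⟩ : ∃ x, x = Ω 0 2 0 / P := ⟨_, rfl⟩
  obtain ⟨A01, hA01⟩ : ∃ x, x = Ω 0 2 1 / P := ⟨_, rfl⟩
  obtain ⟨A11, hA11⟩ : ∃ x, x = (Ω 1 2 1 - Q * A01) / R := ⟨_, rfl⟩
  have o1 : Ω 0 2 0 = P * A00 := by rw [hA00]; field_simp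
  have o2 : Ω 0 2 1 = P * A01 := by rw [hA01]; field_simp
  have o3 : Ω 1 2 1 = Q * A01 + R * A11 := by rw [hA11]; field_simp; ring
  have o4 : Ω 1 2 0 = Q * A00 + R * A01 := by rw [sym, hA00, hA01]; field_simp
  have hHm : A00 + A11 = H y.2 := by
    change (R * Ω 0 2 0 - Q * Ω 0 2 1 + P * Ω 1 2 1) / (P * R) = H y.2 at hmean
    rw [← hmean, o1, o2, o3]
    field_simp
    ring
  obtain ⟨w, hw⟩ : ∃ x, x = -Real.sin y.1 * Ω 0 1 0 + Real.cos y.1 * Ω 1 1 0 := ⟨_, rfl⟩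
  have cw : ∀ i l, connAlong a b h y (1, 0) i l
      = -Real.sin y.1 * Ω 0 i l + Real.cos y.1 * Ω 1 i l := by
    intro i l
    simp [connAlong, circCoef, Fin.sum_univ_three, hΩ]
  have ct : ∀ i l, connAlong a b h y (0, 1) i l = Ω 2 i l := by
    intro i l
    simp [connAlong, circCoef, Fin.sum_univ_three, hΩ]
  have b0 : bw0 h y = -Real.sin y.1 * P + Real.cos y.1 * Q := rfl
  have b1 : bw1 h y = Real.cos y.1 * R := rfl
  have c20 : -Real.sin y.1 * Ω 0 2 0 + Real.cos y.1 * Ω 1 2 0 = ℓ * (e0 * A00 + e1 * A01) := by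
    rw [o1, o4]; linear_combination A00 * (w0 - b0) + A01 * (w1 - b1)
  have c21 : -Real.sin y.1 * Ω 0 2 1 + Real.cos y.1 * Ω 1 2 1 = ℓ * (e0 * A01 + e1 * A11) := by
    rw [o2, o3]; linear_combination A01 * (w0 - b0) + A11 * (w1 - b1)
  have c01 : -Real.sin y.1 * Ω 0 0 1 + Real.cos y.1 * Ω 1 0 1 = -w := by
    rw [hw, anti 0 0 1, anti 1 0 1]; ring
  -- the components of `∂ₜ` along the unit tangent and the conormal of `∂Σ_t`
  obtain ⟨f, hf⟩ : ∃ x, x = S * e0 + U * e1 := ⟨_, rfl⟩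
  obtain ⟨m, hm⟩ : ∃ x, x = S * e1 - U * e0 := ⟨_, rfl⟩
  have hS : S = f * e0 + m * e1 := by rw [hf, hm]; linear_combination -S * he
  have hU : U = f * e1 - m * e0 := by rw [hf, hm]; linear_combination -U * he
  -- the boundary curves move within `∂M`, that is, `∂ₜ` is orthogonal to `X`
  have hm2 : m = -C * V / s := by
    obtain ⟨t0, t1, t2⟩ := hT (0, 1)
    rw [Fin.sum_univ_three, t0, t1, t2, hx0, hx1, hx2] at hpt
    rw [eq_div_iff hs.ne', hm]
    simp only [zero_mul, zero_add, one_mul] at hpt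
    linarith
  -- the directions of the orthonormal basis `e`, `η = sin γ̄ N - cos γ̄ ν` of the tangent plane of `∂M`
  set ζ : Fin 2 → ℝ × ℝ := ![(1 / ℓ, 0), (-(s / V * (f / ℓ)), s / V)] with hζ
  have z0 : tanComp h y (ζ 0) 0 = e0 ∧ tanComp h y (ζ 0) 1 = e1 ∧ tanComp h y (ζ 0) 2 = 0 := by
    obtain ⟨t0, t1, t2⟩ := hT (ζ 0)
    rw [t0, t1, t2, w0, w1]
    simp only [hζ, Matrix.cons_val_zero, zero_mul, add_zero]
    refine ⟨?_, ?_, trivial⟩ <;> field_simp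
  have z1 : tanComp h y (ζ 1) 0 = -C * e1 ∧ tanComp h y (ζ 1) 1 = C * e0 ∧
      tanComp h y (ζ 1) 2 = s := by
    obtain ⟨t0, t1, t2⟩ := hT (ζ 1)
    rw [t0, t1, t2, w0, w1]
    simp only [hζ, Matrix.cons_val_one, Matrix.cons_val_fin_one]
    rw [hS, hU, hm2]
    refine ⟨?_, ?_, ?_⟩ <;> field_simp <;> ring
  have hon : ∀ k l, ∑ i, tanComp h y (ζ k) i * tanComp h y (ζ l) i = if k = l then 1 else 0 := by
    have q00 : e0 * e0 + e1 * e1 + 0 * 0 = 1 := by linarith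
    have q01 : e0 * (-C * e1) + e1 * (C * e0) + 0 * s = 0 := by ring
    have q11 : -C * e1 * (-C * e1) + C * e0 * (C * e0) + s * s = 1 := by
      linear_combination C ^ 2 * he + hC
    intro k l
    rw [Fin.sum_univ_three]
    fin_cases k <;> fin_cases l <;> simp only [Fin.zero_eta, Fin.mk_one, z0, z1]
    · simpa using q00
    · simpa using q01
    · simpa [mul_comm, add_comm] using q01
    · simpa using q11
  have hmc' := hmc ζ hon
  rw [Fin.sum_univ_two, hsf, hsf] at hmc'
  simp only [Fin.sum_univ_three, z0, z1, hx0, hx1, hx2] at hmc'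
  have lin : ∀ (L : ℝ × ℝ →L[ℝ] ℝ) (c d : ℝ), L (c, d) = c * L (1, 0) + d * L (0, 1) := by
    intro L c d
    have : ((c, d) : ℝ × ℝ) = c • (1, 0) + d • (0, 1) := by simp
    rw [this, map_add, map_smul, map_smul, smul_eq_mul, smul_eq_mul]
  have linC : ∀ i l c d, connAlong a b h y (c, d) i l
      = c * connAlong a b h y (1, 0) i l + d * connAlong a b h y (0, 1) i l := by
    intro i l c d
    simp only [connAlong, circCoef, Fin.sum_univ_three]
    simp
    ring
  obtain ⟨-, d0a, d1a, d2a⟩ := hdx (1, 0)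
  obtain ⟨-, d0t, d1t, d2t⟩ := hdx (0, 1)
  have ζ0 : ζ 0 = (1 / ℓ, 0) := rfl
  have ζ1 : ζ 1 = (-(s / V * (f / ℓ)), s / V) := rfl
  obtain ⟨II1, hII1⟩ : ∃ x, x = e0 * (fderiv ℝ (outerComp h r j ψ 0) y (ζ 0)
      + (s * e1 * connAlong a b h y (ζ 0) 0 0 + -(s * e0) * connAlong a b h y (ζ 0) 1 0
        + C * connAlong a b h y (ζ 0) 2 0)) + e1 * (fderiv ℝ (outerComp h r j ψ 1) y (ζ 0)
      + (s * e1 * connAlong a b h y (ζ 0) 0 1 + -(s * e0) * connAlong a b h y (ζ 0) 1 1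
        + C * connAlong a b h y (ζ 0) 2 1)) := ⟨_, rfl⟩
  obtain ⟨II2, hII2⟩ : ∃ x, x = -C * e1 * (fderiv ℝ (outerComp h r j ψ 0) y (ζ 1)
      + (s * e1 * connAlong a b h y (ζ 1) 0 0 + -(s * e0) * connAlong a b h y (ζ 1) 1 0
        + C * connAlong a b h y (ζ 1) 2 0)) + C * e0 * (fderiv ℝ (outerComp h r j ψ 1) y (ζ 1)
      + (s * e1 * connAlong a b h y (ζ 1) 0 1 + -(s * e0) * connAlong a b h y (ζ 1) 1 1
        + C * connAlong a b h y (ζ 1) 2 1)) + s * (fderiv ℝ (outerComp h r j ψ 2) y (ζ 1)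
      + (s * e1 * connAlong a b h y (ζ 1) 0 2 + -(s * e0) * connAlong a b h y (ζ 1) 1 2
        + C * connAlong a b h y (ζ 1) 2 2)) := ⟨_, rfl⟩
  have hII : s / r (modelCurve j ψ y 2) - k * s ≤ II1 + II2 := by
    rw [hII1, hII2]; linarith
  have c02 : -Real.sin y.1 * Ω 0 0 2 + Real.cos y.1 * Ω 1 0 2 = -(ℓ * (e0 * A00 + e1 * A01)) := by
    rw [← c20, anti 0 0 2, anti 1 0 2]; ring
  have c12 : -Real.sin y.1 * Ω 0 1 2 + Real.cos y.1 * Ω 1 1 2 = -(ℓ * (e0 * A01 + e1 * A11)) := by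
    rw [← c21, anti 0 1 2, anti 1 1 2]; ring
  have alg := boundary_algebra (f := f) (A00 := A00) (A01 := A01) (A11 := A11) (w := w)
    (w2 := Ω 2 1 0) (b0 := Ω 2 2 0) (b1 := Ω 2 2 1) (II1 := II1) (II2 := II2) he hC hs.ne' hl.ne'
    hV.ne' hm2 hS hU d0a d1a d2a d0t d1t d2t (by
      rw [hII1, ζ0]
      simp only [linC _ _ (1 / ℓ) 0, lin (fderiv ℝ _ y) (1 / ℓ) 0, cw, ct, self, ← hw, c20, c21, c01]
      ring) (by
      rw [hII2, ζ1]
      simp only [linC _ _ (-(s / V * (f / ℓ))) (s / V),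
        lin (fderiv ℝ _ y) (-(s / V * (f / ℓ))) (s / V), cw, ct, self, ← hw, c20, c21, c01,
        c02, c12, anti 2 0 1, anti 2 0 2, anti 2 1 2]
      ring)
  have hflux : flux0 (slab a b) slabDir h (circ y) * Real.cos y.1
      + flux1 (slab a b) slabDir h (circ y) * Real.sin y.1
      = ℓ / V * ((Ω 2 2 0 - S * A00 - U * A01) * e1 - (Ω 2 2 1 - S * A01 - U * A11) * e0) + w := by
    have a0 : accel (slab a b) slabDir h 0 (circ y) = Ω 2 2 0 - S * A00 - U * A01 := by
      change Ω 2 2 0 - S / P * Ω 0 2 0 + U * Q / (P * R) * Ω 0 2 0 - U / R * Ω 1 2 0 = _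
      rw [o1, o4]; field_simp; ring
    have a1 : accel (slab a b) slabDir h 1 (circ y) = Ω 2 2 1 - S * A01 - U * A11 := by
      change Ω 2 2 1 - S / P * Ω 0 2 1 + U * Q / (P * R) * Ω 0 2 1 - U / R * Ω 1 2 1 = _
      rw [o2, o3]; field_simp; ring
    change ((R * accel (slab a b) slabDir h 0 (circ y) - Q * accel (slab a b) slabDir h 1 (circ y))
        / V + Ω 1 1 0) * Real.cos y.1 + (P * accel (slab a b) slabDir h 1 (circ y) / V - Ω 0 1 0)
        * Real.sin y.1 = _
    rw [a0, a1, hw]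
    have e1' : ℓ * e1 = Real.cos y.1 * R := w1.symm.trans b1
    have e0' : ℓ * e0 = -Real.sin y.1 * P + Real.cos y.1 * Q := w0.symm.trans b0
    linear_combination -(Ω 2 2 0 - S * A00 - U * A01) / V * e1'
      + (Ω 2 2 1 - S * A01 - U * A11) / V * e0'
  rw [hflux, alg]
  -- the derivative of the height along `η`, at most `sin γ̄` by the comparison of the metrics
  obtain ⟨δ, hδ⟩ : ∃ x, x = s / V * (fderiv ℝ (modelCurve j ψ) y (0, 1) 2
    - f / ℓ * fderiv ℝ (modelCurve j ψ) y (1, 0) 2) := ⟨_, rfl⟩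
  have hδs : δ ≤ s := by
    have h1 := hme (ζ 1)
    have h2 : fderiv ℝ (modelCurve j ψ) y (ζ 1) 2 = δ := by
      have := lin ((EuclideanSpace.proj (2 : Fin 3) : 𝔼 3 →L[ℝ] ℝ).comp
        (fderiv ℝ (modelCurve j ψ) y)) (-(s / V * (f / ℓ))) (s / V)
      rw [ζ1, hδ]
      refine Eq.trans this ?_
      change -(s / V * (f / ℓ)) * fderiv ℝ (modelCurve j ψ) y (1, 0) 2
        + s / V * fderiv ℝ (modelCurve j ψ) y (0, 1) 2 = _
      ring
    have h3 := hon 1 1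
    simp only [if_true, ← sq] at h3
    rw [h3, h2] at h1
    have h4 : δ ^ 2 / s ^ 2 ≤ 1 := le_trans (le_add_of_nonneg_left (by positivity)) h1
    rw [div_le_one (by positivity)] at h4
    exact le_of_sq_le_sq h4 hs.le
  have hθ : r (modelCurve j ψ y 2) * |angRate (modelCurve j ψ) y (1, 0)| ≤ ℓ := by
    have h1 := hme (1, 0)
    obtain ⟨t0, t1, t2⟩ := hT (1, 0)
    rw [Fin.sum_univ_three, t0, t1, t2, w0, w1] at h1
    have h2 : (r (modelCurve j ψ y 2) * |angRate (modelCurve j ψ) y (1, 0)|) ^ 2 ≤ ℓ ^ 2 := by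
      rw [mul_pow, sq_abs]
      refine le_trans (le_add_of_nonneg_right (by positivity)) (h1.trans (le_of_eq ?_))
      linear_combination ℓ ^ 2 * he
    exact le_of_sq_le_sq h2 hl.le
  rw [hHm, ← hδ]
  have h1 : C * H y.2 - (II1 + II2) - k * δ ≤ C * H y.2 - s / r (modelCurve j ψ y 2) := by
    have h0 := mul_nonpos_of_nonpos_of_nonneg hk (sub_nonneg.2 hδs)
    linarith
  have h2 := mul_le_mul_of_nonneg_left h1 (div_pos hl hs).le
  have h3 : ℓ / s * (C * H y.2 - s / r (modelCurve j ψ y 2))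
      = ℓ * (C / s) * H y.2 - ℓ / r (modelCurve j ψ y 2) := by field_simp
  have h4 : |angRate (modelCurve j ψ) y (1, 0)| ≤ ℓ / r (modelCurve j ψ y 2) := by
    rw [le_div_iff₀ hrp]; linarith
  have h5 : ℓ / s * (C * H y.2 - (II1 + II2) - k * δ)
      ≤ ℓ * (C / s) * H y.2 - |angRate (modelCurve j ψ) y (1, 0)| := by linarith only [h2, h3, h4]
  change turn h y + _ ≤ _
  rw [add_sub_assoc]
  exact add_le_add_right h5 _

end IsCMCCapillaryFoliation

end BoundaryFlux

/-! ### The divergence theorem on the disk -/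

section DiskDivergence

/-- Polar coordinates on the plane. -/
def polarPt (x : ℝ × ℝ) : 𝔼 2 := x.1 • circlePt x.2

lemma norm_polarPt (x : ℝ × ℝ) : ‖polarPt x‖ = |x.1| := by
  rw [polarPt, norm_smul, norm_circlePt, mul_one, Real.norm_eq_abs]

lemma continuous_polarPt : Continuous polarPt :=
  continuous_fst.smul (contDiff_circlePt.continuous.comp continuous_snd)

/-- The differential of the polar coordinates. -/
def dpolar (x : ℝ × ℝ) : ℝ × ℝ →L[ℝ] 𝔼 2 :=
  (ContinuousLinearMap.fst ℝ ℝ ℝ).smulRight (circlePt x.2)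
    + (ContinuousLinearMap.snd ℝ ℝ ℝ).smulRight (x.1 • circleDir x.2)

lemma hasFDerivAt_polarPt (x : ℝ × ℝ) : HasFDerivAt polarPt (dpolar x) x := by
  have h := (hasDerivAt_circlePt x.2).hasFDerivAt.comp x (hasFDerivAt_snd (𝕜 := ℝ) (p := x))
  refine (HasFDerivAt.smul (hasFDerivAt_fst (𝕜 := ℝ) (p := x)) h).congr_fderiv ?_
  refine ContinuousLinearMap.ext fun ξ => ?_
  simp [dpolar, smul_smul, mul_comm, add_comm]

lemma polarPt_mem_disk {x : ℝ × ℝ} (hx : x ∈ Icc (0 : ℝ) 1 ×ˢ Icc (-Real.pi) Real.pi) :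
    polarPt x ∈ disk := by
  rw [disk, mem_closedBall_zero_iff, norm_polarPt, abs_of_nonneg hx.1.1]
  exact hx.1.2

/-- Integration over the disk in polar coordinates. -/
lemma setIntegral_disk {φ : 𝔼 2 → ℝ} (hφ : ContinuousOn φ disk) :
    ∫ x in disk, φ x
      = ∫ ρ in (0 : ℝ)..1, ∫ α in (-Real.pi)..Real.pi, ρ * φ (polarPt (ρ, α)) := by
  have hπ := Real.pi_pos
  have e1 : MeasurePreserving (fun p : ℝ × ℝ => (!₂[p.1, p.2] : 𝔼 2)) :=
    (PiLp.volume_preserving_toLp (Fin 2)).comp (volume_preserving_finTwoArrow ℝ).symm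
  have e2 : MeasurableEmbedding (fun p : ℝ × ℝ => (!₂[p.1, p.2] : 𝔼 2)) :=
    (MeasurableEquiv.toLp 2 (Fin 2 → ℝ)).measurableEmbedding.comp
      (MeasurableEquiv.finTwoArrow (α := ℝ)).symm.measurableEmbedding
  have hdisk : MeasurableSet disk := measurableSet_closedBall
  rw [← integral_indicator hdisk, ← e1.integral_comp e2, ← integral_comp_polarCoord_symm]
  have h1 : ∀ p : ℝ × ℝ, (!₂[(polarCoord.symm p).1, (polarCoord.symm p).2] : 𝔼 2) = polarPt p := by
    intro p
    rw [polarCoord_symm_apply]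
    ext i
    fin_cases i <;> simp [polarPt, circlePt]
  simp only [h1]
  have hT : polarCoord.target = Ioi (0 : ℝ) ×ˢ Ioo (-Real.pi) Real.pi := rfl
  have h2 : ∀ p ∈ polarCoord.target, p.1 • disk.indicator φ (polarPt p)
      = (Iic (1 : ℝ) ×ˢ (univ : Set ℝ)).indicator (fun p => p.1 * φ (polarPt p)) p := by
    intro p hp
    rw [hT] at hp
    have h3 : polarPt p ∈ disk ↔ p.1 ≤ 1 := by
      rw [disk, mem_closedBall_zero_iff, norm_polarPt, abs_of_pos hp.1]
    have h5 : p ∈ Iic (1 : ℝ) ×ˢ (univ : Set ℝ) ↔ p.1 ≤ 1 := by simp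
    by_cases h4 : p.1 ≤ 1
    · rw [indicator_of_mem (h3.2 h4), indicator_of_mem (h5.2 h4), smul_eq_mul]
    · rw [indicator_of_notMem (fun h => h4 (h3.1 h)), indicator_of_notMem (fun h => h4 (h5.1 h)),
        smul_zero]
  rw [setIntegral_congr_fun polarCoord.open_target.measurableSet h2,
    setIntegral_indicator (measurableSet_Iic.prod MeasurableSet.univ), hT, prod_inter_prod,
    inter_univ, Ioi_inter_Iic, Measure.volume_eq_prod]
  have hK : IntegrableOn (fun p : ℝ × ℝ => p.1 * φ (polarPt p))
      (Icc (0 : ℝ) 1 ×ˢ Icc (-Real.pi) Real.pi) :=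
    ContinuousOn.integrableOn_compact (isCompact_Icc.prod isCompact_Icc)
      (continuous_fst.continuousOn.mul (hφ.comp continuous_polarPt.continuousOn
        fun x hx => polarPt_mem_disk hx))
  rw [setIntegral_prod _ (hK.mono_set (prod_mono Ioc_subset_Icc_self Ioo_subset_Icc_self)),
    intervalIntegral.integral_of_le zero_le_one]
  refine setIntegral_congr_fun measurableSet_Ioc fun ρ _ => ?_
  rw [intervalIntegral.integral_of_le (by linarith), integral_Ioc_eq_integral_Ioo]

/-- The derivative of the radial flux in polar coordinates. -/
def radialDeriv (L0 L1 : 𝔼 2 →L[ℝ] ℝ) (c0 c1 : ℝ) (x : ℝ × ℝ) : ℝ × ℝ →L[ℝ] ℝ :=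
  x.1 • (Real.cos x.2 • L0.comp (dpolar x) + Real.sin x.2 • L1.comp (dpolar x)
    + (c1 * Real.cos x.2 - c0 * Real.sin x.2) • ContinuousLinearMap.snd ℝ ℝ ℝ)
    + (c0 * Real.cos x.2 + c1 * Real.sin x.2) • ContinuousLinearMap.fst ℝ ℝ ℝ

/-- The derivative of the angular flux in polar coordinates. -/
def angularDeriv (L0 L1 : 𝔼 2 →L[ℝ] ℝ) (c0 c1 : ℝ) (x : ℝ × ℝ) : ℝ × ℝ →L[ℝ] ℝ :=
  Real.cos x.2 • L1.comp (dpolar x) - Real.sin x.2 • L0.comp (dpolar x)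
    - (c1 * Real.sin x.2 + c0 * Real.cos x.2) • ContinuousLinearMap.snd ℝ ℝ ℝ

lemma radialDeriv_add_angularDeriv (L0 L1 : 𝔼 2 →L[ℝ] ℝ) (c0 c1 : ℝ) (x : ℝ × ℝ) :
    radialDeriv L0 L1 c0 c1 x (1, 0) + angularDeriv L0 L1 c0 c1 x (0, 1)
      = x.1 * (L0 (vec 0) + L1 (vec 1)) := by
  have h1 : circlePt x.2 = Real.cos x.2 • vec 0 + Real.sin x.2 • vec 1 := by
    ext i; fin_cases i <;> simp [circlePt, vec]
  have h2 : circleDir x.2 = -Real.sin x.2 • vec 0 + Real.cos x.2 • vec 1 := by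
    ext i; fin_cases i <;> simp [circleDir, vec]
  simp only [radialDeriv, angularDeriv, dpolar, _root_.add_apply, _root_.sub_apply,
    _root_.smul_apply, ContinuousLinearMap.comp_apply, ContinuousLinearMap.smulRight_apply,
    ContinuousLinearMap.coe_fst', ContinuousLinearMap.coe_snd', smul_eq_mul, h1, h2, map_add,
    map_smul]
  linear_combination x.1 * (L0 (vec 0) + L1 (vec 1)) * Real.sin_sq_add_cos_sq x.2

variable {f0 f1 : 𝔼 2 → ℝ}

lemma hasFDerivAt_radial {L0 L1 : 𝔼 2 →L[ℝ] ℝ} {x : ℝ × ℝ} (h0 : HasFDerivAt f0 L0 (polarPt x))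
    (h1 : HasFDerivAt f1 L1 (polarPt x)) :
    HasFDerivAt (fun x : ℝ × ℝ => x.1 * (f0 (polarPt x) * Real.cos x.2
      + f1 (polarPt x) * Real.sin x.2))
      (radialDeriv L0 L1 (f0 (polarPt x)) (f1 (polarPt x)) x) x := by
  have hc := (Real.hasDerivAt_cos x.2).comp_hasFDerivAt x (hasFDerivAt_snd (𝕜 := ℝ) (p := x))
  have hs := (Real.hasDerivAt_sin x.2).comp_hasFDerivAt x (hasFDerivAt_snd (𝕜 := ℝ) (p := x))
  have k0 := h0.comp x (hasFDerivAt_polarPt x)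
  have k1 := h1.comp x (hasFDerivAt_polarPt x)
  refine (HasFDerivAt.mul (hasFDerivAt_fst (𝕜 := ℝ) (p := x))
    ((k0.mul hc).add (k1.mul hs))).congr_fderiv ?_
  refine ContinuousLinearMap.ext fun ξ => ?_
  simp [radialDeriv]
  ring

lemma hasFDerivAt_angular {L0 L1 : 𝔼 2 →L[ℝ] ℝ} {x : ℝ × ℝ} (h0 : HasFDerivAt f0 L0 (polarPt x))
    (h1 : HasFDerivAt f1 L1 (polarPt x)) :
    HasFDerivAt (fun x : ℝ × ℝ => f1 (polarPt x) * Real.cos x.2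
      - f0 (polarPt x) * Real.sin x.2)
      (angularDeriv L0 L1 (f0 (polarPt x)) (f1 (polarPt x)) x) x := by
  have hc := (Real.hasDerivAt_cos x.2).comp_hasFDerivAt x (hasFDerivAt_snd (𝕜 := ℝ) (p := x))
  have hs := (Real.hasDerivAt_sin x.2).comp_hasFDerivAt x (hasFDerivAt_snd (𝕜 := ℝ) (p := x))
  have k0 := h0.comp x (hasFDerivAt_polarPt x)
  have k1 := h1.comp x (hasFDerivAt_polarPt x)
  refine ((k1.mul hc).sub (k0.mul hs)).congr_fderiv ?_
  refine ContinuousLinearMap.ext fun ξ => ?_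
  simp [angularDeriv]
  ring

/-- The divergence theorem on the disk, for vector fields which are `C¹` up to the boundary. -/
theorem integral_divergence_disk (h0 : ContDiffOn ℝ 1 f0 disk) (h1 : ContDiffOn ℝ 1 f1 disk) :
    ∫ x in disk, (fderivWithin ℝ f0 disk x (vec 0) + fderivWithin ℝ f1 disk x (vec 1))
      = ∫ α in (-Real.pi)..Real.pi,
        (f0 (circlePt α) * Real.cos α + f1 (circlePt α) * Real.sin α) := by
  have hπ := Real.pi_pos
  have hd : ContinuousOn (fun x => fderivWithin ℝ f0 disk x (vec 0)
      + fderivWithin ℝ f1 disk x (vec 1)) disk :=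
    ((h0.continuousOn_fderivWithin uniqueDiffOn_disk le_rfl).clm_apply continuousOn_const).add
      ((h1.continuousOn_fderivWithin uniqueDiffOn_disk le_rfl).clm_apply continuousOn_const)
  rw [setIntegral_disk hd]
  have hu : uIcc (0 : ℝ) 1 ×ˢ uIcc (-Real.pi) Real.pi = Icc (0 : ℝ) 1 ×ˢ Icc (-Real.pi) Real.pi := by
    rw [uIcc_of_le zero_le_one, uIcc_of_le (by linarith)]
  have hm : MapsTo polarPt (Icc (0 : ℝ) 1 ×ˢ Icc (-Real.pi) Real.pi) disk :=
    fun x hx => polarPt_mem_disk hx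
  have k0 := h0.continuousOn.comp continuous_polarPt.continuousOn hm
  have k1 := h1.continuousOn.comp continuous_polarPt.continuousOn hm
  have kd := hd.comp continuous_polarPt.continuousOn hm
  have kc : ContinuousOn (fun x : ℝ × ℝ => Real.cos x.2) (Icc (0 : ℝ) 1 ×ˢ Icc (-Real.pi) Real.pi) :=
    by fun_prop
  have ks : ContinuousOn (fun x : ℝ × ℝ => Real.sin x.2) (Icc (0 : ℝ) 1 ×ˢ Icc (-Real.pi) Real.pi) :=
    by fun_prop
  have hin : ∀ x ∈ Ioo (min (0 : ℝ) 1) (max 0 1) ×ˢ Ioo (min (-Real.pi) Real.pi) (max (-Real.pi) Real.pi),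
      disk ∈ 𝓝 (polarPt x) := by
    intro x hx
    rw [min_eq_left zero_le_one, max_eq_right zero_le_one] at hx
    refine Filter.mem_of_superset (Metric.isOpen_ball.mem_nhds ?_) Metric.ball_subset_closedBall
    rw [mem_ball_zero_iff, norm_polarPt, abs_of_pos hx.1.1]
    exact hx.1.2
  have hfd : ∀ {f : 𝔼 2 → ℝ}, ContDiffOn ℝ 1 f disk → ∀ x, disk ∈ 𝓝 x →
      HasFDerivAt f (fderivWithin ℝ f disk x) x := fun hf x hx =>
    ((hf.differentiableOn one_ne_zero x (mem_of_mem_nhds hx)).hasFDerivWithinAt).hasFDerivAt hx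
  have key := integral2_divergence_prod_of_hasFDerivAt
    (fun x : ℝ × ℝ => x.1 * (f0 (polarPt x) * Real.cos x.2 + f1 (polarPt x) * Real.sin x.2))
    (fun x : ℝ × ℝ => f1 (polarPt x) * Real.cos x.2 - f0 (polarPt x) * Real.sin x.2)
    (fun x => radialDeriv (fderivWithin ℝ f0 disk (polarPt x)) (fderivWithin ℝ f1 disk (polarPt x))
      (f0 (polarPt x)) (f1 (polarPt x)) x)
    (fun x => angularDeriv (fderivWithin ℝ f0 disk (polarPt x)) (fderivWithin ℝ f1 disk (polarPt x))
      (f0 (polarPt x)) (f1 (polarPt x)) x) 0 (-Real.pi) 1 Real.pi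
    (by
      rw [hu]
      exact continuous_fst.continuousOn.mul ((k0.mul kc).add (k1.mul ks)))
    (by
      rw [hu]
      exact (k1.mul kc).sub (k0.mul ks))
    (fun x hx => hasFDerivAt_radial (hfd h0 _ (hin x hx)) (hfd h1 _ (hin x hx)))
    (fun x hx => hasFDerivAt_angular (hfd h0 _ (hin x hx)) (hfd h1 _ (hin x hx)))
    (by
      rw [hu]
      simp only [radialDeriv_add_angularDeriv]
      exact (continuous_fst.continuousOn.mul kd).integrableOn_compact
        (isCompact_Icc.prod isCompact_Icc))
  simp only [radialDeriv_add_angularDeriv] at key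
  rw [key]
  have hper : circlePt (-Real.pi) = circlePt Real.pi := by simp [circlePt]
  simp [polarPt, hper]

end DiskDivergence

/-! ### Rotation of plane curves -/

section Rotation

/-- A closed curve of unit vectors `E` that is never opposite to the tangent `i exp(iα)` of the
circle turns around once. -/
lemma integral_rotation {E : ℝ → ℂ} {τ : ℝ → ℝ} (hE : ∀ α, HasDerivAt E (τ α * Complex.I * E α) α)
    (hτ : Continuous τ) (hper : E Real.pi = E (-Real.pi))
    (hs : ∀ α, E α * (-Complex.I * Complex.exp (-(α * Complex.I))) ∈ Complex.slitPlane) :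
    ∫ α in (-Real.pi)..Real.pi, τ α = 2 * Real.pi := by
  have hd : ∀ α : ℝ, HasDerivAt (fun α : ℝ => -Complex.I * Complex.exp (-(α * Complex.I)))
      (-Complex.I * (-Complex.I * Complex.exp (-(α * Complex.I)))) α := by
    intro α
    have h1 : HasDerivAt (fun α : ℝ => -((α : ℂ) * Complex.I)) (-Complex.I) α := by
      exact HasDerivAt.congr_deriv ((Complex.ofRealCLM.hasDerivAt (x := α)).mul_const Complex.I).neg
        (by simp)
    exact HasDerivAt.congr_deriv ((h1.cexp).const_mul (-Complex.I)) (by ring)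
  have hlog : ∀ α : ℝ, HasDerivAt
      (fun α : ℝ => Complex.imCLM (Complex.log (E α * (-Complex.I * Complex.exp (-(α * Complex.I))))))
      (τ α - 1) α := by
    intro α
    have h1 := ((hE α).mul (hd α)).clog_real (hs α)
    have h2 := Complex.imCLM.hasFDerivAt.comp_hasDerivAt α h1
    refine HasDerivAt.congr_deriv h2 ?_
    have hne := Complex.slitPlane_ne_zero (hs α)
    have h3 : (τ α * Complex.I * E α * (-Complex.I * Complex.exp (-(α * Complex.I)))
        + E α * (-Complex.I * (-Complex.I * Complex.exp (-(α * Complex.I)))))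
        / (E α * (-Complex.I * Complex.exp (-(α * Complex.I)))) = ((τ α - 1 : ℝ) : ℂ) * Complex.I := by
      rw [div_eq_iff hne]
      push_cast
      ring
    refine (congrArg Complex.imCLM h3).trans ?_
    simp
  have h := intervalIntegral.integral_eq_sub_of_hasDerivAt (a := -Real.pi) (b := Real.pi)
    (fun α _ => hlog α) ((hτ.sub continuous_const).intervalIntegrable _ _)
  have hexp : Complex.exp (-(Real.pi * Complex.I))
      = Complex.exp (-(((-Real.pi : ℝ) : ℂ) * Complex.I)) := by
    push_cast
    rw [neg_mul, neg_neg, Complex.exp_neg, Complex.exp_pi_mul_I]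
    norm_num
  rw [hper, hexp, sub_self, intervalIntegral.integral_sub (hτ.intervalIntegrable _ _)
    (continuous_const.intervalIntegrable _ _)] at h
  simp at h
  linarith

/-- The lift of a plane curve to polar coordinates. -/
lemma polar_lift {z : ℝ → ℂ} {κ θ : ℝ → ℝ} (hκ : Continuous κ) (hθ : Continuous θ)
    (hz : ∀ α, HasDerivAt z ((κ α + θ α * Complex.I) * z α) α) (a α : ℝ) :
    z α = z a * Complex.exp ((∫ x in a..α, κ x : ℝ) + (∫ x in a..α, θ x : ℝ) * Complex.I) := by
  have hK : ∀ α, HasDerivAt (fun α => ((∫ x in a..α, κ x : ℝ) : ℂ)) (κ α) α := fun α =>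
    (hκ.integral_hasStrictDerivAt a α).hasDerivAt.ofReal_comp
  have hT : ∀ α, HasDerivAt (fun α => ((∫ x in a..α, θ x : ℝ) : ℂ)) (θ α) α := fun α =>
    (hθ.integral_hasStrictDerivAt a α).hasDerivAt.ofReal_comp
  have hW := fun α => ((hK α).add ((hT α).mul_const Complex.I))
  have hD : ∀ α, HasDerivAt (fun α => z α * Complex.exp (-(((∫ x in a..α, κ x : ℝ) : ℂ)
      + ((∫ x in a..α, θ x : ℝ) : ℂ) * Complex.I))) 0 α := by
    intro α
    have := (hz α).mul (hW α).neg.cexp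
    convert! this using 1
    simp
    ring
  have hc := is_const_of_deriv_eq_zero (fun α => (hD α).differentiableAt) (fun α => (hD α).deriv) α a
  simp only [intervalIntegral.integral_same, Complex.ofReal_zero, zero_mul, add_zero, neg_zero,
    Complex.exp_zero, mul_one] at hc
  rw [← hc, mul_assoc, ← Complex.exp_add, neg_add_cancel, Complex.exp_zero, mul_one]

/-- A plane curve whose total angular variation is less than `2π` misses a ray from the origin. -/
lemma exists_missed_ray {z : ℝ → ℂ} {κ θ : ℝ → ℝ} (hκ : Continuous κ) (hθ : Continuous θ)
    (hz : ∀ α, HasDerivAt z ((κ α + θ α * Complex.I) * z α) α)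
    (hlt : ∫ α in (-Real.pi)..Real.pi, |θ α| < 2 * Real.pi) :
    ∃ φ : ℝ, ∀ α ∈ Icc (-Real.pi) Real.pi, ∀ ρ : ℝ, 0 < ρ →
      z α ≠ ρ * Complex.exp (φ * Complex.I) := by
  set L := ∫ α in (-Real.pi)..Real.pi, |θ α| with hL
  set T := ∫ α in (-Real.pi)..Real.pi, θ α with hT
  -- the ray opposite to the midpoint of the initial and the final angle
  refine ⟨Complex.arg (z (-Real.pi)) + T / 2 + Real.pi, fun α hα ρ hρ heq => ?_⟩
  have hi : ∀ c d, IntervalIntegrable θ volume c d := fun c d => hθ.intervalIntegrable c d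
  have hi' : ∀ c d, IntervalIntegrable (fun x => |θ x|) volume c d := fun c d =>
    hθ.abs.intervalIntegrable c d
  set Θ := ∫ x in (-Real.pi)..α, θ x with hΘ
  have h1 : |Θ| ≤ ∫ x in (-Real.pi)..α, |θ x| := intervalIntegral.abs_integral_le_integral_abs hα.1
  have h2 : |∫ x in α..Real.pi, θ x| ≤ ∫ x in α..Real.pi, |θ x| :=
    intervalIntegral.abs_integral_le_integral_abs hα.2
  have h3 : Θ + (∫ x in α..Real.pi, θ x) = T :=
    intervalIntegral.integral_add_adjacent_intervals (hi _ _) (hi _ _)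
  have h4 : (∫ x in (-Real.pi)..α, |θ x|) + ∫ x in α..Real.pi, |θ x| = L :=
    intervalIntegral.integral_add_adjacent_intervals (hi' _ _) (hi' _ _)
  have h5 : |Θ - T / 2| < Real.pi := by
    rw [abs_le] at h1 h2
    rw [abs_lt]
    constructor <;> linarith
  have h6 : -1 < Real.cos (Θ - T / 2) := by
    rw [← Real.cos_pi, ← Real.cos_abs (Θ - T / 2)]
    exact Real.cos_lt_cos_of_nonneg_of_le_pi (abs_nonneg _) le_rfl h5
  have h7 := polar_lift hκ hθ hz (-Real.pi) α
  have hz0 := (Complex.norm_mul_exp_arg_mul_I (z (-Real.pi))).symm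
  set A := Complex.arg (z (-Real.pi))
  rw [heq, ← hΘ] at h7
  set z0 := z (-Real.pi)
  replace h7 := h7.trans (congrArg (fun x : ℂ => x * _) hz0)
  beta_reduce at h7
  set K := ∫ x in (-Real.pi)..α, κ x
  have h8 : (ρ : ℂ) * Complex.exp (((T / 2 + Real.pi - Θ : ℝ) : ℂ) * Complex.I)
      = ((‖z0‖ * Real.exp K : ℝ) : ℂ) := by
    have e1 : Complex.exp (((T / 2 + Real.pi - Θ : ℝ) : ℂ) * Complex.I)
        = Complex.exp (((A + T / 2 + Real.pi : ℝ) : ℂ) * Complex.I)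
          * Complex.exp (-(((A : ℂ) + Θ) * Complex.I)) := by
      rw [← Complex.exp_add]; congr 1; push_cast; ring
    rw [e1, ← mul_assoc]
    push_cast at h7 ⊢
    rw [h7, mul_assoc, mul_assoc, ← Complex.exp_add, ← Complex.exp_add]
    congr 2
    ring
  have h9 := congrArg Complex.re h8
  rw [Complex.ofReal_re, Complex.re_ofReal_mul, Complex.exp_ofReal_mul_I_re] at h9
  have h10 := congrArg Complex.im h8
  rw [Complex.ofReal_im, Complex.im_ofReal_mul, Complex.exp_ofReal_mul_I_im] at h10
  have hc : Real.cos (T / 2 + Real.pi - Θ) = -Real.cos (Θ - T / 2) := by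
    rw [← Real.cos_neg (Θ - T / 2), show T / 2 + Real.pi - Θ = -(Θ - T / 2) + Real.pi by ring,
      Real.cos_add_pi]
  have hsn := (mul_eq_zero.1 h10).resolve_left hρ.ne'
  have h11 : 0 ≤ Real.cos (T / 2 + Real.pi - Θ) := by
    have : 0 ≤ ρ * Real.cos (T / 2 + Real.pi - Θ) := by rw [h9]; positivity
    exact nonneg_of_mul_nonneg_right this hρ
  have h12 := Real.sin_sq_add_cos_sq (T / 2 + Real.pi - Θ)
  rw [hsn] at h12
  nlinarith

end Rotation

/-! ### Total turning of the boundary curves -/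

section Turning

section Slice

variable {F : Type*} [NormedAddCommGroup F] [NormedSpace ℝ F] {f : ℝ × ℝ → F} {a b t : ℝ}

lemma hasDerivAt_slice {y : ℝ × ℝ} (hf : DifferentiableAt ℝ f y) :
    HasDerivAt (fun α => f (α, y.2)) (fderiv ℝ f y (1, 0)) y.1 := by
  have h1 : HasDerivAt (fun α : ℝ => (α, y.2)) ((1, 0) : ℝ × ℝ) y.1 :=
    (hasDerivAt_id y.1).prodMk (hasDerivAt_const y.1 y.2)
  exact hf.hasFDerivAt.comp_hasDerivAt y.1 h1

lemma continuousOn_fderiv_cyl (hf : ContDiffOn ℝ ∞ f (cyl a b)) :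
    ContinuousOn (fun y => fderiv ℝ f y (1, 0)) (cyl a b) :=
  (hf.continuousOn_fderiv_of_isOpen (isOpen_cyl a b) (by simp)).clm_apply continuousOn_const

omit [NormedSpace ℝ F] in
lemma continuous_slice (hf : ContinuousOn f (cyl a b)) (ht : t ∈ Ioo a b) :
    Continuous fun α => f (α, t) :=
  hf.comp_continuous (by fun_prop) fun _ => ⟨mem_univ _, ht⟩

end Slice

/-- The Gram-Schmidt frame of a metric turns once along the boundary, relative to the tangent of
the boundary: the matrix that relates it to the coordinate frame is triangular with positive
diagonal, so that it never reverses the direction of a vector. -/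
lemma integral_turn {h : Fin 3 → Fin 3 → 𝔼 2 × ℝ → ℝ} {a b t : ℝ}
    (hh : ∀ k l, ContDiffOn ℝ ∞ (h k l) (slab a b)) (hp : IsPosDefOn (slab a b) h)
    (ht : t ∈ Ioo a b) : ∫ α in (-Real.pi)..Real.pi, turn h (α, t) = 2 * Real.pi := by
  obtain ⟨c0, c1⟩ := contDiffOn_be hh hp
  have hmem : ∀ α : ℝ, (α, t) ∈ cyl a b := fun α => ⟨mem_univ _, ht⟩
  have hcont : ContinuousOn (turn h) (cyl a b) :=
    (c0.continuousOn.mul (continuousOn_fderiv_cyl c1)).sub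
      (c1.continuousOn.mul (continuousOn_fderiv_cyl c0))
  refine integral_rotation (E := fun α => (be0 h (α, t) : ℂ) + be1 h (α, t) * Complex.I)
    (fun α => ?_) (continuous_slice hcont ht) ?_ fun α => ?_
  · obtain ⟨d0, d1, e0, e1⟩ := fderiv_be hh hp (hmem α) (1, 0)
    have h0 := (hasDerivAt_slice d0).ofReal_comp
    have h1 := (hasDerivAt_slice d1).ofReal_comp
    rw [e0] at h0
    rw [e1] at h1
    refine HasDerivAt.congr_deriv (h0.add (h1.mul_const Complex.I)) ?_
    simp only [turn]
    push_cast
    linear_combination (be1 h (α, t) : ℂ) * ((be0 h (α, t) : ℂ) * (fderiv ℝ (be1 h) (α, t) (1, 0))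
      - be1 h (α, t) * (fderiv ℝ (be0 h) (α, t) (1, 0))) * (-Complex.I_sq)
  · have hc : circ (-Real.pi, t) = circ (Real.pi, t) := by simp [circ, circlePt]
    simp [be0, be1, bl, bw0, bw1, hc]
  · have hP := chP_pos hp (circ_mem (hmem α))
    have hR := chR_pos hp (circ_mem (hmem α))
    have hl := bl_pos hp (hmem α)
    obtain ⟨w0, w1⟩ := bw_eq hp (hmem α)
    have hexp : -Complex.I * Complex.exp (-(α * Complex.I))
        = ((-Real.sin α : ℝ) : ℂ) - ((Real.cos α : ℝ) : ℂ) * Complex.I := by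
      rw [← neg_mul, Complex.exp_mul_I, Complex.cos_neg, Complex.sin_neg]
      push_cast
      linear_combination Complex.sin α * Complex.I_sq
    rw [hexp, Complex.mem_slitPlane_iff]
    simp only [Complex.add_re, Complex.add_im, Complex.mul_re, Complex.mul_im, Complex.sub_re,
      Complex.sub_im, Complex.ofReal_re, Complex.ofReal_im, Complex.I_re, Complex.I_im, mul_zero,
      mul_one, add_zero, zero_add, sub_zero, zero_sub]
    -- otherwise the image of the tangent of the circle under the triangular matrix would be a
    -- nonpositive multiple of it, while the eigenvalues of the matrix are positive
    by_contra hcon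
    push Not at hcon
    obtain ⟨k1, k2⟩ := hcon
    have hsc := Real.sin_sq_add_cos_sq α
    have m1 := mul_nonpos_of_nonneg_of_nonpos hl.le k1
    have m2 : bl h (α, t) * _ = bl h (α, t) * 0 := congrArg _ k2
    have n1 : bw0 h (α, t) * (-Real.sin α) + bw1 h (α, t) * Real.cos α ≤ 0 := by
      rw [w0, w1]; linarith
    have n2 : bw0 h (α, t) * Real.cos α + bw1 h (α, t) * Real.sin α = 0 := by
      rw [w0, w1]; linarith
    simp only [bw0, bw1] at n1 n2
    set P := chP h (circ (α, t))
    set Q := chQ h (circ (α, t))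
    set R := chR h (circ (α, t))
    set s := Real.sin α
    set c := Real.cos α
    by_cases hc : c = 0
    · rw [hc] at n1 hsc
      nlinarith
    · have n3 : c * Q = s * (P - R) := by
        have : c * (c * Q - s * (P - R)) = 0 := by linear_combination n2
        linarith [(mul_eq_zero.1 this).resolve_left hc]
      have n4 : s ^ 2 * P - s * (c * Q) + c ^ 2 * R ≤ 0 := by linarith
      rw [n3] at n4
      have : (s ^ 2 + c ^ 2) * R ≤ 0 := by linarith
      rw [hsc] at this
      linarith

variable {M : Type*} [TopologicalSpace M] [ChartedSpace (EuclideanHalfSpace 3) M]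
  [IsManifold (𝓡∂ 3) ∞ M]
  {g : Metric3 M} {X : ∀ p : M, TangentSpace (𝓡∂ 3) p} {tm tp : ℝ} {r : ℝ → ℝ}
  {j : M → 𝔼 3} {B : 𝔼 2 → M} {a b t : ℝ} {ψ : 𝔼 2 × ℝ → M}
  {N : ∀ z, TangentSpace (𝓡∂ 3) (ψ z)} {H : ℝ → ℝ}

/-- Every point of the unit circle is `circlePt α` for an angle `α` in `[-π, π]`. -/
lemma exists_circlePt {x : 𝔼 2} (hx : x ∈ Metric.sphere (0 : 𝔼 2) 1) :
    ∃ α ∈ Icc (-Real.pi) Real.pi, circlePt α = x := by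
  have hn : x 0 ^ 2 + x 1 ^ 2 = 1 := by
    have h1 := EuclideanSpace.norm_sq_eq x
    rw [mem_sphere_zero_iff_norm.1 hx, Fin.sum_univ_two, Real.norm_eq_abs, Real.norm_eq_abs, sq_abs,
      sq_abs] at h1
    linarith
  set z : ℂ := ⟨x 0, x 1⟩ with hz
  have hz1 : ‖z‖ = 1 := by
    rw [Complex.norm_eq_sqrt_sq_add_sq, hz, hn, Real.sqrt_one]
  have hz0 : z ≠ 0 := by rw [← norm_ne_zero_iff, hz1]; exact one_ne_zero
  refine ⟨Complex.arg z, ⟨(Complex.neg_pi_lt_arg z).le, Complex.arg_le_pi z⟩, ?_⟩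
  ext i
  fin_cases i
  · change Real.cos (Complex.arg z) = x 0
    rw [Complex.cos_arg hz0, hz1, div_one]
  · change Real.sin (Complex.arg z) = x 1
    rw [Complex.sin_arg, hz1, div_one]

namespace IsCMCCapillaryFoliation

variable (hψ : IsCMCCapillaryFoliation g X tm tp r j a b ψ N H)
  (hB : IsBoundaryIdentification tm tp r j B)
include hψ hB

lemma contDiffOn_modelCurve (hr : IsProfile tm tp r) :
    ContDiffOn ℝ ∞ (modelCurve j ψ) (cyl a b) := fun _ hy =>
  (hψ.contDiffAt_modelCurve hB hr hy).contDiffWithinAt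

lemma continuousOn_angRate (hr : IsProfile tm tp r) :
    ContinuousOn (fun y => angRate (modelCurve j ψ) y (1, 0)) (cyl a b) := by
  have hq := hψ.contDiffOn_modelCurve hB hr
  have hc : ∀ {f : ℝ × ℝ → 𝔼 3} (i : Fin 3), ContinuousOn f (cyl a b) →
      ContinuousOn (fun y => f y i) (cyl a b) := fun i hf =>
    (EuclideanSpace.proj i : 𝔼 3 →L[ℝ] ℝ).continuous.comp_continuousOn hf
  refine ContinuousOn.div (((hc 0 hq.continuousOn).mul (hc 1 (continuousOn_fderiv_cyl hq))).sub
    ((hc 1 hq.continuousOn).mul (hc 0 (continuousOn_fderiv_cyl hq))))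
    (((hc 0 hq.continuousOn).pow 2).add ((hc 1 hq.continuousOn).pow 2)) fun y hy => ?_
  have := hr.pos _ (hψ.height_mem hB hy)
  change modelCurve j ψ y 0 ^ 2 + modelCurve j ψ y 1 ^ 2 ≠ 0
  rw [hψ.modelCurve_sq hB hy]
  positivity

/-- The boundary curves go around the axis of the model surface. Otherwise one of the meridians
would join the two ends of `∂M` without meeting the curve. -/
lemma two_pi_le_integral_angRate (hr : IsProfile tm tp r) (ht : t ∈ Ioo a b) :
    2 * Real.pi ≤ ∫ α in (-Real.pi)..Real.pi, |angRate (modelCurve j ψ) (α, t) (1, 0)| := by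
  by_contra! hlt
  have hmem : ∀ α : ℝ, (α, t) ∈ cyl a b := fun α => ⟨mem_univ _, ht⟩
  set q : ℝ × ℝ → 𝔼 3 := modelCurve j ψ with hqd
  have hq := hψ.contDiffOn_modelCurve hB hr
  have hproj : ∀ {f : ℝ × ℝ → 𝔼 3} (i : Fin 3), ContinuousOn f (cyl a b) →
      ContinuousOn (fun y => f y i) (cyl a b) := fun i hf =>
    (EuclideanSpace.proj i : 𝔼 3 →L[ℝ] ℝ).continuous.comp_continuousOn hf
  have hne : ∀ y ∈ cyl a b, q y 0 ^ 2 + q y 1 ^ 2 ≠ 0 := fun y hy => by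
    have := hr.pos _ (hψ.height_mem hB hy)
    rw [hψ.modelCurve_sq hB hy]
    positivity
  have hκ : ContinuousOn (fun y => (q y 0 * fderiv ℝ q y (1, 0) 0 + q y 1 * fderiv ℝ q y (1, 0) 1)
      / (q y 0 ^ 2 + q y 1 ^ 2)) (cyl a b) :=
    ContinuousOn.div (((hproj 0 hq.continuousOn).mul (hproj 0 (continuousOn_fderiv_cyl hq))).add
      ((hproj 1 hq.continuousOn).mul (hproj 1 (continuousOn_fderiv_cyl hq))))
      (((hproj 0 hq.continuousOn).pow 2).add ((hproj 1 hq.continuousOn).pow 2)) hne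
  have hz : ∀ α : ℝ, HasDerivAt (fun α => (q (α, t) 0 : ℂ) + q (α, t) 1 * Complex.I)
      ((((q (α, t) 0 * fderiv ℝ q (α, t) (1, 0) 0 + q (α, t) 1 * fderiv ℝ q (α, t) (1, 0) 1)
      / (q (α, t) 0 ^ 2 + q (α, t) 1 ^ 2) : ℝ) + (angRate q (α, t) (1, 0) : ℝ) * Complex.I)
      * ((q (α, t) 0 : ℂ) + q (α, t) 1 * Complex.I)) α := by
    intro α
    have hd := hasDerivAt_slice
      ((hψ.contDiffAt_modelCurve hB hr (hmem α)).differentiableAt (by simp))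
    have hd' : ∀ i : Fin 3, HasDerivAt (fun α => q (α, t) i) (fderiv ℝ q (α, t) (1, 0) i) α :=
      fun i => (EuclideanSpace.proj i : 𝔼 3 →L[ℝ] ℝ).hasFDerivAt.comp_hasDerivAt α hd
    refine HasDerivAt.congr_deriv
      ((hd' 0).ofReal_comp.add ((hd' 1).ofReal_comp.mul_const Complex.I)) ?_
    have h1 := hne _ (hmem α)
    rw [angRate]
    refine Complex.ext ?_ ?_
    · simp only [Complex.add_re, Complex.add_im, Complex.mul_re, Complex.mul_im,
        Complex.ofReal_re, Complex.ofReal_im, Complex.I_re, Complex.I_im, mul_zero,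
        mul_one, add_zero, zero_add, sub_zero]
      field_simp
      ring
    · simp only [Complex.add_re, Complex.add_im, Complex.mul_re, Complex.mul_im,
        Complex.ofReal_re, Complex.ofReal_im, Complex.I_re, Complex.I_im, mul_zero,
        mul_one, add_zero, zero_add, sub_zero]
      field_simp
      ring
  obtain ⟨φ, hφ⟩ := exists_missed_ray (continuous_slice hκ ht)
    (continuous_slice (hψ.continuousOn_angRate hB hr) ht) hz hlt
  obtain ⟨s₀, hs₀, s₁, hs₁, -, hsep⟩ := hψ.separates t ht
  have hmer : ∀ s ∈ Ioo tm tp, (!₂[φ, s] : 𝔼 2) ∈ strip tm tp := fun s hs => hs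
  refine hsep ((fun s : ℝ => B !₂[φ, s]) '' Ioo tm tp) ?_ ?_
    ⟨⟨_, mem_image_of_mem _ hs₀, ?_⟩, ⟨_, mem_image_of_mem _ hs₁, ?_⟩⟩
  · rintro _ ⟨s, hs, rfl⟩
    refine ⟨hB.image ▸ mem_image_of_mem B (hmer s hs), ?_⟩
    rintro ⟨x, hx, hxe⟩
    obtain ⟨α, hα, rfl⟩ := exists_circlePt hx
    have h1 : q (α, t) = modelSurface r !₂[φ, s] := by
      rw [← hB.comp _ (hmer s hs)]
      exact congrArg j hxe
    refine hφ α hα (r s) (hr.pos s hs) ?_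
    have h2 : q (α, t) 0 = r s * Real.cos φ := by rw [h1]; simp [modelSurface]
    have h3 : q (α, t) 1 = r s * Real.sin φ := by rw [h1]; simp [modelSurface]
    rw [h2, h3, Complex.exp_mul_I]
    push_cast
    ring
  · refine isPreconnected_Ioo.image _ (hB.smooth.continuousOn.comp ?_ hmer)
    refine Continuous.continuousOn ?_
    refine (PiLp.continuous_toLp 2 _).comp (continuous_pi fun i => ?_)
    fin_cases i
    · exact continuous_const
    · exact continuous_id
  · change j (B !₂[φ, s₀]) 2 ≤ s₀
    rw [hB.comp _ (hmer s₀ hs₀)]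
    simp [modelSurface]
  · change s₁ ≤ j (B !₂[φ, s₁]) 2
    rw [hB.comp _ (hmer s₁ hs₁)]
    simp [modelSurface]

end IsCMCCapillaryFoliation

end Turning

/-! ### The evolution of the mean curvature -/

section Evolution

/-- Integrals over a compact set of a jointly continuous function are continuous in the
parameter. -/
lemma continuousOn_setIntegral {Y : Type*} [TopologicalSpace Y] [MeasurableSpace Y]
    [OpensMeasurableSpace Y] [SecondCountableTopology Y] [T2Space Y] {μ : Measure Y}
    [IsFiniteMeasureOnCompacts μ] {K : Set Y} (hK : IsCompact K) {a b : ℝ} {f : Y × ℝ → ℝ}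
    (hf : ContinuousOn f (K ×ˢ Ioo a b)) :
    ContinuousOn (fun t => ∫ x in K, f (x, t) ∂μ) (Ioo a b) := by
  intro t ht
  obtain ⟨ε, hε, hsub⟩ := Metric.isOpen_iff.1 isOpen_Ioo t ht
  have hJ : Icc (t - ε / 2) (t + ε / 2) ⊆ Ioo a b := fun s hs => hsub (by
    rw [Metric.mem_ball, Real.dist_eq, abs_lt]
    constructor <;> linarith [hs.1, hs.2])
  have hn : Icc (t - ε / 2) (t + ε / 2) ∈ 𝓝 t := Icc_mem_nhds (by linarith) (by linarith)
  obtain ⟨C, hC⟩ := ((hK.prod isCompact_Icc).bddAbove_image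
    (hf.mono (prod_mono_right hJ)).norm)
  refine ContinuousAt.continuousWithinAt (continuousAt_of_dominated (bound := fun _ => C) ?_ ?_ ?_ ?_)
  · filter_upwards [hn] with s hs
    refine ContinuousOn.aestronglyMeasurable (hf.comp (by fun_prop) fun x hx => ⟨hx, hJ hs⟩)
      hK.measurableSet
  · filter_upwards [hn] with s hs
    exact (ae_restrict_iff' hK.measurableSet).2 (Filter.Eventually.of_forall fun x hx =>
      hC (mem_image_of_mem _ ⟨hx, hs⟩))
  · exact integrableOn_const hK.measure_ne_top
  · refine (ae_restrict_iff' hK.measurableSet).2 (Filter.Eventually.of_forall fun x hx => ?_)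
    have h1 : ContinuousOn (fun s => f (x, s)) (Ioo a b) :=
      hf.comp (by fun_prop) fun s hs => ⟨hx, hs⟩
    exact h1.continuousAt (isOpen_Ioo.mem_nhds ht)

/-- Integration of a pointwise bound in which two of the terms compensate each other. -/
lemma integral_le_of_le_add_sub {F T C A : ℝ → ℝ} {c : ℝ} (hF : Continuous F) (hT : Continuous T)
    (hC : Continuous C) (hA : Continuous A) (hle : ∀ α, F α ≤ T α + C α * c - A α)
    (hTA : ∫ α in (-Real.pi)..Real.pi, T α ≤ ∫ α in (-Real.pi)..Real.pi, A α) :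
    ∫ α in (-Real.pi)..Real.pi, F α ≤ (∫ α in (-Real.pi)..Real.pi, C α) * c := by
  have i1 := hT.intervalIntegrable (μ := volume) (-Real.pi) Real.pi
  have i2 : IntervalIntegrable (fun α => C α * c) volume (-Real.pi) Real.pi :=
    (hC.mul continuous_const).intervalIntegrable _ _
  have i3 := hA.intervalIntegrable (μ := volume) (-Real.pi) Real.pi
  have hm := intervalIntegral.integral_mono_on (by linarith [Real.pi_pos])
    (hF.intervalIntegrable _ _) ((i1.add i2).sub i3) fun α _ => hle α
  rw [intervalIntegral.integral_sub (i1.add i2) i3, intervalIntegral.integral_add i1 i2,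
    intervalIntegral.integral_mul_const] at hm
  linarith

/-- Partial derivatives in the slab are partial derivatives in the disk. -/
lemma fderivWithin_disk_slice {a b t : ℝ} {f : 𝔼 2 × ℝ → ℝ} {x : 𝔼 2} (hx : x ∈ disk)
    (hf : DifferentiableWithinAt ℝ f (slab a b) (x, t)) (ht : t ∈ Ioo a b) (ξ : 𝔼 2) :
    fderivWithin ℝ (fun x => f (x, t)) disk x ξ = fderivWithin ℝ f (slab a b) (x, t) (ξ, 0) := by
  have h1 : HasFDerivWithinAt (fun x : 𝔼 2 => (x, t)) (ContinuousLinearMap.inl ℝ (𝔼 2) ℝ) disk x :=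
    (hasFDerivAt_prodMk_left x t).hasFDerivWithinAt
  have hm : MapsTo (fun x : 𝔼 2 => (x, t)) disk (slab a b) := fun y hy => ⟨hy, ht⟩
  have h2 := (hf.hasFDerivWithinAt.comp x h1 hm).fderivWithin (uniqueDiffOn_disk x hx)
  exact congrArg (fun L : 𝔼 2 →L[ℝ] ℝ => L ξ) h2

variable {M : Type*} [TopologicalSpace M] [ChartedSpace (EuclideanHalfSpace 3) M]
  [IsManifold (𝓡∂ 3) ∞ M]
  {g : Metric3 M} {X : ∀ p : M, TangentSpace (𝓡∂ 3) p} {tm tp : ℝ} {r : ℝ → ℝ}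
  {j : M → 𝔼 3} {B : 𝔼 2 → M} {a b t : ℝ} {ψ : 𝔼 2 × ℝ → M}
  {N : ∀ z, TangentSpace (𝓡∂ 3) (ψ z)} {H : ℝ → ℝ}

namespace IsCMCCapillaryFoliation

variable (hψ : IsCMCCapillaryFoliation g X tm tp r j a b ψ N H)
include hψ

/-- The integral of `1 / v` over a leaf; `chP * chR` is the area density. -/
lemma leafIntegral_inv_speed (ht : t ∈ Ioo a b) :
    leafIntegral g ψ t (fun x => 1 / speed g a b ψ N (x, t))
      = ∫ x in disk, chP (slabMetric g a b ψ) (x, t) * chR (slabMetric g a b ψ) (x, t)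
        / chV (slabMetric g a b ψ) (x, t) := by
  refine setIntegral_congr_fun measurableSet_closedBall fun x hx => ?_
  have hz : (x, t) ∈ slab a b := ⟨hx, ht⟩
  have hf : ∀ k l : Fin 2, firstForm g disk (leaf ψ t) x k l
      = slabMetric g a b ψ k.castSucc l.castSucc (x, t) := by
    intro k l
    change met g (ψ (x, t)) (surfDeriv disk (leaf ψ t) x (vec k))
      (surfDeriv disk (leaf ψ t) x (vec l)) = _
    rw [surfDeriv_leaf hψ.smooth hx ht, surfDeriv_leaf hψ.smooth hx ht, ← slabDir_castSucc,
      ← slabDir_castSucc]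
    rfl
  have hp : IsPosDefOn (slab a b) (slabMetric g a b ψ) := hψ.posDef
  obtain ⟨e1, e2, -, e4, -, -⟩ := chol_eqs hp hz
  have s10 := hp.symm _ hz 1 0
  have hdet : (firstForm g disk (leaf ψ t) x).det
      = (chP (slabMetric g a b ψ) (x, t) * chR (slabMetric g a b ψ) (x, t)) ^ 2 := by
    rw [Matrix.det_fin_two, hf, hf, hf, hf]
    change slabMetric g a b ψ 0 0 (x, t) * slabMetric g a b ψ 1 1 (x, t)
      - slabMetric g a b ψ 0 1 (x, t) * slabMetric g a b ψ 1 0 (x, t) = _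
    rw [s10, e1, e2, e4]
    ring
  have h1 := chP_pos hp hz
  have h2 := chR_pos hp hz
  beta_reduce
  rw [hdet, Real.sqrt_sq (by positivity), (hψ.normal_eq hz).2]
  ring

/-- The integral of `cot γ̄` over the boundary of a leaf; `bl` is the length density. -/
lemma leafBoundaryIntegral_cot (ht : t ∈ Ioo a b) :
    leafBoundaryIntegral g ψ t (fun x => Real.cot (modelAngle r (j (ψ (x, t)))))
      = ∫ α in (-Real.pi)..Real.pi, bl (slabMetric g a b ψ) (α, t)
        * (cosA r (modelCurve j ψ (α, t) 2) / sinA r (modelCurve j ψ (α, t) 2)) := by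
  have hp : IsPosDefOn (slab a b) (slabMetric g a b ψ) := hψ.posDef
  have h1 : ∀ α : ℝ, Real.sqrt (g.inner (leaf ψ t !₂[Real.cos α, Real.sin α])
        (surfDeriv disk (leaf ψ t) !₂[Real.cos α, Real.sin α] !₂[-Real.sin α, Real.cos α])
        (surfDeriv disk (leaf ψ t) !₂[Real.cos α, Real.sin α] !₂[-Real.sin α, Real.cos α]))
      = bl (slabMetric g a b ψ) (α, t) := by
    intro α
    have hy : (α, t) ∈ cyl a b := ⟨mem_univ _, ht⟩
    rw [bl]
    congr 1
    change met g (bdryMap ψ (α, t)) (surfDeriv disk (leaf ψ t) (circlePt α) (circleDir α))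
      (surfDeriv disk (leaf ψ t) (circlePt α) (circleDir α)) = _
    rw [surfDeriv_leaf hψ.smooth (circlePt_mem_disk α) ht]
    have h2 : dm (cyl a b) (bdryMap ψ) (α, t) (1, 0)
        = dm (slab a b) ψ (circlePt α, t) (circleDir α, 0) := by
      rw [hψ.dm_bdryMap hy]
      simp [dcirc, circ]
    rw [← h2, orthonormal_inner (met g (bdryMap ψ (α, t)))
      (fun i => slabFrame g a b ψ i (circ (α, t))) (hψ.inner_slabFrame (circ_mem hy))]
    obtain ⟨t0, t1, t2⟩ := tanComp_eq hp hy (1, 0)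
    simp only [hψ.inner_dm_bdryMap hy, Fin.sum_univ_three, t0, t1, t2]
    ring
  have h3 : ∀ α : ℝ, Real.cot (modelAngle r (j (ψ (!₂[Real.cos α, Real.sin α], t))))
      = cosA r (modelCurve j ψ (α, t) 2) / sinA r (modelCurve j ψ (α, t) 2) := fun α =>
    cot_modelAngle r _
  have hper : Function.Periodic (fun α => bl (slabMetric g a b ψ) (α, t)
        * (cosA r (modelCurve j ψ (α, t) 2) / sinA r (modelCurve j ψ (α, t) 2))) (2 * Real.pi) := by
    intro α
    have hc : circ (α + 2 * Real.pi, t) = circ (α, t) := by simp [circ, circlePt]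
    simp [bl, bw0, bw1, modelCurve, bdryMap, hc]
  have h4 := hper.intervalIntegral_add_eq (-Real.pi) 0
  rw [zero_add, show -Real.pi + 2 * Real.pi = Real.pi by ring] at h4
  rw [h4, leafBoundaryIntegral]
  simp only [h1, h3]
  exact intervalIntegral.integral_congr fun α _ => mul_comm _ _

lemma continuousOn_areaDensity : ContinuousOn (fun z => chP (slabMetric g a b ψ) z
    * chR (slabMetric g a b ψ) z / chV (slabMetric g a b ψ) z) (slab a b) := by
  have hp : IsPosDefOn (slab a b) (slabMetric g a b ψ) := hψ.posDef
  obtain ⟨a1, a2, a3, a4, a5, a6⟩ := contDiffOn_chol hψ.isMovingFrame.smooth hp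
  exact (a1.continuousOn.mul a3.continuousOn).div a6.continuousOn fun z hz => (chV_pos hp hz).ne'

lemma integral_areaDensity_pos (ht : t ∈ Ioo a b) :
    0 < ∫ x in disk, chP (slabMetric g a b ψ) (x, t) * chR (slabMetric g a b ψ) (x, t)
        / chV (slabMetric g a b ψ) (x, t) := by
  have hp : IsPosDefOn (slab a b) (slabMetric g a b ψ) := hψ.posDef
  have hpos : ∀ x ∈ disk, 0 < chP (slabMetric g a b ψ) (x, t) * chR (slabMetric g a b ψ) (x, t)
        / chV (slabMetric g a b ψ) (x, t) := fun x hx =>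
    div_pos (mul_pos (chP_pos hp ⟨hx, ht⟩) (chR_pos hp ⟨hx, ht⟩)) (chV_pos hp ⟨hx, ht⟩)
  have hc : ContinuousOn (fun x => chP (slabMetric g a b ψ) (x, t)
      * chR (slabMetric g a b ψ) (x, t) / chV (slabMetric g a b ψ) (x, t)) disk :=
    hψ.continuousOn_areaDensity.comp (by fun_prop) fun x hx => ⟨hx, ht⟩
  have hmd : MeasurableSet disk := measurableSet_closedBall
  rw [setIntegral_pos_iff_support_of_nonneg_ae
    ((ae_restrict_iff' hmd).2 (Filter.Eventually.of_forall fun x hx => (hpos x hx).le))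
    (hc.integrableOn_compact (isCompact_closedBall _ _))]
  refine lt_of_lt_of_le (Metric.measure_ball_pos volume (0 : 𝔼 2) one_pos) (measure_mono ?_)
  exact fun x hx => ⟨(hpos x (Metric.ball_subset_closedBall hx)).ne',
    Metric.ball_subset_closedBall hx⟩

variable (hB : IsBoundaryIdentification tm tp r j B)
include hB

lemma continuousOn_cot (hr : IsProfile tm tp r) :
    ContinuousOn (fun y => bl (slabMetric g a b ψ) y
      * (cosA r (modelCurve j ψ y 2) / sinA r (modelCurve j ψ y 2))) (cyl a b) := by
  have hq : ContinuousOn (fun y => modelCurve j ψ y 2) (cyl a b) :=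
    (EuclideanSpace.proj (2 : Fin 3) : 𝔼 3 →L[ℝ] ℝ).continuous.comp_continuousOn
      (hψ.contDiffOn_modelCurve hB hr).continuousOn
  have hm : MapsTo (fun y => modelCurve j ψ y 2) (cyl a b) (Ioo tm tp) := fun y hy =>
    hψ.height_mem hB hy
  have hc : ContinuousOn (cosA r) (Ioo tm tp) := fun s hs =>
    (hr.hasDerivAt_cosA hs).continuousAt.continuousWithinAt
  have hs : ContinuousOn (sinA r) (Ioo tm tp) := fun s hs =>
    (hr.hasDerivAt_sinA hs).continuousAt.continuousWithinAt
  exact (contDiffOn_bl hψ.isMovingFrame.smooth hψ.posDef).continuousOn.mul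
    ((hc.comp hq hm).div (hs.comp hq hm) fun y hy => (sinA_pos r _).ne')

lemma continuousOn_Psi (hr : IsProfile tm tp r) : ContinuousOn (Psi g r j a b ψ N) (Ioo a b) := by
  have h1 : ContinuousOn (fun t => ∫ x in disk, chP (slabMetric g a b ψ) (x, t)
      * chR (slabMetric g a b ψ) (x, t) / chV (slabMetric g a b ψ) (x, t)) (Ioo a b) :=
    continuousOn_setIntegral (isCompact_closedBall _ _) hψ.continuousOn_areaDensity
  have h2 : ContinuousOn (fun t => ∫ α in Icc (-Real.pi) Real.pi, bl (slabMetric g a b ψ) (α, t)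
        * (cosA r (modelCurve j ψ (α, t) 2) / sinA r (modelCurve j ψ (α, t) 2))) (Ioo a b) :=
    continuousOn_setIntegral (f := fun y => bl (slabMetric g a b ψ) y
      * (cosA r (modelCurve j ψ y 2) / sinA r (modelCurve j ψ y 2))) isCompact_Icc
      ((hψ.continuousOn_cot hB hr).mono (prod_mono_left (subset_univ _)))
  refine ((h1.inv₀ fun t ht => (hψ.integral_areaDensity_pos ht).ne').mul h2).congr fun t ht => ?_
  rw [Psi, hψ.leafIntegral_inv_speed ht, hψ.leafBoundaryIntegral_cot ht,
    intervalIntegral.integral_of_le (by linarith [Real.pi_pos]),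
    ← integral_Icc_eq_integral_Ioc]
  rfl

omit hB in
/-- The divergence theorem on a leaf. -/
lemma deriv_mean_mul_le_integral_flux (hR : ∀ p : M, 0 ≤ scalarCurvature g p)
    (ht : t ∈ Ioo a b) :
    deriv H t * ∫ x in disk, chP (slabMetric g a b ψ) (x, t) * chR (slabMetric g a b ψ) (x, t)
        / chV (slabMetric g a b ψ) (x, t)
      ≤ ∫ α in (-Real.pi)..Real.pi,
        (flux0 (slab a b) slabDir (slabMetric g a b ψ) (circ (α, t)) * Real.cos α
          + flux1 (slab a b) slabDir (slabMetric g a b ψ) (circ (α, t)) * Real.sin α) := by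
  have hmaps : MapsTo (fun x : 𝔼 2 => (x, t)) disk (slab a b) := fun x hx => ⟨hx, ht⟩
  have hdens := hψ.continuousOn_areaDensity.comp (f := fun x : 𝔼 2 => (x, t)) (by fun_prop) hmaps
  have s0 := hψ.isMovingFrame.smooth_flux0
  have s1 := hψ.isMovingFrame.smooth_flux1
  have hle : ∀ x ∈ disk, _ := fun x hx => hψ.deriv_mean_le hR (hmaps hx)
  generalize slabMetric g a b ψ = h at *
  generalize flux0 (slab a b) slabDir h = F0 at *
  generalize flux1 (slab a b) slabDir h = F1 at *
  have k0 : ContDiffOn ℝ 1 (fun x => F0 (x, t)) disk :=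
    (s0.of_le (by simp)).comp (by fun_prop) hmaps
  have k1 : ContDiffOn ℝ 1 (fun x => F1 (x, t)) disk :=
    (s1.of_le (by simp)).comp (by fun_prop) hmaps
  refine le_trans ?_ (integral_divergence_disk k0 k1).le
  rw [← integral_const_mul]
  refine setIntegral_mono_on
    ((continuousOn_const.mul hdens).integrableOn_compact (isCompact_closedBall _ _))
    (ContinuousOn.integrableOn_compact (isCompact_closedBall _ _) ?_) measurableSet_closedBall
    fun x hx => ?_
  · exact ((k0.continuousOn_fderivWithin uniqueDiffOn_disk le_rfl).clm_apply
      continuousOn_const).add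
      ((k1.continuousOn_fderivWithin uniqueDiffOn_disk le_rfl).clm_apply continuousOn_const)
  · refine (hle x hx).trans (le_of_eq ?_)
    rw [fderivWithin_disk_slice hx ((s0 _ (hmaps hx)).differentiableWithinAt (by simp)) ht,
      fderivWithin_disk_slice hx ((s1 _ (hmaps hx)).differentiableWithinAt (by simp)) ht]
    rfl

/-- The flux through the boundary of a leaf, where the total turning `2π` of the frame is
compensated by the rotation of the boundary curve around the axis. -/
lemma integral_flux_le (hr : IsProfile tm tp r)
    (hX : ∀ p ∈ (𝓡∂ 3).boundary M, IsOutwardUnitNormal g p (X p))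
    (hσ : MetricComparison g tm tp r B) (hH : MeanCurvatureComparison g X tm tp r B)
    (ht : t ∈ Ioo a b) :
    ∫ α in (-Real.pi)..Real.pi,
        (flux0 (slab a b) slabDir (slabMetric g a b ψ) (circ (α, t)) * Real.cos α
          + flux1 (slab a b) slabDir (slabMetric g a b ψ) (circ (α, t)) * Real.sin α)
      ≤ (∫ α in (-Real.pi)..Real.pi, bl (slabMetric g a b ψ) (α, t)
        * (cosA r (modelCurve j ψ (α, t) 2) / sinA r (modelCurve j ψ (α, t) 2))) * H t := by
  have hmem : ∀ α : ℝ, (α, t) ∈ cyl a b := fun α => ⟨mem_univ _, ht⟩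
  have hflux := fun α => hψ.flux_le hB hr hX hσ hH (hmem α)
  have hcot := continuous_slice (hψ.continuousOn_cot hB hr) ht
  have hang := continuous_slice (hψ.continuousOn_angRate hB hr) ht
  have hrot := hψ.two_pi_le_integral_angRate hB hr ht
  have hsm := hψ.isMovingFrame.smooth
  have hpd := hψ.posDef
  have s0 := hψ.isMovingFrame.smooth_flux0
  have s1 := hψ.isMovingFrame.smooth_flux1
  have hturn := integral_turn hsm hpd ht
  obtain ⟨c0, c1⟩ := contDiffOn_be hsm hpd
  have hturnc : Continuous fun α => turn (slabMetric g a b ψ) (α, t) :=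
    continuous_slice (f := turn (slabMetric g a b ψ))
      ((c0.continuousOn.mul (continuousOn_fderiv_cyl c1)).sub
        (c1.continuousOn.mul (continuousOn_fderiv_cyl c0))) ht
  have hcirc : Continuous fun α : ℝ => circ (α, t) :=
    contDiff_circ.continuous.comp (by fun_prop)
  have e0 := s0.continuousOn.comp_continuous hcirc fun α => circ_mem (hmem α)
  have e1 := s1.continuousOn.comp_continuous hcirc fun α => circ_mem (hmem α)
  exact integral_le_of_le_add_sub ((e0.mul Real.continuous_cos).add (e1.mul Real.continuous_sin))
    hturnc hcot hang.abs hflux (hturn.le.trans hrot)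

/-- The differential inequality for the mean curvature of the leaves. -/
lemma deriv_mean_le_Psi_mul (hR : ∀ p : M, 0 ≤ scalarCurvature g p) (hr : IsProfile tm tp r)
    (hX : ∀ p ∈ (𝓡∂ 3).boundary M, IsOutwardUnitNormal g p (X p))
    (hσ : MetricComparison g tm tp r B) (hH : MeanCurvatureComparison g X tm tp r B)
    (ht : t ∈ Ioo a b) : deriv H t ≤ Psi g r j a b ψ N t * H t := by
  have h1 := hψ.deriv_mean_mul_le_integral_flux hR ht
  have h2 := hψ.integral_flux_le hB hr hX hσ hH ht
  have hI := hψ.integral_areaDensity_pos ht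
  rw [Psi, hψ.leafIntegral_inv_speed ht, hψ.leafBoundaryIntegral_cot ht, mul_assoc,
    ← div_eq_inv_mul, le_div_iff₀ hI]
  exact h1.trans h2

end IsCMCCapillaryFoliation

/-- The monotonicity that follows from `H' ≤ Ψ H`. -/
lemma deriv_exp_integral_mul {Ψ H : ℝ → ℝ} {a b t : ℝ} (ha : a < 0) (hb : 0 < b)
    (hΨ : ContinuousOn Ψ (Ioo a b)) (ht : t ∈ Ioo a b) (hH : DifferentiableAt ℝ H t)
    (hle : deriv H t ≤ Ψ t * H t) :
    DifferentiableAt ℝ (fun t => Real.exp (-∫ τ in (0 : ℝ)..t, Ψ τ) * H t) t ∧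
      deriv (fun t => Real.exp (-∫ τ in (0 : ℝ)..t, Ψ τ) * H t) t ≤ 0 := by
  have hsub : uIcc 0 t ⊆ Ioo a b := (ordConnected_Ioo.uIcc_subset ⟨ha, hb⟩ ht)
  have hint : HasDerivAt (fun t => ∫ τ in (0 : ℝ)..t, Ψ τ) (Ψ t) t :=
    intervalIntegral.integral_hasDerivAt_right ((hΨ.mono hsub).intervalIntegrable)
      (hΨ.stronglyMeasurableAtFilter isOpen_Ioo t ht) (hΨ.continuousAt (isOpen_Ioo.mem_nhds ht))
  have h1 := hint.neg.exp.mul hH.hasDerivAt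
  refine ⟨h1.differentiableAt, ?_⟩
  refine le_of_eq_of_le h1.deriv ?_
  have h2 := Real.exp_pos (-∫ τ in (0 : ℝ)..t, Ψ τ)
  have h3 : Real.exp (-∫ τ in (0 : ℝ)..t, Ψ τ) * (deriv H t - Ψ t * H t) ≤ 0 :=
    mul_nonpos_of_nonneg_of_nonpos h2.le (by linarith)
  simp only [Pi.neg_apply]
  linarith

end Evolution

end Capillary

end

theorem theorem3p5 {M : Type*} [TopologicalSpace M] [T2Space M]
    [ChartedSpace (EuclideanHalfSpace 3) M] [IsManifold (𝓡∂ 3) ∞ M]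
    (g : Metric3 M) (hR : ∀ p : M, 0 ≤ scalarCurvature g p)
    (tm tp : ℝ) (r : ℝ → ℝ) (hr : IsProfile tm tp r)
    (j : M → 𝔼 3) (B : 𝔼 2 → M) (hB : IsBoundaryIdentification tm tp r j B)
    (X : ∀ p : M, TangentSpace (𝓡∂ 3) p)
    (hX : ∀ p ∈ (𝓡∂ 3).boundary M, IsOutwardUnitNormal g p (X p))
    (hσ : MetricComparison g tm tp r B)
    (hH : MeanCurvatureComparison g X tm tp r B)
    (a b : ℝ) (ha : a < 0) (hb : 0 < b)
    (ψ : 𝔼 2 × ℝ → M) (N : ∀ z, TangentSpace (𝓡∂ 3) (ψ z)) (H : ℝ → ℝ)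
    (hψ : IsCMCCapillaryFoliation g X tm tp r j a b ψ N H) :
    ContinuousOn (Psi g r j a b ψ N) (Ioo a b) ∧
    ∀ t ∈ Ioo a b,
      DifferentiableAt ℝ
        (fun t => Real.exp (-∫ τ in (0 : ℝ)..t, Psi g r j a b ψ N τ) * H t) t ∧
      deriv (fun t => Real.exp (-∫ τ in (0 : ℝ)..t, Psi g r j a b ψ N τ) * H t) t ≤ 0 := by
  have hΨ := hψ.continuousOn_Psi hB hr
  refine ⟨hΨ, fun t ht => deriv_exp_integral_mul ha hb hΨ ht ?_
    (hψ.deriv_mean_le_Psi_mul hB hR hr hX hσ hH ht)⟩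
  exact (hψ.contDiffOn_H.contDiffAt (isOpen_Ioo.mem_nhds ht)).differentiableAt (by simp)
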